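/- Let $\lambda$ be an uncountable cardinal with $\lambda^{<\lambda}=\lambda$ and let $\kappa=\lambda^+$. Write $S^\kappa_\lambda=\{\delta<\kappa:\mathrm{cf}(\delta)=\lambda\}$, let $S_0\subseteq S^\kappa_\lambda$ be stationary in $\kappa$ and put $S=S^\kappa_\lambda\setminus S_0$. Let $\hat{\mathcal S}_1$ be the set of all (strictly) increasing continuous sequences $\bar a=\langle a_i:i\le\lambda\rangle$ of ordinals below $\kappa$ with $a_i\in S_0$ for every non-limit $i$. For a set $C$ of ordinals let $\mathrm{nacc}(C)$ be the set of those $\alpha\in C$ that are not limits of elements of $C$. Let $\bar C=\langle C_\delta:\delta\in S\rangle$ be such that each $C_\delta$ is a club of $\delta$ of order type $\lambda$ with $\mathrm{nacc}(C_\delta)\cap S_0=\emptyset$ (for instance, $\mathrm{cf}(\alpha)<\lambda$ for all $\alpha\in\mathrm{nacc}(C_\delta)$), and let $\bar h=\langle h_\delta:\delta\in S\rangle$ with $h_\delta:C_\delta\to\lambda$. For each $\bar a\in\hat{\mathcal S}_1$ let $D_{\bar a}$ be the club filter of $\lambda$ or any (proper) normal filter on $\lambda$ (one that contains all end segments and is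 closed under diagonal intersections). In forcing notions larger conditions are stronger. The conditions of $\mathbb Q^1_{\bar C}$ are the closed subsets $e$ of $\kappa$ with $\alpha_e=\sup(e)<\kappa$ such that $e\cap\mathrm{nacc}(C_\delta)$ is bounded in $\delta$ for all $\delta\in S\cap(\alpha_e+1)$; $e_0\le e_1$ iff $e_0$ is an initial segment of $e_1$. The conditions of $\mathbb Q^2_{\bar C,\bar h}$ are the functions $f:\alpha_f\to\lambda$, $\alpha_f<\kappa$, such that $\{\beta\in C_\delta:h_\delta(\beta)=f(\beta)\}$ is co-bounded in $C_\delta$ for all $\delta\in S\cap(\alpha_f+1)$; the order is inclusion. Below, "for most $N$ (or $\bar N$)" means: for every large enough regular $\chi$ and every well-ordering $<^*_\chi$ of $H(\chi)$ there is $x\in H(\chi)$ such that the assertion holds for all $N\prec(H(\chi),\in,<^*_\chi)$ as described with $x\in N$ (respectively, all sequences $\bar N$ as described of elementary submodels of $(H(\chi),\in,<^*_\chi)$ with $x\in N_0$). A sequence of conditions is generic over $N$ if it meets every open dense subset of $\mathbb Q$ that belongs to $N$. A forcing notion $\mathbb Q$ is really $(S_0,\hat{\mathcal S}_1,D)$-complete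 if: ($\alpha$) $\mathbb Q$ is $(<\lambda)$-complete: every increasing sequence of conditions of length $<\lambda$ has an upper bound. ($\beta$) $\mathbb Q$ is strongly $S_0$-complete: for most $N$ with $\|N\|=\lambda$, $N^{<\lambda}\subseteq N$, $N\cap\kappa\in S_0$ and $\mathbb Q\in N$, every increasing sequence $\langle p_i:i<\lambda\rangle\subseteq\mathbb Q\cap N$ that is generic over $N$ has an upper bound in $\mathbb Q$. ($\gamma$) For most increasing continuous sequences $\bar N=\langle N_i:i\le\lambda\rangle$ such that $\lambda\cup\{\lambda,\kappa,\mathbb Q\}\subseteq N_0$, $\|N_i\|<\kappa$ for all $i\le\lambda$ and $\langle N_j:j\le i\rangle\in N_{i+1}$ for all $i<\lambda$: whenever $\bar a\in\hat{\mathcal S}_1$ and $X\in D_{\bar a}$ are such that $N_{i+1}^{<\lambda}\subseteq N_{i+1}$ and $N_{i+1}\cap\kappa=a_{i+1}$ for all $i\in X$, and $r\in N_0\cap\mathbb Q$, the player INC has no winning strategy in the following game of length $\lambda$. At stage $i<\lambda$, COM chooses $\zeta_i\in X$ with $\zeta_i>\zeta_j$ for all $j<i$, and then $p_i\in N_{\zeta_i+1}\cap\mathbb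 Q$ with $r\le p_i$ and $q_{j,\xi}\le p_i$ for all $j<i$, $\xi<\lambda$; INC answers with an increasing sequence $\bar q_i=\langle q_{i,\xi}:\xi<\lambda\rangle\subseteq N_{\zeta_i+1}\cap\mathbb Q$, generic over $N_{\zeta_i+1}$, with $p_i\le q_{i,0}$ and $\bar q_i\in N_{\zeta_i+2}$. COM wins the play if $\{\zeta_i:i<\lambda\}\in D_{\bar a}$ and $\langle p_i:i<\lambda\rangle$ has an upper bound in $\mathbb Q$. Then: (1) $\mathbb Q^1_{\bar C}$ is really $(S_0,\hat{\mathcal S}_1,D)$-complete; in particular it is $(<\lambda)$-complete and strongly $S_0$-complete. (2) $\mathbb Q^2_{\bar C,\bar h}$ is really $(S_0,\hat{\mathcal S}_1,D)$-complete. (3) $\mathbb Q^1_{\bar C}$ adds a club of $\kappa$ meeting each $\mathrm{nacc}(C_\delta)$ boundedly: it forces that the union $E$ of the generic filter is a club of $\kappa$ and that $E\cap\mathrm{nacc}(C_\delta)$ is bounded in $\delta$ for every $\delta\in S$. -/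

import Mathlib

universe u

open Set

noncomputable section

namespace ReallyComplete

/-! ### Coding of ordinals and sequences as sets -/

/-- The set-theoretic sequence `⟨f ξ : ξ < α⟩`, i.e. the function with domain the
von Neumann ordinal `α` and value `f ξ` at `ξ`. -/
def seqCode (α : Ordinal.{u}) (f : Ordinal.{u} → ZFSet.{u}) : ZFSet.{u} :=
  ZFSet.range (fun ξ : Iio α => ZFSet.pair ξ.1.toZFSet (f ξ.1))

/-- The class of ordinals which (as von Neumann ordinals) belong to `x`. -/
def ordSet (x : ZFSet.{u}) : Set Ordinal.{u} := {α | α.toZFSet ∈ x}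

/-- `N ∩ μ`, as a set of ordinals. -/
def trace (N : ZFSet.{u}) (μ : Cardinal.{u}) : Set Ordinal.{u} := ordSet N ∩ Iio μ.ord

/-- `A` is bounded in `δ`. -/
def BoundedIn (A : Set Ordinal.{u}) (δ : Ordinal.{u}) : Prop :=
  ∃ β < δ, ∀ γ ∈ A, γ < δ → γ ≤ β

/-- `nacc(C)`: the elements of `C` which are not limits of elements of `C`. -/
def nacc (C : Set Ordinal.{u}) : Set Ordinal.{u} :=
  {α | α ∈ C ∧ ¬ (α ≠ 0 ∧ ∀ β < α, ∃ γ ∈ C, β < γ ∧ γ < α)}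

/-! ### The structures `(H(χ), ∈, <*)` and their elementary submodels -/

/-- `x ∈ H(χ)`: hereditarily of cardinality less than `χ`. -/
def InH (χ : Cardinal.{u}) (x : ZFSet.{u}) : Prop := ZFSet.Hereditarily (fun y => y.card < χ) x

/-- `H(χ)`. -/
abbrev HSet (χ : Cardinal.{u}) : Type (u + 1) := {x : ZFSet.{u} // InH χ x}

/-- The relation symbols of the language with two binary relations, for `∈` and `<*`. -/
inductive SetRel : ℕ → Type
  | mem : SetRel 2
  | wo : SetRel 2

/-- The language of `(H(χ), ∈, <*)`. -/
def setLang : FirstOrder.Language := ⟨fun _ => Empty, SetRel⟩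

/-- The universe of the structure `(H(χ), ∈, W)`. -/
def HModel (χ : Cardinal.{u}) (_W : HSet χ → HSet χ → Prop) : Type (u + 1) := HSet χ

instance (χ : Cardinal.{u}) (W : HSet χ → HSet χ → Prop) : setLang.Structure (HModel χ W) where
  funMap := fun f => Empty.elim f
  RelMap := fun r =>
    match r with
    | SetRel.mem => fun v => (show HSet χ from v 0).1 ∈ (show HSet χ from v 1).1
    | SetRel.wo => fun v => W (v 0) (v 1)

/-- `N ≺ (H(χ), ∈, W)`. -/
def IsElemSubmodel (χ : Cardinal.{u}) (W : HSet χ → HSet χ → Prop) (N : ZFSet.{u}) : Prop :=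
  ∃ M : setLang.ElementarySubstructure (HModel χ W),
    ∀ y : ZFSet.{u}, y ∈ N ↔ ∃ hy : InH χ y, (show HModel χ W from ⟨y, hy⟩) ∈ M

/-- `N^{<lam} ⊆ N`. -/
def ClosedLT (lam : Cardinal.{u}) (N : ZFSet.{u}) : Prop :=
  ∀ α < lam.ord, ∀ f : Ordinal.{u} → ZFSet.{u}, (∀ ξ < α, f ξ ∈ N) → seqCode α f ∈ N

/-! ### Forcing notions -/

/-- A forcing notion: a partial order (which is a set); larger conditions are stronger. -/
structure ForcingNotion where
  carrier : ZFSet.{u}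
  le : ZFSet.{u} → ZFSet.{u} → Prop
  le_refl : ∀ p ∈ carrier, le p p
  le_trans : ∀ p ∈ carrier, ∀ q ∈ carrier, ∀ r ∈ carrier, le p q → le q r → le p r
  le_antisymm : ∀ p ∈ carrier, ∀ q ∈ carrier, le p q → le q p → p = q

namespace ForcingNotion

variable (Q : ForcingNotion.{u})

/-- The forcing notion as a set: the pair of its set of conditions and its order relation. -/
def code : ZFSet.{u} :=
  ZFSet.pair Q.carrier (ZFSet.pairSep (fun p q => Q.le p q) Q.carrier Q.carrier)

/-- `⟨p i : i < θ⟩` is an increasing sequence of conditions. -/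
def Increasing (θ : Ordinal.{u}) (p : Ordinal.{u} → ZFSet.{u}) : Prop :=
  (∀ i < θ, p i ∈ Q.carrier) ∧ ∀ i j, i ≤ j → j < θ → Q.le (p i) (p j)

/-- `⟨p i : i < θ⟩` has an upper bound. -/
def HasUpperBound (θ : Ordinal.{u}) (p : Ordinal.{u} → ZFSet.{u}) : Prop :=
  ∃ b ∈ Q.carrier, ∀ i < θ, Q.le (p i) b

/-- `(<θ)`-completeness. -/
def IsLTComplete (θ : Ordinal.{u}) : Prop :=
  ∀ δ < θ, ∀ p : Ordinal.{u} → ZFSet.{u}, Q.Increasing δ p → Q.HasUpperBound δ p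

/-- `I` is an open dense set of conditions. -/
def OpenDense (I : ZFSet.{u}) : Prop :=
  I ⊆ Q.carrier ∧ (∀ p ∈ I, ∀ q ∈ Q.carrier, Q.le p q → q ∈ I) ∧
    ∀ p ∈ Q.carrier, ∃ q ∈ I, Q.le p q

/-- `⟨p i : i < θ⟩` is an increasing sequence of elements of `Q ∩ N`, generic over `N`. -/
def GenericSeq (N : ZFSet.{u}) (θ : Ordinal.{u}) (p : Ordinal.{u} → ZFSet.{u}) : Prop :=
  Q.Increasing θ p ∧ (∀ i < θ, p i ∈ N) ∧
    ∀ I ∈ N, Q.OpenDense I → ∃ i < θ, p i ∈ I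

end ForcingNotion

/-! ### Strong completeness -/

/-- `N` is `(lam, 𝒮)`-good, where `𝒮` is a family of subsets of `μ`
(elementarity is stated separately). -/
def IsGood (lam μ : Cardinal.{u}) (𝒮 : Set (Set Ordinal.{u})) (N : ZFSet.{u}) : Prop :=
  N.card = lam ∧ ClosedLT lam N ∧ trace N μ ∈ 𝒮

/-- `Q` is strongly `𝒮`-complete: for every large enough regular `χ` there is a witness `x ∈ H(χ)`
such that for every good `N ≺ (H(χ), ∈, <*)` with `x, Q ∈ N`, every increasing sequence of length
`lam` in `Q ∩ N` which is generic over `N` has an upper bound. -/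
def StronglyComplete (lam μ : Cardinal.{u}) (𝒮 : Set (Set Ordinal.{u}))
    (Q : ForcingNotion.{u}) : Prop :=
  ∃ χ₀ : Cardinal.{u}, ∀ χ : Cardinal.{u}, χ₀ ≤ χ → χ.IsRegular →
    ∀ W : HSet χ → HSet χ → Prop, IsWellOrder (HSet χ) W →
      ∃ x : ZFSet.{u}, InH χ x ∧
        ∀ N : ZFSet.{u}, IsElemSubmodel χ W N → IsGood lam μ 𝒮 N → x ∈ N → Q.code ∈ N →
          ∀ p : Ordinal.{u} → ZFSet.{u}, Q.GenericSeq N lam.ord p → Q.HasUpperBound lam.ord p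

/-! ### Real completeness -/

/-- Sequences `⟨a i : i ≤ lam⟩` of sets of ordinals. -/
abbrev OrdSetSeq (lam : Cardinal.{u}) : Type (u + 1) := Iic lam.ord → Set Ordinal.{u}

/-- The index `i + 1 ≤ lam`, for `i < lam`. -/
def succIdx {lam : Cardinal.{u}} (i : Iio lam.ord) : Iic lam.ord :=
  ⟨Order.succ i.1, Set.mem_Iic.2 (Order.succ_le_of_lt (Set.mem_Iio.1 i.2))⟩

/-- `(a, X)` is a suitable base for `⟨N i : i ≤ lam⟩`; here `S₁` is a family of sequences of subsets
of `μ` and `D` assigns filters on `lam` to the sequences from `S₁`. -/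
def IsSuitableBase (lam μ : Cardinal.{u}) (S₁ : Set (OrdSetSeq lam))
    (D : OrdSetSeq lam → Filter (Iio lam.ord)) (N : Ordinal.{u} → ZFSet.{u})
    (a : OrdSetSeq lam) (X : Set (Iio lam.ord)) : Prop :=
  a ∈ S₁ ∧ X ∈ D a ∧ ∀ i ∈ X,
    ClosedLT lam (N (Order.succ i.1)) ∧ trace (N (Order.succ i.1)) μ = a (succIdx i)

/-- `⟨N i : i ≤ lam⟩` is a `(lam, κ, S₁, D, Q)`-suitable sequence of elementary submodels of
`(H(χ), ∈, W)`. Only the values `N i` for `i ≤ lam` matter. -/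
structure IsSuitable (lam κ μ : Cardinal.{u}) (S₁ : Set (OrdSetSeq lam))
    (D : OrdSetSeq lam → Filter (Iio lam.ord)) (Q : ForcingNotion.{u})
    (χ : Cardinal.{u}) (W : HSet χ → HSet χ → Prop) (N : Ordinal.{u} → ZFSet.{u}) : Prop where
  elem : ∀ i ≤ lam.ord, IsElemSubmodel χ W (N i)
  increasing : ∀ i j, i ≤ j → j ≤ lam.ord → N i ⊆ N j
  continuous : ∀ i ≤ lam.ord, Order.IsSuccLimit i → ∀ y ∈ N i, ∃ j < i, y ∈ N j
  ords_mem : ∀ ξ < lam.ord, ξ.toZFSet ∈ N 0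
  lam_mem : lam.ord.toZFSet ∈ N 0
  kappa_mem : κ.ord.toZFSet ∈ N 0
  forcing_mem : Q.code ∈ N 0
  card_lt : ∀ i ≤ lam.ord, (N i).card < κ
  seq_mem : ∀ i < lam.ord, seqCode (Order.succ i) N ∈ N (Order.succ i)
  base : ∃ a X, IsSuitableBase lam μ S₁ D N a X

/-! The game: at stage `i < lam`, COM plays `ζ i ∈ X` and a condition `p i`, and INC answers with a
sequence `q i = ⟨q i ξ : ξ < lam⟩`. -/

/-- COM's move `(ζ i, p i)` at stage `i` is legal. -/
def ComLegal (lam : Cardinal.{u}) (Q : ForcingNotion.{u}) (N : Ordinal.{u} → ZFSet.{u})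
    (X : Set (Iio lam.ord)) (r : ZFSet.{u}) (ζ : Ordinal.{u} → Iio lam.ord)
    (p : Ordinal.{u} → ZFSet.{u}) (q : Ordinal.{u} → Ordinal.{u} → ZFSet.{u})
    (i : Ordinal.{u}) : Prop :=
  ζ i ∈ X ∧ (∀ j < i, ζ j < ζ i) ∧ p i ∈ N (Order.succ (ζ i).1) ∧ p i ∈ Q.carrier ∧
    Q.le r (p i) ∧ ∀ j < i, ∀ ξ < lam.ord, Q.le (q j ξ) (p i)

/-- INC's answer `q i` at stage `i` is legal. -/
def IncLegal (lam : Cardinal.{u}) (Q : ForcingNotion.{u}) (N : Ordinal.{u} → ZFSet.{u})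
    (ζ : Ordinal.{u} → Iio lam.ord) (p : Ordinal.{u} → ZFSet.{u})
    (q : Ordinal.{u} → Ordinal.{u} → ZFSet.{u}) (i : Ordinal.{u}) : Prop :=
  Q.GenericSeq (N (Order.succ (ζ i).1)) lam.ord (q i) ∧ Q.le (p i) (q i 0) ∧
    seqCode lam.ord (q i) ∈ N (Order.succ (Order.succ (ζ i).1))

/-- COM wins a complete play. -/
def ComWins (lam : Cardinal.{u}) (Q : ForcingNotion.{u}) (F : Filter (Iio lam.ord))
    (ζ : Ordinal.{u} → Iio lam.ord) (p : Ordinal.{u} → ZFSet.{u}) : Prop :=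
  {z | ∃ i < lam.ord, ζ i = z} ∈ F ∧ Q.HasUpperBound lam.ord p

/-- A strategy of INC: to a stage `i` and the moves of COM at the stages `j ≤ i` it assigns a
sequence of conditions. -/
abbrev IncStrategy (lam : Cardinal.{u}) : Type (u + 1) :=
  (i : Ordinal.{u}) → (Iic i → Iio lam.ord × ZFSet.{u}) → (Ordinal.{u} → ZFSet.{u})

/-- The answers given by a strategy of INC to the moves `(ζ, p)` of COM. -/
def IncStrategy.answer {lam : Cardinal.{u}} (σ : IncStrategy lam)
    (ζ : Ordinal.{u} → Iio lam.ord) (p : Ordinal.{u} → ZFSet.{u}) :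
    Ordinal.{u} → Ordinal.{u} → ZFSet.{u} :=
  fun i => σ i (fun j => (ζ j.1, p j.1))

/-- INC has a winning strategy: a strategy whose answer is legal as long as COM has played legally,
and such that COM wins no complete play in which INC follows it. -/
def IncHasWinningStrategy (lam : Cardinal.{u}) (Q : ForcingNotion.{u})
    (N : Ordinal.{u} → ZFSet.{u}) (F : Filter (Iio lam.ord)) (X : Set (Iio lam.ord))
    (r : ZFSet.{u}) : Prop :=
  ∃ σ : IncStrategy lam, ∀ (ζ : Ordinal.{u} → Iio lam.ord) (p : Ordinal.{u} → ZFSet.{u}),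
    (∀ i < lam.ord, (∀ j ≤ i, ComLegal lam Q N X r ζ p (σ.answer ζ p) j) →
      IncLegal lam Q N ζ p (σ.answer ζ p) i) ∧
    ((∀ i < lam.ord, ComLegal lam Q N X r ζ p (σ.answer ζ p) i) → ¬ ComWins lam Q F ζ p)

/-- `Q` is really `(𝒮₀, S₁, D)`-complete. -/
def IsReallyComplete (lam κ μ : Cardinal.{u}) (𝒮₀ : Set (Set Ordinal.{u}))
    (S₁ : Set (OrdSetSeq lam)) (D : OrdSetSeq lam → Filter (Iio lam.ord))
    (Q : ForcingNotion.{u}) : Prop :=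
  Q.IsLTComplete lam.ord ∧
  StronglyComplete lam μ 𝒮₀ Q ∧
  ∃ χ₀ : Cardinal.{u}, ∀ χ : Cardinal.{u}, χ₀ ≤ χ → χ.IsRegular →
    ∀ W : HSet χ → HSet χ → Prop, IsWellOrder (HSet χ) W →
      ∃ x : ZFSet.{u}, InH χ x ∧
        ∀ N : Ordinal.{u} → ZFSet.{u}, IsSuitable lam κ μ S₁ D Q χ W N → x ∈ N 0 →
          ∀ (a : OrdSetSeq lam) (X : Set (Iio lam.ord)), IsSuitableBase lam μ S₁ D N a X →
            ∀ r ∈ N 0, r ∈ Q.carrier → ¬ IncHasWinningStrategy lam Q N (D a) X r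

/-! ### Filters on `lam` -/

/-- The club filter of `lam`. -/
def clubFilter (lam : Cardinal.{u}) : Filter (Iio lam.ord) :=
  Filter.generate {A : Set (Iio lam.ord) | IsClub A}

/-- A (proper) normal filter on `lam`: it contains all end segments and is closed under diagonal
intersections. -/
structure IsNormalFilter (lam : Cardinal.{u}) (F : Filter (Iio lam.ord)) : Prop where
  neBot : F.NeBot
  endSegment : ∀ α : Iio lam.ord, Ioi α ∈ F
  diagonal : ∀ A : Iio lam.ord → Set (Iio lam.ord), (∀ α, A α ∈ F) →
    {ξ | ∀ α < ξ, ξ ∈ A α} ∈ F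

/-! ### The families `S₀` and `Ŝ₁`, and the ladder system -/

/-- `S^κ_lam = {δ < κ : cf(δ) = lam}`. -/
def cofSet (κ lam : Cardinal.{u}) : Set Ordinal.{u} := {δ | δ < κ.ord ∧ δ.cof = lam}

/-- A set of ordinals as a family of sets of ordinals (an ordinal is the set of smaller ones). -/
def asFamily (S₀ : Set Ordinal.{u}) : Set (Set Ordinal.{u}) := {a | ∃ α ∈ S₀, a = Iio α}

/-- `Ŝ₁`: the increasing continuous sequences `⟨a i : i ≤ lam⟩` of ordinals below `κ` such that
`a i ∈ S₀` for non-limit `i`. -/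
def seqFamily (lam κ : Cardinal.{u}) (S₀ : Set Ordinal.{u}) : Set (OrdSetSeq lam) :=
  {a | ∃ α : Iic lam.ord → Ordinal.{u}, StrictMono α ∧
    (∀ i, Order.IsSuccLimit i.1 → IsLUB (α '' Iio i) (α i)) ∧
    (∀ i, α i < κ.ord) ∧ (∀ i, ¬ Order.IsSuccLimit i.1 → α i ∈ S₀) ∧
    a = fun i => Iio (α i)}

/-- `⟨C δ : δ ∈ S⟩` is a sequence such that `C δ` is a club of `δ` of order type `lam` and
`nacc(C δ)` is disjoint from `S₀`. -/
def IsLadderSystem (lam : Cardinal.{u}) (S₀ S : Set Ordinal.{u})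
    (C : Ordinal.{u} → Set Ordinal.{u}) : Prop :=
  ∀ δ ∈ S, C δ ⊆ Iio δ ∧ IsClub {x : Iio δ | x.1 ∈ C δ} ∧
    Ordinal.type (α := C δ) (· < ·) = Ordinal.lift.{u + 1} lam.ord ∧
    ∀ α ∈ nacc (C δ), α ∉ S₀

/-! ### The forcing notion adding a club -/

/-- `E` is a closed subset of `κ` with `sup E < κ` such that `E ∩ nacc(C δ)` is bounded in `δ` for
all `δ ∈ S ∩ (sup E + 1)`. -/
def IsClubCondition (κ : Cardinal.{u}) (S : Set Ordinal.{u}) (C : Ordinal.{u} → Set Ordinal.{u})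
    (E : Set Ordinal.{u}) : Prop :=
  E ⊆ Iio κ.ord ∧ IsClosed E ∧ sSup E < κ.ord ∧
    ∀ δ ∈ S, δ ≤ sSup E → BoundedIn (E ∩ nacc (C δ)) δ

/-- The club-adding forcing: conditions are ordered by being an initial segment. -/
def clubForcing (κ : Cardinal.{u}) (S : Set Ordinal.{u}) (C : Ordinal.{u} → Set Ordinal.{u}) :
    ForcingNotion.{u} where
  carrier := ZFSet.sep (fun e => IsClubCondition κ S C (ordSet e)) (ZFSet.powerset κ.ord.toZFSet)
  le e e' := e ⊆ e' ∧ ∀ y ∈ e', y ∉ e → ∀ x ∈ e, x ∈ y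
  le_refl _ _ := ⟨fun _ h => h, fun _ h h' => absurd h h'⟩
  le_trans p _ q _ r _ h h' := by
    refine ⟨fun _ hx => h'.1 (h.1 hx), fun y hy hyp x hx => ?_⟩
    by_cases hyq : y ∈ q
    · exact h.2 y hyq hyp x hx
    · exact h'.2 y hy hyq x (h.1 hx)
  le_antisymm _ _ _ _ h h' := ZFSet.ext fun _ => ⟨fun hx => h.1 hx, fun hx => h'.1 hx⟩

/-! ### The uniformization forcing notion -/

/-- `f` is (the graph of) a function from some ordinal `α < κ` to `lam` such that for all
`δ ∈ S ∩ (α + 1)` the set `{β ∈ C δ : h δ β = f β}` is co-bounded in `C δ`. -/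
def IsUnifCondition (lam κ : Cardinal.{u}) (S : Set Ordinal.{u})
    (C : Ordinal.{u} → Set Ordinal.{u}) (h : Ordinal.{u} → Ordinal.{u} → Ordinal.{u})
    (f : ZFSet.{u}) : Prop :=
  ∃ α < κ.ord, ∃ g : Ordinal.{u} → Ordinal.{u}, (∀ ξ < α, g ξ < lam.ord) ∧
    f = seqCode α (fun ξ => (g ξ).toZFSet) ∧
    ∀ δ ∈ S, δ ≤ α → BoundedIn {β | β ∈ C δ ∧ h δ β ≠ g β} δ

/-- The uniformization forcing, ordered by inclusion. -/
def unifForcing (lam κ : Cardinal.{u}) (S : Set Ordinal.{u}) (C : Ordinal.{u} → Set Ordinal.{u})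
    (h : Ordinal.{u} → Ordinal.{u} → Ordinal.{u}) : ForcingNotion.{u} where
  carrier := ZFSet.sep (IsUnifCondition lam κ S C h)
    (ZFSet.powerset (ZFSet.prod κ.ord.toZFSet lam.ord.toZFSet))
  le f f' := f ⊆ f'
  le_refl _ _ := fun _ h => h
  le_trans _ _ _ _ _ _ h h' := fun _ hx => h' (h hx)
  le_antisymm _ _ _ _ h h' := ZFSet.ext fun _ => ⟨fun hx => h hx, fun hx => h' hx⟩

/-! ### Names and the forcing relation -/

/-- The conditions of `Q`, as a type. -/
abbrev ForcingNotion.Cond (Q : ForcingNotion.{u}) : Type (u + 1) := {p : ZFSet.{u} // p ∈ Q.carrier}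

/-- `Q`-names: `mk ι val cond` is the name `{(val i, s) : i ∈ ι, s ∈ cond i}`. -/
inductive FName (Q : ForcingNotion.{u}) : Type (u + 1)
  | mk (ι : Type u) (val : ι → FName Q) (cond : ι → Set Q.Cond) : FName Q

/-- Statements of the forcing language, given by the conditions which force them. -/
abbrev Stmt (Q : ForcingNotion.{u}) : Type (u + 1) := Q.Cond → Prop

section forcingRelation

variable {Q : ForcingNotion.{u}}

/-- `p` is stronger than some element of `c`. -/
def Below (c : Set Q.Cond) (p : Q.Cond) : Prop := ∃ s ∈ c, Q.le s.1 p.1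

/-- `p ⊩ x = y`. -/
def fEq : FName Q → FName Q → Stmt Q
  | FName.mk ι A c, FName.mk ι' B d => fun p =>
    (∀ (i : ι) (q : Q.Cond), Q.le p.1 q.1 → Below (c i) q →
      ∃ r : Q.Cond, Q.le q.1 r.1 ∧ ∃ j : ι', Below (d j) r ∧ fEq (A i) (B j) r) ∧
    (∀ (j : ι') (q : Q.Cond), Q.le p.1 q.1 → Below (d j) q →
      ∃ r : Q.Cond, Q.le q.1 r.1 ∧ ∃ i : ι, Below (c i) r ∧ fEq (A i) (B j) r)

/-- `p ⊩ x ∈ y`. -/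
def fMem (x : FName Q) : FName Q → Stmt Q
  | FName.mk ι B d => fun p =>
    ∀ q : Q.Cond, Q.le p.1 q.1 → ∃ r : Q.Cond, Q.le q.1 r.1 ∧ ∃ j : ι, Below (d j) r ∧ fEq x (B j) r

/-- `p ⊩ ¬ A`. -/
def fNot (A : Stmt Q) : Stmt Q := fun p => ∀ q : Q.Cond, Q.le p.1 q.1 → ¬ A q

/-- `p ⊩ A ∧ B`. -/
def fAnd (A B : Stmt Q) : Stmt Q := fun p => A p ∧ B p

/-- `p ⊩ A → B`. -/
def fImp (A B : Stmt Q) : Stmt Q := fNot (fAnd A (fNot B))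

/-- `p ⊩ ∀ x, A x`. -/
def fAll (A : FName Q → Stmt Q) : Stmt Q := fun p => ∀ x, A x p

/-- `p ⊩ ∃ x, A x`. -/
def fEx (A : FName Q → Stmt Q) : Stmt Q := fNot (fAll fun x => fNot (A x))

/-- `E ⊆ k`, `E` is unbounded in `k`, and `E` is closed in `k`
(for names `k` of limit ordinals). -/
def fIsClubIn (E k : FName Q) : Stmt Q :=
  fAnd (fAll fun x => fImp (fMem x E) (fMem x k)) <|
  fAnd (fAll fun x => fImp (fMem x k) (fEx fun y => fAnd (fMem y E) (fMem x y))) <|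
  fAll fun x => fImp
    (fAnd (fMem x k) <|
     fAnd (fEx fun y => fMem y x) <|
     fAll fun y => fImp (fMem y x) (fEx fun z => fAnd (fMem z E) (fAnd (fMem y z) (fMem z x))))
    (fMem x E)

/-- `E ∩ A` is bounded in `d` (for names `d` of limit ordinals and `A` of subsets of `d`). -/
def fInterBounded (E A d : FName Q) : Stmt Q :=
  fEx fun y => fAnd (fMem y d) <|
    fAll fun x => fImp (fAnd (fMem x E) (fMem x A)) (fMem x y)

/-- The standard name of a set of the ground model. -/
def check (Q : ForcingNotion.{u}) (x : ZFSet.{u}) : FName Q :=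
  FName.mk (Shrink.{u} x) (fun i => check Q ((equivShrink x).symm i).1) (fun _ => Set.univ)
termination_by x
decreasing_by exact ((equivShrink x).symm i).2

/-- The name of `⋃ G`, where `G` is the generic filter, for a forcing notion whose conditions are
subsets of `k`. -/
def genericUnion (Q : ForcingNotion.{u}) (k : ZFSet.{u}) : FName Q :=
  FName.mk (Shrink.{u} k) (fun i => check Q ((equivShrink k).symm i).1)
    (fun i => {p | ((equivShrink k).symm i).1 ∈ p.1})

/-- A statement is forced (by every condition). -/
def Forced (A : Stmt Q) : Prop := ∀ p : Q.Cond, A p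

end forcingRelation

/-- A subset of `δ`, as a set. -/
def subsetCode (δ : Ordinal.{u}) (A : Set Ordinal.{u}) : ZFSet.{u} :=
  ZFSet.sep (fun y => ∃ α ∈ A, y = α.toZFSet) δ.toZFSet

/-- `Q` (whose conditions are subsets of `κ`) forces that the union `E` of the generic filter is a
club of `κ` such that `E ∩ nacc(C δ)` is bounded in `δ` for every `δ ∈ S`. -/
def AddsClubAvoiding (κ : Cardinal.{u}) (S : Set Ordinal.{u}) (C : Ordinal.{u} → Set Ordinal.{u})
    (Q : ForcingNotion.{u}) : Prop :=
  Forced (fIsClubIn (genericUnion Q κ.ord.toZFSet) (check Q κ.ord.toZFSet)) ∧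
  ∀ δ ∈ S, Forced (fInterBounded (genericUnion Q κ.ord.toZFSet)
    (check Q (subsetCode δ (nacc (C δ)))) (check Q δ.toZFSet))

end ReallyComplete

end

noncomputable section

namespace ReallyComplete

/-! ### Elementary submodels of `H(χ)` -/

section submodels

open FirstOrder Language

/-! Conditions of both forcings have a height below `κ`: the supremum of a closed set, or the domain
of a function. Let `α` be the supremum of the heights along a chain. The limit of the chain (closure
of the union, or union) can fail to be a condition only if `α ∈ S`, the height `α` is not attained,
and the places where the chain violates the requirement of `C α` are unbounded in `α`.
`IsLadderForcing` axiomatizes this, and all completeness is derived from it.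

For a chain of length less than `λ` an unattained supremum has cofinality less than `λ`. For a
sequence generic over `N` the supremum is `N ∩ κ`, which is in `S₀`. In both cases `S` is avoided.

In the game let `δ` be the last term of `a`. If `δ ∈ S`, COM must protect the ladder `T = C δ`,
which need not belong to the models. COM lets `ζ` enumerate `X ∩ E`, where `E` is the club of
indices `z` such that `a z` is a limit of `T`. The ordinal `a (ζ+1)` is in `S₀`, hence has
cofinality `λ`, whereas `T` has fewer than `λ` points below it. So some `γ < a (ζ+1)` lies above all
those points, and COM plays a condition of height `γ` without new violations. INC's answer grows
only from `γ` to `a (ζ+1)`, where `T` has no points. The supremum of the conditions to be extended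
next is not in `S` and not in `nacc T`: at successors it is in `S₀`; at limits it has cofinality
less than `λ` and is a limit of `T`. Thus all violations stay at or below the height of `r`, and the
play has an upper bound (`not_incHasWinningStrategy`).

COM's moves must lie in the models. The part of `T` below `γ` is small, so the data of a move are
coded in `N` by `<λ`-closure; a single function `F` turns codes into moves, and `N` is closed under
`F` because the witness `x` contains its graph.

For the uniformization forcing, extending conditions is the substantial point: at most `λ` ladders
are made disjoint by cutting off bounded parts (`exists_disjointification`). Part (3) is a density
argument: once a condition contains a point above `α`, it decides the generic set up to `α`. -/

theorem InH.mem {χ : Cardinal.{u}} {x y : ZFSet.{u}} (hx : InH χ x) (hy : y ∈ x) : InH χ y :=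
  ZFSet.Hereditarily.mem hx hy

theorem InH.mono {χ χ' : Cardinal.{u}} (hχ : χ ≤ χ') (x : ZFSet.{u}) : InH χ x → InH χ' x := by
  induction x using ZFSet.inductionOn with
  | _ x ih =>
    intro hx
    exact ZFSet.hereditarily_iff.2
      ⟨(ZFSet.Hereditarily.self hx).trans_le hχ, fun y hy => ih y hy (hx.mem hy)⟩

theorem exists_inH (x : ZFSet.{u}) : ∃ χ : Cardinal.{u}, InH χ x := by
  induction x using ZFSet.inductionOn with
  | _ x ih =>
    choose! f hf using ih
    refine ⟨max (Order.succ x.card) (⨆ y : Shrink.{u} x, f ((equivShrink x).symm y).1),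
      ZFSet.hereditarily_iff.2 ⟨(Order.lt_succ _).trans_le (le_max_left _ _), fun y hy => ?_⟩⟩
    refine InH.mono (le_trans ?_ (le_max_right _ _)) y (hf y hy)
    have := le_ciSup (f := fun y : Shrink.{u} x => f ((equivShrink x).symm y).1)
      Cardinal.bddAbove_of_small (equivShrink x ⟨y, hy⟩)
    simpa using this

theorem inH_doubleton {χ : Cardinal.{u}} (hχ : Cardinal.aleph0 ≤ χ) {a b : ZFSet.{u}}
    (ha : InH χ a) (hb : InH χ b) : InH χ {a, b} := by
  refine ZFSet.hereditarily_iff.2 ⟨?_, fun y hy => ?_⟩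
  · refine ZFSet.card_insert_le.trans_lt (lt_of_lt_of_le ?_ hχ)
    rw [ZFSet.card_singleton, one_add_one_eq_two]
    exact Cardinal.natCast_lt_aleph0 (n := 2)
  · rcases ZFSet.mem_pair.1 hy with rfl | rfl
    exacts [ha, hb]

variable {χ : Cardinal.{u}} {W : HSet χ → HSet χ → Prop} {N : ZFSet.{u}}

theorem IsElemSubmodel.inH (hN : IsElemSubmodel χ W N) {y : ZFSet.{u}} (hy : y ∈ N) : InH χ y := by
  obtain ⟨M, hM⟩ := hN
  exact ((hM y).1 hy).1

/-- The set which is an element of the structure `(H(χ), ∈, W)`. -/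
def HModel.val (z : HModel χ W) : ZFSet.{u} := (show HSet χ from z).1

theorem HModel.inH (z : HModel χ W) : InH χ z.val := (show HSet χ from z).2

theorem HModel.val_inj {z w : HModel χ W} : z.val = w.val ↔ z = w := Subtype.ext_iff.symm

/-- An element of `H(χ)`, as an element of the structure `(H(χ), ∈, W)`. -/
def HModel.mk (W : HSet χ → HSet χ → Prop) (y : ZFSet.{u}) (hy : InH χ y) : HModel χ W :=
  (⟨y, hy⟩ : HSet χ)

@[simp]
theorem HModel.val_mk (y : ZFSet.{u}) (hy : InH χ y) : (HModel.mk W y hy).val = y := rfl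

/-- If `H(χ)` has an element with a first order property with parameters in `N`, so has `N`. -/
theorem IsElemSubmodel.exists_mem (hN : IsElemSubmodel χ W N)
    (φ : setLang.BoundedFormula (Fin 2) 1) {a b : HModel χ W} (ha : a.val ∈ N) (hb : b.val ∈ N)
    (h : ∃ z : HModel χ W, φ.Realize ![a, b] ![z]) :
    ∃ z : HModel χ W, z.val ∈ N ∧ φ.Realize ![a, b] ![z] := by
  obtain ⟨M, hM⟩ := hN
  have hmem : ∀ z : HModel χ W, z.val ∈ N → z ∈ M := by
    intro z hz
    obtain ⟨_, h⟩ := (hM z.val).1 hz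
    exact h
  let v : Fin 2 → M := ![⟨a, hmem a ha⟩, ⟨b, hmem b hb⟩]
  have hv : (M.subtype : M → HModel χ W) ∘ v = ![a, b] := by
    funext i
    fin_cases i <;> rfl
  have hsnoc : ∀ {T : Type (u + 1)} (z : T),
      (Fin.snoc (default : Fin 0 → T) z : Fin 1 → T) = ![z] := by
    intro T z
    funext i
    fin_cases i
    rfl
  have h1 : φ.ex.Realize (M := HModel χ W) ((M.subtype : M → HModel χ W) ∘ v)
      ((M.subtype : M → HModel χ W) ∘ default) := by
    rw [BoundedFormula.realize_ex, hv,
      Subsingleton.elim ((M.subtype : M → HModel χ W) ∘ default) default]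
    obtain ⟨z, hz⟩ := h
    exact ⟨z, by rw [hsnoc]; exact hz⟩
  rw [M.subtype.map_boundedFormula, BoundedFormula.realize_ex] at h1
  obtain ⟨z, hz⟩ := h1
  rw [hsnoc, ← M.subtype.map_boundedFormula, hv] at hz
  have hz1 : (M.subtype : M → HModel χ W) ∘ ![z] = ![z.1] := by
    funext i
    fin_cases i
    rfl
  rw [hz1] at hz
  exact ⟨z.1, (hM _).2 ⟨z.1.inH, z.2⟩, hz⟩

/-- The membership symbol. -/
def memRel : setLang.Relations 2 := SetRel.mem

/-- The atomic formula `s ∈ t`. -/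
def memF {n : ℕ} (s t : setLang.Term (Fin 2 ⊕ Fin n)) : setLang.BoundedFormula (Fin 2) n :=
  memRel.boundedFormula₂ s t

theorem realize_memF {n : ℕ} (s t : setLang.Term (Fin 2 ⊕ Fin n)) (v : Fin 2 → HModel χ W)
    (xs : Fin n → HModel χ W) :
    (memF s t).Realize v xs ↔
      HModel.val (s.realize (Sum.elim v xs)) ∈ HModel.val (t.realize (Sum.elim v xs)) := by
  rw [memF, BoundedFormula.realize_rel₂]
  rfl

/-- The `i`-th parameter. -/
def parT {n : ℕ} (i : Fin 2) : setLang.Term (Fin 2 ⊕ Fin n) := Term.var (Sum.inl i)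

/-- The `i`-th variable. -/
def varT {n : ℕ} (i : Fin n) : setLang.Term (Fin 2 ⊕ Fin n) := Term.var (Sum.inr i)

/-- A set that is the only one in `H(χ)` satisfying a formula with parameters in `N` is in `N`. The
formula sees only elements of `H(χ)`, which suffices because `H(χ)` is transitive. -/
theorem IsElemSubmodel.doubleton_mem (hN : IsElemSubmodel χ W N) (hχ : Cardinal.aleph0 ≤ χ)
    {a b : ZFSet.{u}} (ha : a ∈ N) (hb : b ∈ N) : {a, b} ∈ N := by
  have key : ∀ z : HModel χ W, BoundedFormula.Realize
      ((memF (varT 1) (varT 0)).iff ((varT 1 =' parT 0) ⊔ (varT 1 =' parT 1)) :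
        setLang.BoundedFormula (Fin 2) 2).all ![.mk W a (hN.inH ha), .mk W b (hN.inH hb)] ![z] ↔
      ∀ w : HModel χ W, w.val ∈ z.val ↔ w.val = a ∨ w.val = b := by
    intro z
    rw [BoundedFormula.realize_all]
    refine forall_congr' fun w => ?_
    rw [BoundedFormula.realize_iff, BoundedFormula.realize_sup, realize_memF,
      BoundedFormula.realize_bdEqual, BoundedFormula.realize_bdEqual]
    refine iff_congr Iff.rfl (or_congr ?_ ?_)
    · exact HModel.val_inj.symm
    · exact HModel.val_inj.symm
  obtain ⟨z, hzN, hz⟩ := hN.exists_mem _ (a := .mk W a (hN.inH ha)) (b := .mk W b (hN.inH hb)) ha hb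
    ⟨.mk W {a, b} (inH_doubleton hχ (hN.inH ha) (hN.inH hb)), (key _).2 fun w => ZFSet.mem_pair⟩
  rw [key] at hz
  have : z.val = {a, b} := by
    ext w
    rw [ZFSet.mem_pair]
    constructor
    · intro hw
      exact (hz (.mk W w (z.inH.mem hw))).1 hw
    · rintro (rfl | rfl)
      · exact (hz (.mk W w (hN.inH ha))).2 (Or.inl rfl)
      · exact (hz (.mk W w (hN.inH hb))).2 (Or.inr rfl)
  exact this ▸ hzN

theorem IsElemSubmodel.singleton_mem (hN : IsElemSubmodel χ W N) (hχ : Cardinal.aleph0 ≤ χ)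
    {a : ZFSet.{u}} (ha : a ∈ N) : {a} ∈ N := by
  rw [← ZFSet.pair_eq_singleton]
  exact hN.doubleton_mem hχ ha ha

theorem IsElemSubmodel.pair_mem (hN : IsElemSubmodel χ W N) (hχ : Cardinal.aleph0 ≤ χ)
    {a b : ZFSet.{u}} (ha : a ∈ N) (hb : b ∈ N) : ZFSet.pair a b ∈ N :=
  hN.doubleton_mem hχ (hN.singleton_mem hχ ha) (hN.doubleton_mem hχ ha hb)

theorem IsElemSubmodel.exists_mem_mem (hN : IsElemSubmodel χ W N) {a b z : ZFSet.{u}}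
    (ha : a ∈ N) (hb : b ∈ N) (hz : z ∈ a) (hbz : b ∈ z) : ∃ y ∈ N, y ∈ a ∧ b ∈ y := by
  have key : ∀ z : HModel χ W, BoundedFormula.Realize
      (memF (varT 0) (parT 0) ⊓ memF (parT 1) (varT 0) : setLang.BoundedFormula (Fin 2) 1)
      ![.mk W a (hN.inH ha), .mk W b (hN.inH hb)] ![z] ↔ z.val ∈ a ∧ b ∈ z.val := by
    intro z
    rw [BoundedFormula.realize_inf, realize_memF, realize_memF]
    rfl
  obtain ⟨y, hyN, hy⟩ := hN.exists_mem _ (a := .mk W a (hN.inH ha)) (b := .mk W b (hN.inH hb)) ha hb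
    ⟨.mk W z ((hN.inH ha).mem hz), (key _).2 ⟨hz, hbz⟩⟩
  exact ⟨y.val, hyN, (key y).1 hy⟩

theorem IsElemSubmodel.exists_mem_ne (hN : IsElemSubmodel χ W N) {a b z : ZFSet.{u}}
    (ha : a ∈ N) (hb : b ∈ N) (hz : z ∈ a) (hbz : z ≠ b) : ∃ y ∈ N, y ∈ a ∧ y ≠ b := by
  have key : ∀ z : HModel χ W, BoundedFormula.Realize
      (memF (varT 0) (parT 0) ⊓ ∼(varT 0 =' parT 1) : setLang.BoundedFormula (Fin 2) 1)
      ![.mk W a (hN.inH ha), .mk W b (hN.inH hb)] ![z] ↔ z.val ∈ a ∧ z.val ≠ b := by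
    intro z
    rw [BoundedFormula.realize_inf, realize_memF, BoundedFormula.realize_not,
      BoundedFormula.realize_bdEqual]
    exact and_congr Iff.rfl (not_congr HModel.val_inj.symm)
  obtain ⟨y, hyN, hy⟩ := hN.exists_mem _ (a := .mk W a (hN.inH ha)) (b := .mk W b (hN.inH hb)) ha hb
    ⟨.mk W z ((hN.inH ha).mem hz), (key _).2 ⟨hz, hbz⟩⟩
  exact ⟨y.val, hyN, (key y).1 hy⟩

/-- In the Kuratowski pair, `a` is the only common element of all members. -/
theorem IsElemSubmodel.fst_mem (hN : IsElemSubmodel χ W N) {a b : ZFSet.{u}}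
    (h : ZFSet.pair a b ∈ N) : a ∈ N := by
  have key : ∀ z : HModel χ W, BoundedFormula.Realize
      ((memF (varT 1) (parT 0)).imp (memF (varT 0) (varT 1)) :
        setLang.BoundedFormula (Fin 2) 2).all ![.mk W _ (hN.inH h), .mk W _ (hN.inH h)] ![z] ↔
      ∀ w : HModel χ W, w.val ∈ ZFSet.pair a b → z.val ∈ w.val := by
    intro z
    rw [BoundedFormula.realize_all]
    refine forall_congr' fun w => ?_
    rw [BoundedFormula.realize_imp, realize_memF, realize_memF]
    rfl
  have hs : ({a} : ZFSet.{u}) ∈ ZFSet.pair a b := ZFSet.mem_pair.2 (Or.inl rfl)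
  have ha : InH χ a := ((hN.inH h).mem hs).mem (ZFSet.mem_singleton.2 rfl)
  obtain ⟨y, hyN, hy⟩ := hN.exists_mem _ (a := .mk W _ (hN.inH h)) (b := .mk W _ (hN.inH h)) h h
    ⟨.mk W a ha, (key _).2 fun w hw => by
      rcases ZFSet.mem_pair.1 hw with hw | hw <;> simp [hw]⟩
  have := (key y).1 hy (.mk W {a} ((hN.inH h).mem hs)) hs
  rw [HModel.val_mk, ZFSet.mem_singleton] at this
  exact this ▸ hyN

/-- If `b ≠ a`, then `{a, b}` is the member of the pair other than `{a}`, and `b` is its member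
other than `a`. -/
theorem IsElemSubmodel.snd_mem (hN : IsElemSubmodel χ W N) (hχ : Cardinal.aleph0 ≤ χ)
    {a b : ZFSet.{u}} (h : ZFSet.pair a b ∈ N) : b ∈ N := by
  have ha := hN.fst_mem h
  by_cases hab : b = a
  · exact hab ▸ ha
  have ht : ({a, b} : ZFSet.{u}) ∈ ZFSet.pair a b := ZFSet.mem_pair.2 (Or.inr rfl)
  have hne : ({a, b} : ZFSet.{u}) ≠ {a} := by
    rw [Ne, ZFSet.pair_eq_singleton_iff]
    exact fun h => hab h.2
  obtain ⟨y, hyN, hy, hya⟩ := hN.exists_mem_ne h (hN.singleton_mem hχ ha) ht hne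
  rcases ZFSet.mem_pair.1 hy with hy | hy
  · exact absurd hy hya
  · rw [hy] at hyN
    obtain ⟨w, hwN, hw, hwa⟩ := hN.exists_mem_ne hyN ha (ZFSet.mem_pair.2 (Or.inr rfl)) hab
    rcases ZFSet.mem_pair.1 hw with hw | hw
    · exact absurd hw hwa
    · exact hw ▸ hwN

/-- The graph of the restriction of `F` to the set `A`. -/
def graphOn (A : ZFSet.{u}) (F : ZFSet.{u} → ZFSet.{u}) : ZFSet.{u} :=
  ZFSet.range fun a : A => ZFSet.pair a.1 (F a.1)

theorem IsElemSubmodel.apply_mem (hN : IsElemSubmodel χ W N) (hχ : Cardinal.aleph0 ≤ χ)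
    {A a : ZFSet.{u}} {F : ZFSet.{u} → ZFSet.{u}} (hF : graphOn A F ∈ N) (ha : a ∈ N)
    (haA : a ∈ A) : F a ∈ N := by
  have h1 : ZFSet.pair a (F a) ∈ graphOn A F := ZFSet.mem_range.2 ⟨⟨a, haA⟩, rfl⟩
  -- A member of the graph that contains `{a}` must have first coordinate `a`, so elementarity finds
  -- the right pair inside `N`.
  obtain ⟨p, hpN, hp, hap⟩ := hN.exists_mem_mem hF (hN.singleton_mem hχ ha) h1
    (ZFSet.mem_pair.2 (Or.inl rfl))
  obtain ⟨⟨a', ha'⟩, rfl⟩ := ZFSet.mem_range.1 hp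
  have : a = a' := by
    rcases ZFSet.mem_pair.1 hap with h | h
    · exact ZFSet.singleton_inj.1 h
    · exact (ZFSet.singleton_eq_pair_iff.1 h).1
  subst this
  exact hN.snd_mem hχ hpN

/-- For most elementary submodels `N`, the set `N` is closed under given functions. -/
theorem exists_closure_witness (A₁ A₂ A₃ : ZFSet.{u}) (F₁ F₂ F₃ : ZFSet.{u} → ZFSet.{u}) :
    ∃ χ₀ : Cardinal.{u}, ∃ x : ZFSet.{u}, ∀ χ, χ₀ ≤ χ → InH χ x ∧
      ∀ (W : HSet χ → HSet χ → Prop) (N : ZFSet.{u}), IsElemSubmodel χ W N → x ∈ N →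
        (∀ a ∈ N, ∀ b ∈ N, ZFSet.pair a b ∈ N) ∧ (∀ a ∈ A₁, a ∈ N → F₁ a ∈ N) ∧
        (∀ a ∈ A₂, a ∈ N → F₂ a ∈ N) ∧ ∀ a ∈ A₃, a ∈ N → F₃ a ∈ N := by
  -- The witness `x` is the triple of the graphs of the three functions on their domains.
  obtain ⟨χ₁, hχ₁⟩ := exists_inH
    (ZFSet.pair (graphOn A₁ F₁) (ZFSet.pair (graphOn A₂ F₂) (graphOn A₃ F₃)))
  refine ⟨max χ₁ Cardinal.aleph0, _, fun χ hχ => ⟨hχ₁.mono ((le_max_left _ _).trans hχ) _, ?_⟩⟩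
  intro W N hN hx
  have h0 : Cardinal.aleph0 ≤ χ := (le_max_right _ _).trans hχ
  have h1 := hN.fst_mem hx
  have h23 := hN.snd_mem h0 hx
  have h2 := hN.fst_mem h23
  have h3 := hN.snd_mem h0 h23
  exact ⟨fun a ha b hb => hN.pair_mem h0 ha hb, fun a haA ha => hN.apply_mem h0 h1 ha haA,
    fun a haA ha => hN.apply_mem h0 h2 ha haA, fun a haA ha => hN.apply_mem h0 h3 ha haA⟩

end submodels

/-! ### Small sets of ordinals -/

/-- By König, `λ ^ cf λ > λ`, which contradicts `λ ^ <λ = λ` when `cf λ < λ`. -/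
theorem isRegular_of_powerlt_eq {lam : Cardinal.{u}} (hlam : Cardinal.aleph0 < lam)
    (hpow : Cardinal.powerlt lam lam = lam) : lam.IsRegular := by
  refine ⟨hlam.le, ?_⟩
  by_contra! h
  have h1 := Cardinal.le_powerlt lam h
  rw [hpow] at h1
  exact absurd (Cardinal.lt_power_cof_ord hlam.le) h1.not_gt

/-- `A` is a set of fewer than `lam` ordinals. -/
def IsSmall (lam : Cardinal.{u}) (A : Set Ordinal.{u}) : Prop :=
  ∃ τ < lam.ord, ∃ u : Ordinal.{u} → Ordinal.{u}, A = u '' Iio τ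

theorem isSmall_empty {lam : Cardinal.{u}} (hlam : lam ≠ 0) : IsSmall lam ∅ :=
  ⟨0, by simpa [Cardinal.lt_ord, pos_iff_ne_zero] using hlam, id, by simp⟩

theorem isSmall_of_card_lt {lam : Cardinal.{u}} {A : Set Ordinal.{u}}
    (hA : Cardinal.mk A < Cardinal.lift.{u + 1} lam) : IsSmall lam A := by
  obtain ⟨c, hc⟩ := Cardinal.lt_lift_iff.1 hA
  have h1 : Cardinal.mk (Iio c.ord) = Cardinal.mk A := by
    rw [Cardinal.mk_Iio_ordinal, Cardinal.card_ord, hc.2]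
  obtain ⟨e⟩ := Cardinal.eq.1 h1
  refine ⟨c.ord, Cardinal.ord_lt_ord.2 hc.1, fun ξ => if h : ξ < c.ord then (e ⟨ξ, h⟩).1 else 0, ?_⟩
  ext x
  constructor
  · intro hx
    have h2 : (e.symm ⟨x, hx⟩).1 < c.ord := (e.symm ⟨x, hx⟩).2
    refine ⟨(e.symm ⟨x, hx⟩).1, h2, ?_⟩
    simp only [h2, dif_pos]
    exact congrArg Subtype.val (e.apply_symm_apply ⟨x, hx⟩)
  · rintro ⟨ξ, hξ, rfl⟩
    have h2 : ξ < c.ord := hξ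
    simp [h2]

/-- This gap between "fewer than `λ` points" and "cofinality `λ`" is what lets COM and the
disjointification of ladders step above finitely described obstacles of size less than `λ`. -/
theorem IsSmall.boundedIn {lam : Cardinal.{u}} {A : Set Ordinal.{u}} (hA : IsSmall lam A)
    {δ : Ordinal.{u}} (hδ : δ.cof = lam) (h0 : lam ≠ 0) : BoundedIn A δ := by
  obtain ⟨τ, hτ, u, rfl⟩ := hA
  have hδ0 : 0 < δ := by
    rw [← Ordinal.cof_pos, hδ]
    exact pos_iff_ne_zero.2 h0
  refine ⟨sSup (u '' Iio τ ∩ Iio δ), Ordinal.sSup_lt_of_lt_cof ?_ fun i hi => hi.2,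
    fun γ hγ hγδ => le_csSup ⟨δ, fun _ hi => le_of_lt hi.2⟩ ⟨hγ, hγδ⟩⟩
  rw [← Ordinal.lift_cof, hδ]
  refine ((Cardinal.mk_le_mk_of_subset inter_subset_left).trans Cardinal.mk_image_le).trans_lt ?_
  rw [Cardinal.mk_Iio_ordinal, Cardinal.lift_lt]
  exact Cardinal.lt_ord.1 hτ

theorem exists_bound_of_lt_cof {lam : Cardinal.{u}} {δ τ : Ordinal.{u}} (hδ : δ.cof = lam)
    (h0 : lam ≠ 0) (hτ : τ < lam.ord) (u : Ordinal.{u} → Ordinal.{u}) (hu : ∀ ξ < τ, u ξ < δ) :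
    ∃ β < δ, ∀ ξ < τ, u ξ ≤ β := by
  obtain ⟨β, hβ, h⟩ := IsSmall.boundedIn (A := u '' Iio τ) ⟨τ, hτ, u, rfl⟩ hδ h0
  exact ⟨β, hβ, fun ξ hξ => h _ ⟨ξ, hξ, rfl⟩ (hu ξ hξ)⟩

theorem isSuccLimit_of_cof_eq {lam : Cardinal.{u}} (hlam : Cardinal.aleph0 < lam) {δ : Ordinal.{u}}
    (hδ : δ.cof = lam) : Order.IsSuccLimit δ := by
  rw [← Ordinal.one_lt_cof_iff, hδ]
  exact Cardinal.one_lt_aleph0.trans hlam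

theorem cof_ne_of_forall_exists {lam : Cardinal.{u}} {δ τ : Ordinal.{u}} (h0 : lam ≠ 0)
    (hτ : τ < lam.ord) (u : Ordinal.{u} → Ordinal.{u}) (hu : ∀ ξ < τ, u ξ < δ)
    (h : ∀ β < δ, ∃ ξ < τ, β < u ξ) : δ.cof ≠ lam := by
  intro hδ
  obtain ⟨β, hβ, hb⟩ := exists_bound_of_lt_cof hδ h0 hτ u hu
  obtain ⟨ξ, hξ, h1⟩ := h β hβ
  exact (hb ξ hξ).not_gt h1

/-! ### Ladder systems -/

section ladder

variable {lam : Cardinal.{u}} {S₀ S : Set Ordinal.{u}} {C : Ordinal.{u} → Set Ordinal.{u}}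

theorem IsLadderSystem.exists_gt (hC : IsLadderSystem lam S₀ S C) {δ β : Ordinal.{u}} (hδ : δ ∈ S)
    (hlim : Order.IsSuccLimit δ) (hβ : β < δ) : ∃ c ∈ C δ, β < c := by
  obtain ⟨_, hclub, _⟩ := hC δ hδ
  obtain ⟨c, hc, h⟩ := hclub.isCofinal ⟨Order.succ β, hlim.succ_lt hβ⟩
  exact ⟨c.1, hc, (Order.lt_succ β).trans_le h⟩

/-- A proper initial segment of a set of order type `λ` has fewer than `λ` elements. -/
theorem IsLadderSystem.isSmall (hC : IsLadderSystem lam S₀ S C) {δ β : Ordinal.{u}} (hδ : δ ∈ S)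
    (hlim : Order.IsSuccLimit δ) (hβ : β < δ) : IsSmall lam (C δ ∩ Iio β) := by
  obtain ⟨c, hc, hβc⟩ := hC.exists_gt hδ hlim hβ
  obtain ⟨_, _, htype, _⟩ := hC δ hδ
  have h1 : Ordinal.typein (α := C δ) (· < ·) ⟨c, hc⟩ < Ordinal.lift.{u + 1} lam.ord := by
    rw [← htype]
    exact Ordinal.typein_lt_type _ _
  have h2 : Cardinal.mk {y : C δ // y < ⟨c, hc⟩} < Cardinal.lift.{u + 1} lam := by
    have h3 : (Ordinal.typein (α := C δ) (· < ·) ⟨c, hc⟩).card < Cardinal.lift.{u + 1} lam := by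
      rw [← Cardinal.lt_ord, ← Cardinal.lift_ord]
      exact h1
    exact h3
  refine isSmall_of_card_lt (lt_of_le_of_lt ?_ h2)
  refine Cardinal.mk_le_of_injective
    (f := fun y : (C δ ∩ Iio β : Set Ordinal.{u}) => ⟨⟨y.1, y.2.1⟩, Subtype.mk_lt_mk.2 (lt_trans (mem_Iio.1 y.2.2) hβc)⟩) ?_
  intro y z h
  have := congrArg (fun w => w.1.1) h
  exact Subtype.ext this

end ladder

/-! ### Filters on `lam` -/

section filters

variable {lam : Cardinal.{u}}

theorem isSuccLimit_ord (hlam : Cardinal.aleph0 < lam) : Order.IsSuccLimit lam.ord :=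
  Cardinal.isSuccLimit_ord hlam.le

theorem exists_gt_of_isClub (hlam : Cardinal.aleph0 < lam) {E : Set (Iio lam.ord)}
    (hE : IsClub E) (α : Iio lam.ord) : ∃ z ∈ E, α < z := by
  obtain ⟨z, hz, h⟩ := hE.isCofinal ⟨Order.succ α.1, (isSuccLimit_ord hlam).succ_lt α.2⟩
  exact ⟨z, hz, Subtype.mk_lt_mk.2 ((Order.lt_succ α.1).trans_le h)⟩

/-- Choose `e α ∈ E` above each `α`. The diagonal intersection of the end segments above `e α`
consists of the ordinals closed under `e`, and each nonzero one is a limit of `E`. -/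
theorem IsNormalFilter.mem_of_isClub (hlam : Cardinal.aleph0 < lam) {F : Filter (Iio lam.ord)}
    (hF : IsNormalFilter lam F) {E : Set (Iio lam.ord)} (hE : IsClub E) : E ∈ F := by
  choose e he hlt using exists_gt_of_isClub hlam hE
  have h0 : (0 : Ordinal.{u}) < lam.ord := (isSuccLimit_ord hlam).bot_lt
  filter_upwards [hF.diagonal (fun α => Ioi (e α)) fun α => hF.endSegment _,
    hF.endSegment ⟨0, h0⟩] with ξ hξ hξ0
  refine hE.isLUB_mem (t := E ∩ Iio ξ) inter_subset_left
    ⟨e ⟨0, h0⟩, he _, hξ _ hξ0⟩ ⟨fun z hz => le_of_lt hz.2, fun b hb => ?_⟩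
  by_contra! hbξ
  exact (hb ⟨he b, hξ b hbξ⟩).not_gt (hlt b)

/-- Finitely many clubs of an ordinal of uncountable cofinality have a club intersection. -/
theorem isClub_of_mem_clubFilter (hreg : lam.IsRegular) (hlam : Cardinal.aleph0 < lam)
    {Y : Set (Iio lam.ord)} (hY : Y ∈ clubFilter lam) : ∃ E ⊆ Y, IsClub E := by
  obtain ⟨t, ht, hfin, hsub⟩ := Filter.mem_generate_iff.1 hY
  refine ⟨⋂₀ t, hsub, IsClub.sInter_of_countable ?_ hfin.countable ht⟩
  rw [Ordinal.cof_Iio, ← Ordinal.lift_cof, hreg.cof_ord]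
  intro h
  rw [Cardinal.lift_eq_aleph0] at h
  exact hlam.ne' h

theorem mem_filter_of_isClub (hlam : Cardinal.aleph0 < lam) {F : Filter (Iio lam.ord)}
    (hF : F = clubFilter lam ∨ IsNormalFilter lam F) {E : Set (Iio lam.ord)} (hE : IsClub E) :
    E ∈ F := by
  rcases hF with rfl | hF
  · exact Filter.mem_generate_of_mem hE
  · exact hF.mem_of_isClub hlam hE

theorem exists_gt_of_mem_filter (hreg : lam.IsRegular) (hlam : Cardinal.aleph0 < lam)
    {F : Filter (Iio lam.ord)} (hF : F = clubFilter lam ∨ IsNormalFilter lam F)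
    {Y : Set (Iio lam.ord)} (hY : Y ∈ F) (α : Iio lam.ord) : ∃ z ∈ Y, α < z := by
  rcases hF with rfl | hF
  · obtain ⟨E, hEY, hE⟩ := isClub_of_mem_clubFilter hreg hlam hY
    obtain ⟨z, hz, h⟩ := exists_gt_of_isClub hlam hE α
    exact ⟨z, hEY hz, h⟩
  · have := hF.neBot
    obtain ⟨z, hz, h⟩ := Filter.nonempty_of_mem (Filter.inter_mem hY (hF.endSegment α))
    exact ⟨z, hz, h⟩

/-- This provides COM's indices: all of `Y` is enumerated, so the set of chosen indices is in the
filter whenever `Y` is. -/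
theorem exists_enumeration (hreg : lam.IsRegular) {Y : Set (Iio lam.ord)}
    (hY : ∀ α, ∃ z ∈ Y, α < z) :
    ∃ ζ : Ordinal.{u} → Iio lam.ord, (∀ i < lam.ord, ζ i ∈ Y) ∧
      (∀ i < lam.ord, ∀ j < i, ζ j < ζ i) ∧ ∀ z ∈ Y, ∃ i < lam.ord, ζ i = z := by
  -- Adding the final segment from `λ` on makes the set unbounded in all ordinals, so that `enumOrd`
  -- is strictly increasing and onto it.
  set Z : Set Ordinal.{u} := Subtype.val '' Y ∪ Ici lam.ord with hZ
  have hZb : ¬ BddAbove Z := by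
    rintro ⟨b, hb⟩
    have h1 : Order.succ (max b lam.ord) ∈ Z :=
      Or.inr (mem_Ici.2 ((le_max_right _ _).trans (Order.le_succ _)))
    exact (hb h1).not_gt ((le_max_left _ _).trans_lt (Order.lt_succ _))
  set f := Ordinal.enumOrd Z with hf
  have hmono : StrictMono f := Ordinal.enumOrd_strictMono hZb
  have hrange : range f = Z := Ordinal.range_enumOrd hZb
  have hlt : ∀ i < lam.ord, f i < lam.ord := by
    intro i hi
    by_contra! h
    obtain ⟨β, hβ, hb⟩ := exists_bound_of_lt_cof hreg.cof_ord hreg.ne_zero hi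
      (fun j => if f j < lam.ord then f j else 0) fun ξ _ => by
        show (if f ξ < lam.ord then f ξ else 0) < lam.ord
        split_ifs with h1
        exacts [h1, hreg.ord_pos]
    obtain ⟨z, hz, hβz⟩ := hY ⟨β, hβ⟩
    have hz' : z.1 ∈ range f := by
      rw [hrange]
      exact Or.inl ⟨z, hz, rfl⟩
    obtain ⟨j, hj⟩ := hz'
    have hzl : z.1 < lam.ord := z.2
    have hji : j < i := hmono.lt_iff_lt.1 ((hj.trans_lt hzl).trans_le h)
    have h2 := hb j hji
    rw [hj, if_pos hzl] at h2
    exact h2.not_gt hβz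
  refine ⟨fun i => if h : i < lam.ord then ⟨f i, hlt i h⟩ else ⟨0, hreg.ord_pos⟩, ?_, ?_, ?_⟩
  · intro i hi
    have h1 : f i ∈ Z := hrange ▸ mem_range_self i
    rcases h1 with ⟨z, hz, h⟩ | h1
    · have h2 : (⟨f i, hlt i hi⟩ : Iio lam.ord) = z := Subtype.ext h.symm
      simpa [hi, h2] using hz
    · exact absurd (hlt i hi) (not_lt_of_ge h1)
  · intro i hi j hj
    simpa [hi, hj.trans hi] using Subtype.mk_lt_mk.2 (hmono hj)
  · intro z hz
    have hz' : z.1 ∈ range f := by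
      rw [hrange]
      exact Or.inl ⟨z, hz, rfl⟩
    obtain ⟨i, hi⟩ := hz'
    have hzl : z.1 < lam.ord := z.2
    have hil : i < lam.ord := (hmono.le_apply.trans hi.le).trans_lt hzl
    exact ⟨i, hil, by simp [hil, hi]⟩

end filters

/-! ### Increasing continuous sequences -/

/-- `⟨A i : i ≤ θ⟩` is increasing and continuous. -/
structure IsContSeq (θ : Ordinal.{u}) (A : Ordinal.{u} → Ordinal.{u}) : Prop where
  lt : ∀ i j, i < j → j ≤ θ → A i < A j
  cont : ∀ i ≤ θ, Order.IsSuccLimit i → ∀ β < A i, ∃ j < i, β < A j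

theorem exists_contSeq_of_mem_seqFamily {lam κ : Cardinal.{u}} {S₀ : Set Ordinal.{u}}
    {a : OrdSetSeq lam} (ha : a ∈ seqFamily lam κ S₀) :
    ∃ A : Ordinal.{u} → Ordinal.{u}, IsContSeq lam.ord A ∧ (∀ i ≤ lam.ord, A i < κ.ord) ∧
      (∀ i ≤ lam.ord, ¬ Order.IsSuccLimit i → A i ∈ S₀) ∧ ∀ i : Iic lam.ord, a i = Iio (A i.1) := by
  obtain ⟨α, hmono, hlim, hκ, hS, rfl⟩ := ha
  obtain ⟨A, hA⟩ : ∃ A : Ordinal.{u} → Ordinal.{u}, ∀ i (hi : i ≤ lam.ord), A i = α ⟨i, hi⟩ :=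
    ⟨fun i => α ⟨min i lam.ord, mem_Iic.2 (min_le_right _ _)⟩, fun i hi => by simp [hi]⟩
  refine ⟨A, ⟨fun i j hij hj => ?_, fun i hi hl β hβ => ?_⟩,
    fun i hi => hA i hi ▸ hκ _, fun i hi h => ?_, fun i => ?_⟩
  · rw [hA i (hij.le.trans hj), hA j hj]
    exact hmono hij
  · rw [hA i hi] at hβ
    obtain ⟨_, ⟨j, hj, rfl⟩, h⟩ := (lt_isLUB_iff (hlim ⟨i, hi⟩ hl)).1 hβ
    exact ⟨j.1, hj, by rw [hA j.1 j.2]; exact h⟩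
  · rw [hA i hi]
    exact hS _ h
  · rw [hA i.1 i.2]

theorem IsContSeq.le {θ : Ordinal.{u}} {A : Ordinal.{u} → Ordinal.{u}} (hA : IsContSeq θ A)
    {i j : Ordinal.{u}} (hij : i ≤ j) (hj : j ≤ θ) : A i ≤ A j := by
  rcases hij.eq_or_lt with rfl | h
  exacts [le_rfl, (hA.lt i j h hj).le]

theorem isSuccLimit_of_forall_exists {o : Ordinal.{u}} (h0 : o ≠ 0)
    (h : ∀ b < o, ∃ c, b < c ∧ c < o) : Order.IsSuccLimit o := by
  rw [Ordinal.isSuccLimit_iff, Order.isSuccPrelimit_iff_succ_lt]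
  refine ⟨h0, fun b hb => ?_⟩
  obtain ⟨c, hbc, hc⟩ := h b hb
  exact (Order.succ_le_of_lt hbc).trans_lt hc

/-- The indices `i` such that `A i` is a limit of elements of `T` form a club. -/
theorem IsContSeq.isClub_limits {lam : Cardinal.{u}} (hreg : lam.IsRegular)
    (hlam : Cardinal.aleph0 < lam) {A : Ordinal.{u} → Ordinal.{u}} (hA : IsContSeq lam.ord A)
    {T : Set Ordinal.{u}} (hT : ∀ β < A lam.ord, ∃ t ∈ T, β < t ∧ t < A lam.ord) :
    IsClub {ζ : Iio lam.ord | ∀ β < A ζ.1, ∃ t ∈ T, β < t ∧ t < A ζ.1} := by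
  refine ⟨fun d hd hne _ z hz => ?_, fun z => ?_⟩
  · by_cases hzd : z ∈ d
    · exact hd hzd
    have hlt : ∀ b < z, ∃ c ∈ d, b < c ∧ c < z := fun b hb => by
      obtain ⟨c, hc, h⟩ := (lt_isLUB_iff hz).1 hb
      exact ⟨c, hc, h, lt_of_le_of_ne (hz.1 hc) fun h' => hzd (h' ▸ hc)⟩
    have hzl : z.1 < lam.ord := z.2
    have hlim : Order.IsSuccLimit z.1 := by
      refine isSuccLimit_of_forall_exists ?_ fun b hb => ?_
      · obtain ⟨c, hc⟩ := hne
        have h1 : c < z := lt_of_le_of_ne (hz.1 hc) fun h' => hzd (h' ▸ hc)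
        exact (lt_of_le_of_lt (zero_le (a := c.1)) h1).ne'
      · obtain ⟨c, _, h1, h2⟩ := hlt ⟨b, hb.trans hzl⟩ hb
        exact ⟨c.1, h1, h2⟩
    intro β hβ
    obtain ⟨j, hj, hβj⟩ := hA.cont z.1 hzl.le hlim β hβ
    obtain ⟨c, hc, h1, h2⟩ := hlt ⟨j, hj.trans hzl⟩ hj
    have hcl : c.1 < lam.ord := c.2
    obtain ⟨t, ht, h3, h4⟩ := hd hc β (hβj.trans (hA.lt j c.1 h1 hcl.le))
    exact ⟨t, ht, h3, h4.trans (hA.lt c.1 z.1 h2 hzl.le)⟩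
  -- Unboundedness: iterate a map `f` such that `T` has a point between `A ζ` and `A (f ζ)`. By
  -- continuity `A` at the next fixed point is a limit of points of `T`; the fixed point stays below
  -- `λ` since `λ` is regular and uncountable.
  · have hstep : ∀ ζ < lam.ord, ∃ ζ' < lam.ord, ζ < ζ' ∧ ∃ t ∈ T, A ζ < t ∧ t < A ζ' := by
      intro ζ hζ
      obtain ⟨t, ht, h1, h2⟩ := hT (A ζ) (hA.lt _ _ hζ le_rfl)
      obtain ⟨j, hj, h3⟩ := hA.cont _ le_rfl (isSuccLimit_ord hlam) t h2
      refine ⟨j, hj, ?_, t, ht, h1, h3⟩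
      by_contra! hle
      exact ((h1.trans h3).trans_le (hA.le hle hζ.le)).false
    choose! f hfl hlt hft using hstep
    have hzl : z.1 < lam.ord := z.2
    have hn : Ordinal.nfp f z.1 < lam.ord :=
      Ordinal.nfp_lt_ord (by rwa [hreg.cof_ord]) hfl hzl
    have hit : ∀ n, f^[n] z.1 < lam.ord := fun n => (Ordinal.iterate_le_nfp f z.1 n).trans_lt hn
    have hsucc : ∀ n, f^[n] z.1 < f^[n + 1] z.1 := fun n => by
      rw [Function.iterate_succ_apply']
      exact hlt _ (hit n)
    have hlts : ∀ n, f^[n] z.1 < Ordinal.nfp f z.1 := fun n =>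
      (hsucc n).trans_le (Ordinal.iterate_le_nfp f z.1 (n + 1))
    have hlim : Order.IsSuccLimit (Ordinal.nfp f z.1) := by
      refine isSuccLimit_of_forall_exists (lt_of_le_of_lt (zero_le (a := _)) (hlts 0)).ne' fun b hb => ?_
      obtain ⟨n, h⟩ := Ordinal.lt_nfp_iff.1 hb
      exact ⟨_, h, hlts n⟩
    refine ⟨⟨Ordinal.nfp f z.1, hn⟩, fun β hβ => ?_, Ordinal.le_nfp f z.1⟩
    obtain ⟨j, hj, hβj⟩ := hA.cont _ hn.le hlim β hβ
    obtain ⟨n, h⟩ := Ordinal.lt_nfp_iff.1 hj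
    obtain ⟨t, ht, h1, h2⟩ := hft _ (hit n)
    rw [← Function.iterate_succ_apply' f n] at h2
    exact ⟨t, ht, (hβj.trans (hA.lt _ _ h (hit n).le)).trans h1,
      h2.trans (hA.lt _ _ (hlts (n + 1)) hn.le)⟩

/-! ### Codes of sequences -/

theorem mem_seqCode {α : Ordinal.{u}} {f : Ordinal.{u} → ZFSet.{u}} {y : ZFSet.{u}} :
    y ∈ seqCode α f ↔ ∃ ξ < α, ZFSet.pair ξ.toZFSet (f ξ) = y := by
  rw [seqCode, ZFSet.mem_range]
  exact ⟨fun ⟨ξ, h⟩ => ⟨ξ.1, ξ.2, h⟩, fun ⟨ξ, hξ, h⟩ => ⟨⟨ξ, hξ⟩, h⟩⟩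

theorem pair_mem_seqCode {α ξ : Ordinal.{u}} {f : Ordinal.{u} → ZFSet.{u}} {y : ZFSet.{u}} :
    ZFSet.pair ξ.toZFSet y ∈ seqCode α f ↔ ξ < α ∧ f ξ = y := by
  rw [mem_seqCode]
  constructor
  · rintro ⟨η, hη, h⟩
    obtain ⟨h1, h2⟩ := ZFSet.pair_inj.1 h
    obtain rfl := Ordinal.toZFSet_injective h1
    exact ⟨hη, h2⟩
  · rintro ⟨h, rfl⟩
    exact ⟨ξ, h, rfl⟩

theorem seqCode_congr {α : Ordinal.{u}} {f f' : Ordinal.{u} → ZFSet.{u}}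
    (h : ∀ ξ < α, f ξ = f' ξ) : seqCode α f = seqCode α f' := by
  ext y
  rw [mem_seqCode, mem_seqCode]
  exact exists_congr fun ξ => and_congr_right fun hξ => by rw [h ξ hξ]

theorem seqCode_inj {α α' : Ordinal.{u}} {f f' : Ordinal.{u} → ZFSet.{u}}
    (h : seqCode α f = seqCode α' f') : α = α' ∧ ∀ ξ < α, f ξ = f' ξ := by
  have h1 : ∀ ξ < α, ξ < α' ∧ f' ξ = f ξ := fun ξ hξ =>
    pair_mem_seqCode.1 (h ▸ pair_mem_seqCode.2 ⟨hξ, rfl⟩)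
  have h2 : ∀ ξ < α', ξ < α ∧ f ξ = f' ξ := fun ξ hξ =>
    pair_mem_seqCode.1 (h ▸ pair_mem_seqCode.2 ⟨hξ, rfl⟩)
  exact ⟨le_antisymm (le_of_forall_lt fun ξ hξ => (h1 ξ hξ).1)
    (le_of_forall_lt fun ξ hξ => (h2 ξ hξ).1), fun ξ hξ => ((h1 ξ hξ).2).symm⟩

theorem seqCode_mem_powerset {α θ : Ordinal.{u}} {f : Ordinal.{u} → ZFSet.{u}} {B : ZFSet.{u}}
    (hα : α ≤ θ) (hf : ∀ ξ < α, f ξ ∈ B) :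
    seqCode α f ∈ ZFSet.powerset (ZFSet.prod θ.toZFSet B) := by
  rw [ZFSet.mem_powerset]
  intro y hy
  obtain ⟨ξ, hξ, rfl⟩ := mem_seqCode.1 hy
  exact ZFSet.pair_mem_prod.2 ⟨Ordinal.toZFSet_mem_toZFSet_iff.2 (hξ.trans_le hα), hf ξ hξ⟩

/-- Being a non-limit point is decided locally; hence a code which records only `T ∩ γ` carries
enough information for a move. -/
theorem mem_nacc_of_inter_eq {T T' : Set Ordinal.{u}} {γ β : Ordinal.{u}}
    (h : T ∩ Iio γ = T' ∩ Iio γ) (hβ : β < γ) (hT : β ∈ nacc T) : β ∈ nacc T' := by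
  have h1 : ∀ x < γ, x ∈ T' → x ∈ T := fun x hx hx' => (h.symm.subset ⟨hx', hx⟩).1
  refine ⟨(h.subset ⟨hT.1, hβ⟩).1, fun hlim => hT.2 ⟨hlim.1, fun x hx => ?_⟩⟩
  obtain ⟨y, hy, hxy, hyβ⟩ := hlim.2 x hx
  exact ⟨y, h1 y (hyβ.trans hβ) hy, hxy, hyβ⟩

/-! ### Forcing notions with heights -/

/-- `Q` is a forcing notion each of whose conditions `p` has a height `ht p`, and avoids the ladder
`C δ` on a final segment for `δ ∈ S` below its height; `Bad p T g` is the set of places where `p`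
violates the requirement given by the ladder `T` and the function `g` on it. -/
structure IsLadderForcing (lam κ : Cardinal.{u}) (S : Set Ordinal.{u})
    (C : Ordinal.{u} → Set Ordinal.{u}) (h : Ordinal.{u} → Ordinal.{u} → Ordinal.{u})
    (Q : ForcingNotion.{u}) (ht : ZFSet.{u} → Ordinal.{u})
    (Bad : ZFSet.{u} → Set Ordinal.{u} → (Ordinal.{u} → Ordinal.{u}) → Set Ordinal.{u}) :
    Prop where
  nonempty : ∃ p, p ∈ Q.carrier
  ht_lt : ∀ p ∈ Q.carrier, ht p < κ.ord
  ht_mono : ∀ p ∈ Q.carrier, ∀ q ∈ Q.carrier, Q.le p q → ht p ≤ ht q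
  bad_mem : ∀ p ∈ Q.carrier, ∀ T g, ∀ β ∈ Bad p T g, β ∈ T ∧ β ≤ ht p
  bad_of_le : ∀ p ∈ Q.carrier, ∀ q ∈ Q.carrier, Q.le p q → ∀ T g, ∀ β ∈ Bad q T g,
    β ∈ Bad p T g ∨ ht p ≤ β
  -- Violations depend only on the ladder below `γ`. The assumption `γ ∉ T` excludes a violation at
  -- `γ` itself, which `bad_mem` permits when the height equals `γ`.
  bad_local : ∀ p ∈ Q.carrier, ∀ γ, ht p ≤ γ → ∀ T T' g g', γ ∉ T → T ∩ Iio γ = T' ∩ Iio γ →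
    (∀ β ∈ T, β < γ → g β = g' β) → Bad p T g ⊆ Bad p T' g'
  -- The limit of the chain may create one new violation, at `α`. This really occurs for closed
  -- sets, whose limit contains the new point `α`.
  upper : ∀ A : Set ZFSet.{u}, A.Nonempty → (∀ p ∈ A, p ∈ Q.carrier) →
    (∀ p ∈ A, ∀ q ∈ A, Q.le p q ∨ Q.le q p) → ∀ α < κ.ord, IsLUB (ht '' A) α →
    (α ∈ S → (∃ p ∈ A, ht p = α) ∨ ∃ β < α, ∀ p ∈ A, Bad p (C α) (h α) ⊆ Iic β) →
    ∃ b ∈ Q.carrier, (∀ p ∈ A, Q.le p b) ∧ ht b = α ∧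
      ∀ T g, ∀ β ∈ Bad b T g, (∃ p ∈ A, β ∈ Bad p T g) ∨ (β = α ∧ α ∈ nacc T)
  extend : ∀ p ∈ Q.carrier, ∀ γ < κ.ord, ht p < γ → ∀ T g, γ ∉ T → IsSmall lam (T ∩ Iio γ) →
    (∀ β ∈ T, β < γ → g β < lam.ord) →
    ∃ q ∈ Q.carrier, Q.le p q ∧ ht q = γ ∧ Bad q T g ⊆ Bad p T g

namespace IsLadderForcing

variable {lam κ : Cardinal.{u}} {S₀ S : Set Ordinal.{u}} {C : Ordinal.{u} → Set Ordinal.{u}}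
  {h : Ordinal.{u} → Ordinal.{u} → Ordinal.{u}} {Q : ForcingNotion.{u}}
  {ht : ZFSet.{u} → Ordinal.{u}}
  {Bad : ZFSet.{u} → Set Ordinal.{u} → (Ordinal.{u} → Ordinal.{u}) → Set Ordinal.{u}}

theorem increasing_chain {θ : Ordinal.{u}} {p : Ordinal.{u} → ZFSet.{u}} (hp : Q.Increasing θ p) :
    ∀ x ∈ p '' Iio θ, ∀ y ∈ p '' Iio θ, Q.le x y ∨ Q.le y x := by
  rintro _ ⟨i, hi, rfl⟩ _ ⟨j, hj, rfl⟩
  rcases le_total i j with hij | hij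
  exacts [Or.inl (hp.2 i j hij hj), Or.inr (hp.2 j i hij hi)]

/-- If the supremum `α` of the heights were in `S` and not attained, the chain would show that the
cofinality of `α` is not `λ`. -/
theorem isLTComplete (H : IsLadderForcing lam κ S C h Q ht Bad) (hlam : Cardinal.aleph0 < lam)
    (hκ : κ = Order.succ lam) (hS : S ⊆ cofSet κ lam) : Q.IsLTComplete lam.ord := by
  intro δ hδ p hp
  rcases eq_or_ne δ 0 with rfl | hδ0
  · obtain ⟨b, hb⟩ := H.nonempty
    exact ⟨b, hb, fun i hi => absurd hi not_lt_zero⟩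
  have h0 : (0 : Ordinal.{u}) < δ := pos_iff_ne_zero.2 hδ0
  have hκreg : κ.IsRegular := hκ ▸ Cardinal.isRegular_succ hlam.le
  have hδκ : δ < κ.ord := hδ.trans (Cardinal.ord_lt_ord.2 (hκ ▸ Order.lt_succ lam))
  obtain ⟨β, hβ, hb⟩ := exists_bound_of_lt_cof hκreg.cof_ord hκreg.ne_zero hδκ (fun i => ht (p i))
    fun i hi => H.ht_lt _ (hp.1 i hi)
  have hbdd : β ∈ upperBounds (ht '' (p '' Iio δ)) := by
    rintro _ ⟨_, ⟨i, hi, rfl⟩, rfl⟩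
    exact hb i hi
  have hne : (p '' Iio δ).Nonempty := ⟨p 0, 0, h0, rfl⟩
  have hlub := isLUB_csSup (hne.image ht) ⟨β, hbdd⟩
  set α := sSup (ht '' (p '' Iio δ)) with hα
  have hin : ∀ x ∈ p '' Iio δ, x ∈ Q.carrier := by
    rintro _ ⟨i, hi, rfl⟩
    exact hp.1 i hi
  obtain ⟨b, hbQ, hbub, -⟩ := H.upper (p '' Iio δ) hne hin (increasing_chain hp) α
    ((hlub.2 hbdd).trans_lt hβ) hlub fun hαS => Or.inl (by
      by_contra! hna
      refine cof_ne_of_forall_exists (zero_le.trans_lt hlam).ne' hδ (fun i => ht (p i))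
        (fun i hi => lt_of_le_of_ne (hlub.1 ⟨_, ⟨i, hi, rfl⟩, rfl⟩) (hna _ ⟨i, hi, rfl⟩))
        (fun β hβ => ?_) (hS hαS).2
      obtain ⟨_, ⟨_, ⟨i, hi, rfl⟩, rfl⟩, hlt⟩ := (lt_isLUB_iff hlub).1 hβ
      exact ⟨i, hi, hlt⟩)
  exact ⟨b, hbQ, fun i hi => hbub _ ⟨i, hi, rfl⟩⟩

/-- The set of conditions of height greater than `b`. -/
def aboveSet (Q : ForcingNotion.{u}) (ht : ZFSet.{u} → Ordinal.{u}) (b : ZFSet.{u}) : ZFSet.{u} :=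
  ZFSet.sep (fun p => b ∈ (ht p).toZFSet) Q.carrier

theorem openDense_aboveSet (H : IsLadderForcing lam κ S C h Q ht Bad)
    (hlam : Cardinal.aleph0 < lam) (hκ : κ = Order.succ lam) {β : Ordinal.{u}} (hβ : β < κ.ord) :
    Q.OpenDense (aboveSet Q ht β.toZFSet) := by
  simp only [aboveSet, ForcingNotion.OpenDense, ZFSet.mem_sep, Ordinal.toZFSet_mem_toZFSet_iff]
  refine ⟨ZFSet.sep_subset, fun p hp q hq hpq => ⟨hq, hp.2.trans_le (H.ht_mono p hp.1 q hq hpq)⟩,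
    fun p hp => ?_⟩
  have hlim : Order.IsSuccLimit κ.ord :=
    Cardinal.isSuccLimit_ord (hκ ▸ hlam.le.trans (Order.le_succ lam))
  obtain ⟨q, hq, hpq, hht, -⟩ := H.extend p hp (Order.succ (max β (ht p)))
    (hlim.succ_lt (max_lt hβ (H.ht_lt p hp))) ((le_max_right _ _).trans_lt (Order.lt_succ _)) ∅ id
    (notMem_empty _) (by simpa using isSmall_empty (zero_le.trans_lt hlam).ne')
    fun β hβ => absurd hβ (notMem_empty β)
  exact ⟨q, ⟨hq, hht ▸ (le_max_left _ _).trans_lt (Order.lt_succ _)⟩, hpq⟩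

/-- The closure properties of a set `N` needed to compute the heights of generic sequences. -/
structure HeightClosed (κ : Cardinal.{u}) (Q : ForcingNotion.{u}) (ht : ZFSet.{u} → Ordinal.{u})
    (N : ZFSet.{u}) : Prop where
  ht_mem : ∀ p ∈ Q.carrier, p ∈ N → (ht p).toZFSet ∈ N
  above_mem : ∀ b ∈ κ.ord.toZFSet, b ∈ N → aboveSet Q ht b ∈ N

theorem ht_lt_of_mem (H : IsLadderForcing lam κ S C h Q ht Bad) {N : ZFSet.{u}}
    (hN : HeightClosed κ Q ht N) {δ : Ordinal.{u}} (htr : trace N κ = Iio δ) {p : ZFSet.{u}}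
    (hp : p ∈ Q.carrier) (hpN : p ∈ N) : ht p < δ := by
  have h1 : ht p ∈ trace N κ := ⟨hN.ht_mem p hp hpN, H.ht_lt p hp⟩
  rwa [htr] at h1

theorem exists_lt_ht_of_generic (H : IsLadderForcing lam κ S C h Q ht Bad)
    (hlam : Cardinal.aleph0 < lam) (hκ : κ = Order.succ lam) {N : ZFSet.{u}}
    (hN : HeightClosed κ Q ht N) {δ : Ordinal.{u}} (htr : trace N κ = Iio δ)
    {θ : Ordinal.{u}} {q : Ordinal.{u} → ZFSet.{u}} (hq : Q.GenericSeq N θ q)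
    {β : Ordinal.{u}} (hβ : β < δ) : ∃ i < θ, β < ht (q i) := by
  have h1 : β ∈ trace N κ := by
    rw [htr]
    exact hβ
  obtain ⟨i, hi, h2⟩ := hq.2.2 _ (hN.above_mem _ (Ordinal.toZFSet_mem_toZFSet_iff.2 h1.2) h1.1)
    (H.openDense_aboveSet hlam hκ h1.2)
  exact ⟨i, hi, Ordinal.toZFSet_mem_toZFSet_iff.1 (ZFSet.mem_sep.1 h2).2⟩

/-- The heights stay below `δ = N ∩ κ` because `N` is closed under `ht`, and are cofinal in it by
genericity for the dense sets `aboveSet`. As `δ ∉ S`, the limit faces no requirement at `δ`. -/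
theorem upper_of_generic (H : IsLadderForcing lam κ S C h Q ht Bad)
    (hlam : Cardinal.aleph0 < lam) (hκ : κ = Order.succ lam) {N : ZFSet.{u}}
    (hN : HeightClosed κ Q ht N) {δ : Ordinal.{u}} (htr : trace N κ = Iio δ) (hδκ : δ < κ.ord)
    (hδS : δ ∉ S) {q : Ordinal.{u} → ZFSet.{u}} (hq : Q.GenericSeq N lam.ord q) :
    Q.HasUpperBound lam.ord q := by
  have h0 : (0 : Ordinal.{u}) < lam.ord := (isSuccLimit_ord hlam).bot_lt
  have hin : ∀ x ∈ q '' Iio lam.ord, x ∈ Q.carrier := by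
    rintro _ ⟨i, hi, rfl⟩
    exact hq.1.1 i hi
  obtain ⟨b, hb, hub, -⟩ := H.upper (q '' Iio lam.ord) ⟨q 0, 0, h0, rfl⟩ hin
    (increasing_chain hq.1) δ hδκ (by
      refine ⟨?_, fun b hb => ?_⟩
      · rintro _ ⟨_, ⟨i, hi, rfl⟩, rfl⟩
        exact (H.ht_lt_of_mem hN htr (hq.1.1 i hi) (hq.2.1 i hi)).le
      · by_contra! hbδ
        obtain ⟨i, hi, h1⟩ := H.exists_lt_ht_of_generic hlam hκ hN htr hq hbδ
        exact (hb ⟨_, ⟨i, hi, rfl⟩, rfl⟩).not_gt h1) fun h => absurd h hδS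
  exact ⟨b, hb, fun i hi => hub _ ⟨i, hi, rfl⟩⟩

theorem stronglyComplete (H : IsLadderForcing lam κ S C h Q ht Bad)
    (hlam : Cardinal.aleph0 < lam) (hκ : κ = Order.succ lam) (hS₀ : S₀ ⊆ cofSet κ lam)
    (hdisj : ∀ δ ∈ S₀, δ ∉ S) : StronglyComplete lam κ (asFamily S₀) Q := by
  obtain ⟨χ₀, x, hx⟩ := exists_closure_witness ∅ Q.carrier κ.ord.toZFSet id
    (fun p => (ht p).toZFSet) (aboveSet Q ht)
  refine ⟨χ₀, fun χ hχ _ W _ => ⟨x, (hx χ hχ).1, fun N hN hgood hxN _ p hp => ?_⟩⟩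
  obtain ⟨-, -, h2, h3⟩ := (hx χ hχ).2 W N hN hxN
  obtain ⟨δ, hδ, htr⟩ := hgood.2.2
  exact H.upper_of_generic hlam hκ ⟨h2, h3⟩ htr (hS₀ hδ).1 (hdisj δ hδ) hp

/-! ### A single move -/

/-- `a` codes the set of conditions `A`, the ordinal `γ`, and the function `g` on `T ∩ γ`. -/
def MoveCode (lam : Cardinal.{u}) (a : ZFSet.{u}) (A : Set ZFSet.{u}) (γ : Ordinal.{u})
    (T : Set Ordinal.{u}) (g : Ordinal.{u} → Ordinal.{u}) : Prop :=
  ∃ (r : ZFSet.{u}) (i : Ordinal.{u}) (q : Ordinal.{u} → Ordinal.{u} → ZFSet.{u})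
    (τ : Ordinal.{u}) (t : Ordinal.{u} → Ordinal.{u}),
    a = ZFSet.pair r (ZFSet.pair γ.toZFSet
      (ZFSet.pair (seqCode τ fun ξ => ZFSet.pair (t ξ).toZFSet (g (t ξ)).toZFSet)
        (seqCode i fun j => seqCode lam.ord (q j)))) ∧
    A = {r} ∪ {x | ∃ j < i, ∃ ξ < lam.ord, x = q j ξ} ∧ T ∩ Iio γ = t '' Iio τ

theorem MoveCode.unique {a : ZFSet.{u}} {A A' : Set ZFSet.{u}} {γ γ' : Ordinal.{u}}
    {T T' : Set Ordinal.{u}} {g g' : Ordinal.{u} → Ordinal.{u}} (h : MoveCode lam a A γ T g)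
    (h' : MoveCode lam a A' γ' T' g') :
    A = A' ∧ γ = γ' ∧ T ∩ Iio γ = T' ∩ Iio γ ∧ ∀ β ∈ T, β < γ → g β = g' β := by
  obtain ⟨r, i, q, τ, t, ha, hA, hT⟩ := h
  obtain ⟨r', i', q', τ', t', ha', hA', hT'⟩ := h'
  rw [ha] at ha'
  simp only [ZFSet.pair_inj] at ha'
  obtain ⟨rfl, h1, h2, h3⟩ := ha'
  obtain rfl := Ordinal.toZFSet_injective h1
  obtain ⟨rfl, hs⟩ := seqCode_inj h2
  obtain ⟨rfl, hq⟩ := seqCode_inj h3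
  have h4 : ∀ ξ < τ, t ξ = t' ξ ∧ g (t ξ) = g' (t' ξ) := fun ξ hξ => by
    obtain ⟨h5, h6⟩ := ZFSet.pair_inj.1 (hs ξ hξ)
    exact ⟨Ordinal.toZFSet_injective h5, Ordinal.toZFSet_injective h6⟩
  refine ⟨?_, rfl, ?_, fun β hβ hβγ => ?_⟩
  · rw [hA, hA']
    congr 1
    ext x
    refine exists_congr fun j => and_congr_right fun hj => exists_congr fun ξ =>
      and_congr_right fun hξ => ?_
    rw [(seqCode_inj (hq j hj)).2 ξ hξ]
  · rw [hT, hT']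
    exact image_congr fun ξ hξ => (h4 ξ hξ).1
  · have h5 : β ∈ t '' Iio τ := hT ▸ ⟨hβ, hβγ⟩
    obtain ⟨ξ, hξ, rfl⟩ := h5
    rw [(h4 ξ hξ).2, (h4 ξ hξ).1]

/-- The hypotheses which allow to extend all the conditions from `A` to a condition of height `γ`
satisfying the requirement given by `T` and `g` between the supremum of their heights and `γ`. -/
structure MoveHyp (lam κ : Cardinal.{u}) (S : Set Ordinal.{u}) (Q : ForcingNotion.{u})
    (ht : ZFSet.{u} → Ordinal.{u}) (A : Set ZFSet.{u}) (γ : Ordinal.{u}) (T : Set Ordinal.{u})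
    (g : Ordinal.{u} → Ordinal.{u}) : Prop where
  mem : ∀ p ∈ A, p ∈ Q.carrier
  chain : ∀ p ∈ A, ∀ q ∈ A, Q.le p q ∨ Q.le q p
  lub : ∃ α < γ, IsLUB (ht '' A) α ∧ (α ∈ S → ∃ p ∈ A, ht p = α)
  lt : γ < κ.ord
  notMem : γ ∉ T
  small : IsSmall lam (T ∩ Iio γ)
  values : ∀ β ∈ T, β < γ → g β < lam.ord

/-- `z` is an extension as described above. -/
structure MoveSpec (Q : ForcingNotion.{u}) (ht : ZFSet.{u} → Ordinal.{u})
    (Bad : ZFSet.{u} → Set Ordinal.{u} → (Ordinal.{u} → Ordinal.{u}) → Set Ordinal.{u})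
    (A : Set ZFSet.{u}) (γ : Ordinal.{u}) (T : Set Ordinal.{u})
    (g : Ordinal.{u} → Ordinal.{u}) (z : ZFSet.{u}) : Prop where
  mem : z ∈ Q.carrier
  le : ∀ p ∈ A, Q.le p z
  ht_eq : ht z = γ
  bad : ∀ β ∈ Bad z T g, (∃ p ∈ A, β ∈ Bad p T g) ∨ (IsLUB (ht '' A) β ∧ β ∈ nacc T)

/-- Take the limit of `A`, of height `α`, and extend it to height `γ` following `g` on `T`. The only
violation not inherited from `A` can be at `α`. -/
theorem exists_moveSpec (H : IsLadderForcing lam κ S C h Q ht Bad) {A : Set ZFSet.{u}}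
    {γ : Ordinal.{u}} {T : Set Ordinal.{u}} {g : Ordinal.{u} → Ordinal.{u}} (hne : A.Nonempty)
    (hyp : MoveHyp lam κ S Q ht A γ T g) : ∃ z, MoveSpec Q ht Bad A γ T g z := by
  obtain ⟨α, hαγ, hlub, hα⟩ := hyp.lub
  obtain ⟨b, hb, hub, hht, hbad⟩ := H.upper A hne hyp.mem hyp.chain α (hαγ.trans hyp.lt) hlub
    fun h => Or.inl (hα h)
  obtain ⟨z, hz, hbz, hzt, hzb⟩ := H.extend b hb γ hyp.lt (hht ▸ hαγ) T g hyp.notMem hyp.small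
    hyp.values
  refine ⟨z, hz, fun p hp => Q.le_trans p (hyp.mem p hp) b hb z hz (hub p hp) hbz, hzt,
    fun β hβ => (hbad T g β (hzb hβ)).imp_right ?_⟩
  rintro ⟨rfl, h⟩
  exact ⟨hlub, h⟩

/-- A move correct for one ladder is correct for any ladder and function that agree with it below
`γ`. -/
theorem MoveSpec.congr (H : IsLadderForcing lam κ S C h Q ht Bad) {A : Set ZFSet.{u}}
    {γ : Ordinal.{u}} {T T' : Set Ordinal.{u}} {g g' : Ordinal.{u} → Ordinal.{u}} {z : ZFSet.{u}}
    (hyp : MoveHyp lam κ S Q ht A γ T g) (hyp' : MoveHyp lam κ S Q ht A γ T' g')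
    (hT : T ∩ Iio γ = T' ∩ Iio γ) (hg : ∀ β ∈ T, β < γ → g β = g' β)
    (hz : MoveSpec Q ht Bad A γ T g z) : MoveSpec Q ht Bad A γ T' g' z := by
  obtain ⟨α, hαγ, hlub, -⟩ := hyp.lub
  refine ⟨hz.mem, hz.le, hz.ht_eq, fun β hβ => ?_⟩
  have h1 : β ∈ Bad z T g := by
    refine H.bad_local z hz.mem γ hz.ht_eq.le T' T g' g hyp'.notMem hT.symm (fun x hx hxγ => ?_) hβ
    exact (hg x (hT.symm.subset ⟨hx, hxγ⟩).1 hxγ).symm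
  rcases hz.bad β h1 with ⟨p, hp, h2⟩ | ⟨h2, h3⟩
  · exact Or.inl ⟨p, hp, H.bad_local p (hyp.mem p hp) γ ((hlub.1 ⟨p, hp, rfl⟩).trans hαγ.le)
      T T' g g' hyp.notMem hT hg h2⟩
  · exact Or.inr ⟨h2, mem_nacc_of_inter_eq hT (h2.unique hlub ▸ hαγ) h3⟩

/-- The function computing a move from its code. -/
theorem exists_move (H : IsLadderForcing lam κ S C h Q ht Bad) :
    ∃ F : ZFSet.{u} → ZFSet.{u}, ∀ a A γ T g, MoveCode lam a A γ T g →
      MoveHyp lam κ S Q ht A γ T g → MoveSpec Q ht Bad A γ T g (F a) := by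
  have key : ∀ a : ZFSet.{u}, ∃ z, ∀ A γ T g, MoveCode lam a A γ T g →
      MoveHyp lam κ S Q ht A γ T g → MoveSpec Q ht Bad A γ T g z := by
    intro a
    -- Any data decoded from `a` serve for the choice: other decodings have the same `A` and `γ` and
    -- agree on the ladder below `γ`.
    by_cases hex : ∃ A γ T g, MoveCode lam a A γ T g ∧ MoveHyp lam κ S Q ht A γ T g
    · obtain ⟨A, γ, T, g, hcode, hyp⟩ := hex
      have hne : A.Nonempty := by
        obtain ⟨r, _, _, _, _, _, hA, _⟩ := hcode
        exact ⟨r, hA ▸ Or.inl rfl⟩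
      obtain ⟨z, hz⟩ := H.exists_moveSpec hne hyp
      refine ⟨z, fun A' γ' T' g' hcode' hyp' => ?_⟩
      obtain ⟨rfl, rfl, hT, hg⟩ := hcode.unique hcode'
      exact MoveSpec.congr H hyp hyp' hT hg hz
    · exact ⟨∅, fun A γ T g h1 h2 => absurd ⟨A, γ, T, g, h1, h2⟩ hex⟩
  choose F hF using key
  exact ⟨F, hF⟩

/-- A set containing the relevant codes of moves. -/
def moveDomain (lam κ : Cardinal.{u}) (Q : ForcingNotion.{u}) : ZFSet.{u} :=
  ZFSet.prod Q.carrier (ZFSet.prod κ.ord.toZFSet (ZFSet.prod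
    (ZFSet.powerset (ZFSet.prod lam.ord.toZFSet (ZFSet.prod κ.ord.toZFSet lam.ord.toZFSet)))
    (ZFSet.powerset (ZFSet.prod lam.ord.toZFSet
      (ZFSet.powerset (ZFSet.prod lam.ord.toZFSet Q.carrier))))))

end IsLadderForcing

/-! ### COM's play in the game -/

theorem not_mem_nacc_of_limit {T : Set Ordinal.{u}} {α : Ordinal.{u}} (h0 : α ≠ 0)
    (h : ∀ β < α, ∃ t ∈ T, β < t ∧ t < α) : α ∉ nacc T := fun hα => hα.2 ⟨h0, h⟩

/-- Used for COM's conditions: the `i`-th one depends on INC's answers before `i`, which depend only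
on COM's earlier moves. -/
theorem exists_recursion (step : Ordinal.{u} → (Ordinal.{u} → ZFSet.{u}) → ZFSet.{u})
    (hstep : ∀ i f f', (∀ j < i, f j = f' j) → step i f = step i f') :
    ∃ p : Ordinal.{u} → ZFSet.{u}, ∀ i, p i = step i p := by
  classical
  let p : Ordinal.{u} → ZFSet.{u} := (wellFounded_lt (α := Ordinal.{u})).fix fun i prev =>
    step i fun j => if hj : j < i then prev j hj else ∅
  refine ⟨p, fun i => ?_⟩
  refine (WellFounded.fix_eq _ _ i).trans (hstep i _ _ fun j hj => ?_)
  rw [dif_pos hj]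

/-- A set `T` and a function `g` which represent the ladder at the limit of the models, if there is
one, together with a large set `E` of indices at the limits of which `nacc T` is avoided. -/
theorem exists_target {lam κ : Cardinal.{u}} {S₀ S : Set Ordinal.{u}}
    {C : Ordinal.{u} → Set Ordinal.{u}} {h : Ordinal.{u} → Ordinal.{u} → Ordinal.{u}}
    (hreg : lam.IsRegular) (hlam : Cardinal.aleph0 < lam) (hS₀ : S₀ ⊆ cofSet κ lam)
    (hS : S ⊆ cofSet κ lam) (hC : IsLadderSystem lam S₀ S C)
    (hh : ∀ δ ∈ S, ∀ β ∈ C δ, h δ β < lam.ord) {F : Filter (Iio lam.ord)}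
    (hF : F = clubFilter lam ∨ IsNormalFilter lam F) {A : Ordinal.{u} → Ordinal.{u}}
    (hA : IsContSeq lam.ord A) (hA₀ : ∀ i ≤ lam.ord, ¬ Order.IsSuccLimit i → A i ∈ S₀) :
    ∃ (T : Set Ordinal.{u}) (g : Ordinal.{u} → Ordinal.{u}) (E : Set (Iio lam.ord)),
      E ∈ F ∧ (A lam.ord ∈ S → T = C (A lam.ord) ∧ g = h (A lam.ord)) ∧
      (∀ β < A lam.ord, IsSmall lam (T ∩ Iio β)) ∧ (∀ t ∈ T, g t < lam.ord) ∧
      (∀ t ∈ nacc T, t ∉ S₀) ∧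
      ∀ z : Iio lam.ord, ∀ d ⊆ E, d.Nonempty → IsLUB d z → A z.1 ∉ nacc T := by
  by_cases hδ : A lam.ord ∈ S
  · have hlim := isSuccLimit_of_cof_eq hlam (hS hδ).2
    -- Since `C δ` is cofinal in `δ = A λ` and `A` is continuous, `A ζ` is a limit of `C δ` for club
    -- many `ζ`.
    have hclub : IsClub {ζ : Iio lam.ord | ∀ β < A ζ.1, ∃ t ∈ C (A lam.ord), β < t ∧ t < A ζ.1} :=
      hA.isClub_limits hreg hlam fun β hβ => by
        obtain ⟨t, ht, hβt⟩ := hC.exists_gt hδ hlim hβ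
        exact ⟨t, ht, hβt, (hC _ hδ).1 ht⟩
    refine ⟨C (A lam.ord), h (A lam.ord), _, mem_filter_of_isClub hlam hF hclub,
      fun _ => ⟨rfl, rfl⟩, fun β hβ => hC.isSmall hδ hlim hβ, hh _ hδ, (hC _ hδ).2.2.2,
      fun z d hd hne hz => not_mem_nacc_of_limit ?_ (hclub.isLUB_mem hd hne hz)⟩
    have hz : z.1 < lam.ord := z.2
    -- By definition `0` never counts as a limit, so `A z ≠ 0` is needed to exclude `A z` from `nacc
    -- T`.
    have h1 : A 0 ∈ S₀ := hA₀ 0 zero_le (by simp)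
    have h2 : A 0 ≠ 0 := (isSuccLimit_of_cof_eq hlam (hS₀ h1).2).ne_bot
    exact ((pos_iff_ne_zero.2 h2).trans_le (hA.le zero_le hz.le)).ne'
  · exact ⟨∅, id, univ, Filter.univ_mem, fun h => absurd h hδ,
      fun β _ => by simpa using isSmall_empty hreg.ne_zero, by simp, by simp [nacc], by simp [nacc]⟩

namespace IsLadderForcing

variable {lam κ : Cardinal.{u}} {S₀ S : Set Ordinal.{u}} {C : Ordinal.{u} → Set Ordinal.{u}}
  {h : Ordinal.{u} → Ordinal.{u} → Ordinal.{u}} {Q : ForcingNotion.{u}}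
  {ht : ZFSet.{u} → Ordinal.{u}}
  {Bad : ZFSet.{u} → Set Ordinal.{u} → (Ordinal.{u} → Ordinal.{u}) → Set Ordinal.{u}}

/-- The conditions which have to be extended at stage `i` of the game. -/
def prevConds (lam : Cardinal.{u}) (r : ZFSet.{u}) (q : Ordinal.{u} → Ordinal.{u} → ZFSet.{u})
    (i : Ordinal.{u}) : Set ZFSet.{u} :=
  {r} ∪ {x | ∃ j < i, ∃ ξ < lam.ord, x = q j ξ}

/-- The supremum of the heights of the conditions which have to be extended at stage `i`. -/
theorem exists_isLUB_prevConds (hlam : Cardinal.aleph0 < lam)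
    {A : Ordinal.{u} → Ordinal.{u}} (hA : IsContSeq lam.ord A)
    (hA₀ : ∀ i ≤ lam.ord, ¬ Order.IsSuccLimit i → A i ∈ S₀) (hdisj : ∀ δ ∈ S₀, δ ∉ S)
    (hS : S ⊆ cofSet κ lam) {T : Set Ordinal.{u}} (hT₀ : ∀ t ∈ nacc T, t ∉ S₀)
    {E : Set (Iio lam.ord)}
    (hE : ∀ z : Iio lam.ord, ∀ d ⊆ E, d.Nonempty → IsLUB d z → A z.1 ∉ nacc T)
    {ζ : Ordinal.{u} → Iio lam.ord} {r : ZFSet.{u}}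
    {q : Ordinal.{u} → Ordinal.{u} → ZFSet.{u}} {i : Ordinal.{u}} (hi : i < lam.ord)
    (hζE : ∀ j < i, ζ j ∈ E) (hζ : ∀ j ≤ i, ∀ k < j, ζ k < ζ j)
    (hr : ∀ j < i, ∀ ξ < lam.ord, ht r ≤ ht (q j ξ))
    (hlt : ∀ j < i, ∀ ξ < lam.ord, ht (q j ξ) < A (Order.succ (ζ j).1))
    (hcof : ∀ j < i, ∀ β < A (Order.succ (ζ j).1), ∃ ξ < lam.ord, β < ht (q j ξ)) :
    ∃ α ≤ max (ht r) (A (ζ i).1), IsLUB (ht '' prevConds lam r q i) α ∧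
      (α ∈ S → ∃ p ∈ prevConds lam r q i, ht p = α) ∧ (α ∈ nacc T → α ≤ ht r) := by
  have h0 : (0 : Ordinal.{u}) < lam.ord := (isSuccLimit_ord hlam).bot_lt
  have hsl : ∀ z : Iio lam.ord, Order.succ z.1 < lam.ord := fun z =>
    (isSuccLimit_ord hlam).succ_lt z.2
  rcases Ordinal.zero_or_succ_or_isSuccLimit i with rfl | ⟨j, rfl⟩ | hlim
  -- Stage `0`: only `r` has to be extended, and its height is attained.
  · have h1 : prevConds lam r q 0 = {r} := by
      rw [prevConds, union_eq_left]
      rintro x ⟨j, hj, -⟩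
      exact absurd hj not_lt_zero
    refine ⟨ht r, le_max_left _ _, ?_, fun _ => ⟨r, Or.inl rfl, rfl⟩, fun _ => le_rfl⟩
    rw [h1, image_singleton]
    exact isLUB_singleton
  -- Successor stage: the last generic sequence has heights cofinal in `A (ζ j + 1)`. This is in
  -- `S₀`, hence neither in `S` nor in `nacc T`.
  · have hj : j < Order.succ j := Order.lt_succ j
    have hmem : A (Order.succ (ζ j).1) ∈ S₀ :=
      hA₀ _ (hsl _).le (Order.not_isSuccLimit_succ _)
    refine ⟨A (Order.succ (ζ j).1), le_max_of_le_right ?_, ⟨?_, fun b hb => ?_⟩,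
      fun h => absurd h (hdisj _ hmem), fun h => absurd hmem (hT₀ _ h)⟩
    · exact hA.le (Order.succ_le_of_lt (hζ _ le_rfl j hj)) (ζ (Order.succ j)).2.le
    · rintro _ ⟨x, rfl | ⟨k, hk, ξ, hξ, rfl⟩, rfl⟩
      · exact (hr j hj 0 h0).trans (hlt j hj 0 h0).le
      · refine (hlt k hk ξ hξ).le.trans (hA.le (Order.succ_le_succ ?_) (hsl _).le)
        rcases (Order.lt_succ_iff.1 hk).eq_or_lt with rfl | hkj
        exacts [le_rfl, (hζ j hj.le k hkj).le]
    · by_contra! hbα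
      obtain ⟨ξ, hξ, h1⟩ := hcof j hj b hbα
      exact (hb ⟨_, Or.inr ⟨j, hj, ξ, hξ, rfl⟩, rfl⟩).not_gt h1
  -- Limit stage: with `z` the supremum of the earlier indices, the heights are cofinal in `A z`.
  · have hi0 : 0 < i := hlim.bot_lt
    have hbdd : BddAbove ((fun j => (ζ j).1) '' Iio i) := by
      refine ⟨(ζ i).1, ?_⟩
      rintro _ ⟨j, hj, rfl⟩
      exact (hζ i le_rfl j hj).le
    have hne : ((fun j => (ζ j).1) '' Iio i).Nonempty := ⟨_, 0, hi0, rfl⟩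
    have hlub := isLUB_csSup hne hbdd
    set z := sSup ((fun j => (ζ j).1) '' Iio i) with hz
    have hzi : z ≤ (ζ i).1 := hlub.2 (by
      rintro _ ⟨j, hj, rfl⟩
      exact (hζ i le_rfl j hj).le)
    have hζi : (ζ i).1 < lam.ord := (ζ i).2
    have hzl : z < lam.ord := hzi.trans_lt hζi
    have hup : ∀ j < i, Order.succ (ζ j).1 ≤ z := fun j hj =>
      Order.succ_le_of_lt ((Subtype.coe_lt_coe.2
        (hζ _ (hlim.succ_lt hj).le j (Order.lt_succ j))).trans_le
          (hlub.1 ⟨Order.succ j, hlim.succ_lt hj, rfl⟩))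
    have hex : ∀ b < z, ∃ j < i, b < (ζ j).1 := fun b hb => by
      obtain ⟨_, ⟨j, hj, rfl⟩, h1⟩ := (lt_isLUB_iff hlub).1 hb
      exact ⟨j, hj, h1⟩
    have hzlim : Order.IsSuccLimit z := by
      refine isSuccLimit_of_forall_exists ?_ fun b hb => ?_
      · exact (zero_le.trans_lt ((Order.lt_succ _).trans_le (hup 0 hi0))).ne'
      · obtain ⟨j, hj, h1⟩ := hex b hb
        exact ⟨_, h1, (Order.lt_succ _).trans_le (hup j hj)⟩
    have hAex : ∀ β < A z, ∃ j < i, β < A (ζ j).1 := fun β hβ => by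
      obtain ⟨k, hk, h1⟩ := hA.cont z hzl.le hzlim β hβ
      obtain ⟨j, hj, h2⟩ := hex k hk
      exact ⟨j, hj, h1.trans_le (hA.le h2.le (ζ j).2.le)⟩
    have hAlt : ∀ j < i, A (ζ j).1 < A z := fun j hj =>
      hA.lt _ _ ((Order.lt_succ _).trans_le (hup j hj)) hzl.le
    refine ⟨A z, le_max_of_le_right (hA.le hzi hζi.le), ⟨?_, fun b hb => ?_⟩, fun hzS => ?_,
      fun hzT => ?_⟩
    · rintro _ ⟨x, rfl | ⟨k, hk, ξ, hξ, rfl⟩, rfl⟩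
      · exact ((hr 0 hi0 0 h0).trans (hlt 0 hi0 0 h0).le).trans (hA.le (hup 0 hi0) hzl.le)
      · exact (hlt k hk ξ hξ).le.trans (hA.le (hup k hk) hzl.le)
    · by_contra! hbα
      obtain ⟨j, hj, h1⟩ := hAex b hbα
      obtain ⟨ξ, hξ, h2⟩ := hcof j hj b (h1.trans (hA.lt _ _ (Order.lt_succ _) (hsl _).le))
      exact (hb ⟨_, Or.inr ⟨j, hj, ξ, hξ, rfl⟩, rfl⟩).not_gt h2
    -- A cofinal sequence of length `i < λ` shows that `A z` does not have cofinality `λ`.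
    · exact absurd (hS hzS).2
        (cof_ne_of_forall_exists (zero_le.trans_lt hlam).ne' hi (fun j => A (ζ j).1) hAlt hAex)
    -- The index `z` is a supremum of members of `E`, so `A z` is a limit of `T`.
    · refine absurd hzT (hE ⟨z, hzl⟩ (ζ '' Iio i) ?_ ⟨_, 0, hi0, rfl⟩ ⟨?_, fun b hb => ?_⟩)
      · rintro _ ⟨j, hj, rfl⟩
        exact hζE j hj
      · rintro _ ⟨j, hj, rfl⟩
        exact Subtype.coe_le_coe.1 (hlub.1 ⟨j, hj, rfl⟩)
      · refine Subtype.coe_le_coe.1 (hlub.2 ?_)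
        rintro _ ⟨j, hj, rfl⟩
        exact Subtype.coe_le_coe.2 (hb ⟨j, hj, rfl⟩)

/-- The properties of the models which are used in the game. -/
structure GameModels (lam κ : Cardinal.{u}) (Q : ForcingNotion.{u})
    (ht : ZFSet.{u} → Ordinal.{u}) (F : ZFSet.{u} → ZFSet.{u}) (N : Ordinal.{u} → ZFSet.{u})
    (A : Ordinal.{u} → Ordinal.{u}) (X : Set (Iio lam.ord)) : Prop where
  mono : ∀ i j, i ≤ j → j ≤ lam.ord → N i ⊆ N j
  ords : ∀ ξ < lam.ord, ξ.toZFSet ∈ N 0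
  pair_mem : ∀ i ≤ lam.ord, ∀ a ∈ N i, ∀ b ∈ N i, ZFSet.pair a b ∈ N i
  move_mem : ∀ i ≤ lam.ord, ∀ a ∈ moveDomain lam κ Q, a ∈ N i → F a ∈ N i
  height : ∀ i ≤ lam.ord, HeightClosed κ Q ht (N i)
  closed : ∀ z ∈ X, ClosedLT lam (N (Order.succ z.1))
  trace_eq : ∀ z ∈ X, trace (N (Order.succ z.1)) κ = Iio (A (Order.succ z.1))

/-- The choices of COM which depend only on the index of the model. -/
theorem exists_heights (H : IsLadderForcing lam κ S C h Q ht Bad) (hlam : Cardinal.aleph0 < lam)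
    (hS₀ : S₀ ⊆ cofSet κ lam) {A : Ordinal.{u} → Ordinal.{u}} (hA : IsContSeq lam.ord A)
    (hA₀ : ∀ i ≤ lam.ord, ¬ Order.IsSuccLimit i → A i ∈ S₀) {T : Set Ordinal.{u}}
    (hTs : ∀ β < A lam.ord, IsSmall lam (T ∩ Iio β)) {F : ZFSet.{u} → ZFSet.{u}}
    {N : Ordinal.{u} → ZFSet.{u}} {X : Set (Iio lam.ord)} (hN : GameModels lam κ Q ht F N A X)
    {r : ZFSet.{u}} (hr : r ∈ Q.carrier) (hrN : r ∈ N 0) {z : Iio lam.ord} (hz : z ∈ X) :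
    ∃ γ τ, ∃ t : Ordinal.{u} → Ordinal.{u}, γ < A (Order.succ z.1) ∧ A z.1 < γ ∧ ht r < γ ∧
      (∀ x ∈ T, x < A (Order.succ z.1) → x < γ) ∧ τ < lam.ord ∧ T ∩ Iio γ = t '' Iio τ := by
  have hsl : Order.succ z.1 < lam.ord := (isSuccLimit_ord hlam).succ_lt z.2
  have hcof := (hS₀ (hA₀ _ hsl.le (Order.not_isSuccLimit_succ _))).2
  have hlim := isSuccLimit_of_cof_eq hlam hcof
  have hAl := hA.lt _ _ hsl le_rfl
  obtain ⟨β, hβ, hb⟩ := (hTs _ hAl).boundedIn hcof (zero_le.trans_lt hlam).ne'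
  have hrlt : ht r < A (Order.succ z.1) :=
    H.ht_lt_of_mem (hN.height _ hsl.le) (hN.trace_eq z hz) hr (hN.mono 0 _ zero_le hsl.le hrN)
  -- The height `m + 1` exceeds `A z`, `ht r` and every point of `T` below `A (z + 1)`; it remains
  -- below `A (z + 1)`, which is a limit ordinal.
  set m := max β (max (ht r) (A z.1)) with hm
  have hmlt : m < A (Order.succ z.1) :=
    max_lt hβ (max_lt hrlt (hA.lt _ _ (Order.lt_succ _) hsl.le))
  have hlt : ∀ x ≤ m, x < Order.succ m := fun x hx => Order.lt_succ_of_le hx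
  obtain ⟨τ, hτ, t, hτt⟩ := hTs (Order.succ m) ((hlim.succ_lt hmlt).trans hAl)
  refine ⟨Order.succ m, τ, t, hlim.succ_lt hmlt, hlt _ ?_, hlt _ ?_,
    fun x hx hxA => hlt _ ((hb x ⟨hx, hxA⟩ hxA).trans (le_max_left _ _)), hτ, hτt⟩
  · exact (le_max_right _ _).trans (le_max_right _ _)
  · exact (le_max_left _ _).trans (le_max_right _ _)

variable {lam κ : Cardinal.{u}} {S₀ S : Set Ordinal.{u}} {C : Ordinal.{u} → Set Ordinal.{u}}
  {h : Ordinal.{u} → Ordinal.{u} → Ordinal.{u}} {Q : ForcingNotion.{u}}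
  {ht : ZFSet.{u} → Ordinal.{u}}
  {Bad : ZFSet.{u} → Set Ordinal.{u} → (Ordinal.{u} → Ordinal.{u}) → Set Ordinal.{u}}

/-- The code of a move of COM. -/
def moveCode (lam : Cardinal.{u}) (r : ZFSet.{u}) (γ τ : Ordinal.{u})
    (t g : Ordinal.{u} → Ordinal.{u}) (i : Ordinal.{u})
    (q : Ordinal.{u} → Ordinal.{u} → ZFSet.{u}) : ZFSet.{u} :=
  ZFSet.pair r (ZFSet.pair γ.toZFSet
    (ZFSet.pair (seqCode τ fun ξ => ZFSet.pair (t ξ).toZFSet (g (t ξ)).toZFSet)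
      (seqCode i fun j => seqCode lam.ord (q j))))

/-- Each component is an element of the model or a sequence of length less than `λ` of such
elements, so `<λ`-closure and pairing put the code in the model. The second part places it in the
domain on which the model is closed under `F`. -/
theorem moveCode_mem (hlam : Cardinal.aleph0 < lam) {F : ZFSet.{u} → ZFSet.{u}}
    {N : Ordinal.{u} → ZFSet.{u}} {A : Ordinal.{u} → Ordinal.{u}} {X : Set (Iio lam.ord)}
    (hN : GameModels lam κ Q ht F N A X) {z : Iio lam.ord} (hz : z ∈ X) {r : ZFSet.{u}}
    (hr : r ∈ Q.carrier) (hrN : r ∈ N 0) {γ τ : Ordinal.{u}} {t g : Ordinal.{u} → Ordinal.{u}}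
    (hγ : γ < A (Order.succ z.1)) (hτ : τ < lam.ord) (ht' : ∀ ξ < τ, t ξ < γ)
    (hg : ∀ ξ < τ, g (t ξ) < lam.ord) {i : Ordinal.{u}} (hi : i < lam.ord)
    {q : Ordinal.{u} → Ordinal.{u} → ZFSet.{u}} (hq : ∀ j < i, ∀ ξ < lam.ord, q j ξ ∈ Q.carrier)
    (hqN : ∀ j < i, seqCode lam.ord (q j) ∈ N (Order.succ z.1)) :
    moveCode lam r γ τ t g i q ∈ N (Order.succ z.1) ∧
      moveCode lam r γ τ t g i q ∈ moveDomain lam κ Q := by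
  have hsl : Order.succ z.1 ≤ lam.ord := ((isSuccLimit_ord hlam).succ_lt z.2).le
  have htr : ∀ x < A (Order.succ z.1), x.toZFSet ∈ N (Order.succ z.1) ∧ x < κ.ord := fun x hx => by
    have h1 : x ∈ trace (N (Order.succ z.1)) κ := by
      rw [hN.trace_eq z hz]
      exact hx
    exact h1
  have h0 := hN.mono 0 _ zero_le hsl
  have hpair := hN.pair_mem _ hsl
  constructor
  · refine hpair _ (h0 hrN) _ (hpair _ (htr γ hγ).1 _ (hpair _ ?_ _ ?_))
    · exact hN.closed z hz τ hτ _ fun ξ hξ => hpair _ (htr _ ((ht' ξ hξ).trans hγ)).1 _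
        (h0 (hN.ords _ (hg ξ hξ)))
    · exact hN.closed z hz i hi _ hqN
  · simp only [moveCode, moveDomain, ZFSet.pair_mem_prod]
    refine ⟨hr, Ordinal.toZFSet_mem_toZFSet_iff.2 (htr γ hγ).2, ?_, ?_⟩
    · refine seqCode_mem_powerset hτ.le fun ξ hξ => ZFSet.pair_mem_prod.2
        ⟨Ordinal.toZFSet_mem_toZFSet_iff.2 ((ht' ξ hξ).trans (htr γ hγ).2),
          Ordinal.toZFSet_mem_toZFSet_iff.2 (hg ξ hξ)⟩
    · exact seqCode_mem_powerset hi.le fun j hj => seqCode_mem_powerset le_rfl (hq j hj)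

theorem not_incHasWinningStrategy (H : IsLadderForcing lam κ S C h Q ht Bad)
    (hreg : lam.IsRegular) (hlam : Cardinal.aleph0 < lam) (hκ : κ = Order.succ lam)
    (hS₀ : S₀ ⊆ cofSet κ lam) (hS : S ⊆ cofSet κ lam) (hdisj : ∀ δ ∈ S₀, δ ∉ S)
    (hC : IsLadderSystem lam S₀ S C) (hh : ∀ δ ∈ S, ∀ β ∈ C δ, h δ β < lam.ord)
    {D : Filter (Iio lam.ord)} (hD : D = clubFilter lam ∨ IsNormalFilter lam D)
    {F : ZFSet.{u} → ZFSet.{u}} (hF : ∀ a B γ T g, MoveCode lam a B γ T g →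
      MoveHyp lam κ S Q ht B γ T g → MoveSpec Q ht Bad B γ T g (F a))
    {A : Ordinal.{u} → Ordinal.{u}} (hA : IsContSeq lam.ord A) (hAκ : ∀ i ≤ lam.ord, A i < κ.ord)
    (hA₀ : ∀ i ≤ lam.ord, ¬ Order.IsSuccLimit i → A i ∈ S₀) {N : Ordinal.{u} → ZFSet.{u}}
    {X : Set (Iio lam.ord)} (hX : X ∈ D) (hN : GameModels lam κ Q ht F N A X)
    {r : ZFSet.{u}} (hr : r ∈ Q.carrier) (hrN : r ∈ N 0) :
    ¬ IncHasWinningStrategy lam Q N D X r := by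
  rintro ⟨σ, hσ⟩
  obtain ⟨T, g, E, hED, hTδ, hTs, hTg, hT₀, hE⟩ :=
    exists_target (h := h) hreg hlam hS₀ hS hC hh hD hA hA₀
  have hsl : ∀ z : Iio lam.ord, Order.succ z.1 < lam.ord := fun z =>
    (isSuccLimit_ord hlam).succ_lt z.2
  have h0 : (0 : Ordinal.{u}) < lam.ord := (isSuccLimit_ord hlam).bot_lt
  have hXE : X ∩ E ∈ D := Filter.inter_mem hX hED
  have hunb := exists_gt_of_mem_filter hreg hlam hD hXE
  -- The indices are fixed in advance, independently of INC's answers.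
  obtain ⟨ζ, hζmem, hζlt, hζsurj⟩ := exists_enumeration hreg hunb
  have hheights : ∀ z ∈ X, ∃ γ τ, ∃ t : Ordinal.{u} → Ordinal.{u},
      γ < A (Order.succ z.1) ∧ A z.1 < γ ∧ ht r < γ ∧
      (∀ x ∈ T, x < A (Order.succ z.1) → x < γ) ∧ τ < lam.ord ∧ T ∩ Iio γ = t '' Iio τ :=
    fun z hz => H.exists_heights hlam hS₀ hA hA₀ hTs hN hr hrN hz
  choose! γ τ t hγA hAγ hrγ hTγ hτ hτt using hheights
  obtain ⟨p, hp⟩ := exists_recursion (fun i f => F (moveCode lam r (γ (ζ i)) (τ (ζ i)) (t (ζ i)) g i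
    fun j => σ j fun k => (ζ k.1, f k.1))) (by
      intro i f f' hff'
      refine congrArg F ?_
      simp only [moveCode]
      rw [seqCode_congr (α := i) fun j hj => ?_]
      have h1 : (fun k : Iic j => (ζ k.1, f k.1)) = fun k : Iic j => (ζ k.1, f' k.1) :=
        funext fun k => by rw [hff' k.1 ((mem_Iic.1 k.2).trans_lt hj)]
      rw [h1])
  set q := σ.answer ζ p with hq
  have hp' : ∀ i, p i = F (moveCode lam r (γ (ζ i)) (τ (ζ i)) (t (ζ i)) g i q) := hp
  -- The invariant is that no violation of `T` ever occurs above the height of `r`.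
  have key : ∀ i, i < lam.ord → ComLegal lam Q N X r ζ p q i ∧ ht (p i) = γ (ζ i) ∧
      ∀ β ∈ Bad (p i) T g, β ≤ ht r := by
    intro i
    induction i using WellFoundedLT.induction with
    | ind i ih =>
    intro hi
    have hcom : ∀ j < i, ComLegal lam Q N X r ζ p q j := fun j hj => (ih j hj (hj.trans hi)).1
    have hinc : ∀ j < i, IncLegal lam Q N ζ p q j := fun j hj =>
      (hσ ζ p).1 j (hj.trans hi) fun k hk => hcom k (hk.trans_lt hj)
    have hqQ : ∀ j < i, ∀ ξ < lam.ord, q j ξ ∈ Q.carrier := fun j hj => (hinc j hj).1.1.1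
    have hpq : ∀ j < i, ∀ ξ < lam.ord, Q.le (p j) (q j ξ) := fun j hj ξ hξ =>
      Q.le_trans _ (hcom j hj).2.2.2.1 _ (hqQ j hj 0 h0) _ (hqQ j hj ξ hξ) (hinc j hj).2.1
        ((hinc j hj).1.1.2 0 ξ zero_le hξ)
    have hrq : ∀ j < i, ∀ ξ < lam.ord, Q.le r (q j ξ) := fun j hj ξ hξ =>
      Q.le_trans _ hr _ (hcom j hj).2.2.2.1 _ (hqQ j hj ξ hξ) (hcom j hj).2.2.2.2.1 (hpq j hj ξ hξ)
    have hX' : ∀ j ≤ i, ζ j ∈ X := fun j hj => (hζmem j (hj.trans_lt hi)).1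
    have hqlt : ∀ j < i, ∀ ξ < lam.ord, ht (q j ξ) < A (Order.succ (ζ j).1) := fun j hj ξ hξ =>
      H.ht_lt_of_mem (hN.height _ (hsl _).le) (hN.trace_eq _ (hX' j hj.le)) (hqQ j hj ξ hξ)
        ((hinc j hj).1.2.1 ξ hξ)
    have hqq : ∀ j < i, ∀ k < j, ∀ ξ < lam.ord, ∀ η < lam.ord, Q.le (q k ξ) (q j η) :=
      fun j hj k hk ξ hξ η hη => Q.le_trans _ (hqQ k (hk.trans hj) ξ hξ) _ (hcom j hj).2.2.2.1 _
        (hqQ j hj η hη) ((hcom j hj).2.2.2.2.2 k hk ξ hξ) (hpq j hj η hη)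
    obtain ⟨α, hα, hlub, hαS, hαT⟩ := exists_isLUB_prevConds (ht := ht) (r := r) (q := q) hlam hA hA₀
      hdisj hS hT₀ hE hi (fun j hj => (hζmem j (hj.trans hi)).2)
      (fun j hj k hk => hζlt j (hj.trans_lt hi) k hk)
      (fun j hj ξ hξ => H.ht_mono _ hr _ (hqQ j hj ξ hξ) (hrq j hj ξ hξ)) hqlt
      (fun j hj β hβ => H.exists_lt_ht_of_generic hlam hκ (hN.height _ (hsl _).le)
        (hN.trace_eq _ (hX' j hj.le)) (hinc j hj).1 hβ)
    have hXi := hX' i le_rfl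
    have hγl : γ (ζ i) < A lam.ord := (hγA _ hXi).trans (hA.lt _ _ (hsl _) le_rfl)
    have hyp : MoveHyp lam κ S Q ht (prevConds lam r q i) (γ (ζ i)) T g := by
      refine ⟨?_, ?_, ⟨α, hα.trans_lt (max_lt (hrγ _ hXi) (hAγ _ hXi)), hlub, hαS⟩,
        hγl.trans (hAκ _ le_rfl), fun hγT => (hTγ _ hXi _ hγT (hγA _ hXi)).false, hTs _ hγl,
        fun β hβ _ => hTg β hβ⟩
      · rintro x (rfl | ⟨j, hj, ξ, hξ, rfl⟩)
        exacts [hr, hqQ j hj ξ hξ]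
      · rintro x (rfl | ⟨j, hj, ξ, hξ, rfl⟩) y (rfl | ⟨k, hk, η, hη, rfl⟩)
        · exact Or.inl (Q.le_refl _ hr)
        · exact Or.inl (hrq k hk η hη)
        · exact Or.inr (hrq j hj ξ hξ)
        · rcases lt_trichotomy j k with hjk | rfl | hjk
          · exact Or.inl (hqq k hk j hjk ξ hξ η hη)
          · rcases le_total ξ η with hξη | hξη
            exacts [Or.inl ((hinc j hj).1.1.2 ξ η hξη hη), Or.inr ((hinc j hj).1.1.2 η ξ hξη hξ)]
          · exact Or.inr (hqq j hj k hjk η hη ξ hξ)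
    have htγ : ∀ ξ < τ (ζ i), t (ζ i) ξ ∈ T ∩ Iio (γ (ζ i)) := fun ξ hξ => by
      rw [hτt _ hXi]
      exact ⟨ξ, hξ, rfl⟩
    obtain ⟨hcN, hcD⟩ := moveCode_mem (g := g) hlam hN hXi hr hrN (hγA _ hXi) (hτ _ hXi)
      (fun ξ hξ => (htγ ξ hξ).2) (fun ξ hξ => hTg _ (htγ ξ hξ).1) hi hqQ fun j hj =>
        -- INC's `j`-th answer is in the model of index `ζ j + 2`, and `ζ j + 2 ≤ ζ i + 1`.
        hN.mono _ _ (Order.succ_le_succ (Order.succ_le_of_lt (hζlt i hi j hj))) (hsl _).le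
          (hinc j hj).2.2
    have hspec := hF _ _ _ _ _ ⟨r, i, q, τ (ζ i), t (ζ i), rfl, rfl, hτt _ hXi⟩ hyp
    have hpN := hN.move_mem _ (hsl (ζ i)).le _ hcD hcN
    change MoveSpec Q ht Bad (prevConds lam r q i) (γ (ζ i)) T g
      (F (moveCode lam r (γ (ζ i)) (τ (ζ i)) (t (ζ i)) g i q)) at hspec
    rw [← hp' i] at hspec hpN
    refine ⟨⟨hXi, hζlt i hi, hpN, hspec.mem, hspec.le r (Or.inl rfl), fun j hj ξ hξ =>
      hspec.le _ (Or.inr ⟨j, hj, ξ, hξ, rfl⟩)⟩, hspec.ht_eq, fun β hβ => ?_⟩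
    rcases hspec.bad β hβ with ⟨x, rfl | ⟨j, hj, ξ, hξ, rfl⟩, hβx⟩ | ⟨h1, h2⟩
    · exact (H.bad_mem _ hr T g β hβx).2
    · obtain ⟨hβT, hβle⟩ := H.bad_mem _ (hqQ j hj ξ hξ) T g β hβx
      -- A violation in INC's sequence is already one of `p j`, or lies at or above `γ (ζ j)`. The
      -- latter is impossible: it would be a point of `T` below `A (ζ j + 1)`, and all of these are
      -- below `γ (ζ j)`.
      rcases H.bad_of_le _ (hcom j hj).2.2.2.1 _ (hqQ j hj ξ hξ) (hpq j hj ξ hξ) T g β hβx with h1 | h1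
      · exact (ih j hj (hj.trans hi)).2.2 β h1
      · rw [(ih j hj (hj.trans hi)).2.1] at h1
        exact absurd h1 (hTγ _ (hX' j hj.le) β hβT (hβle.trans_lt (hqlt j hj ξ hξ))).not_ge
    · obtain rfl := h1.unique hlub
      exact hαT h2
  have hcom : ∀ i < lam.ord, ComLegal lam Q N X r ζ p q i := fun i hi => (key i hi).1
  have hinc : ∀ i < lam.ord, IncLegal lam Q N ζ p q i := fun i hi =>
    (hσ ζ p).1 i hi fun k hk => hcom k (hk.trans_lt hi)
  refine (hσ ζ p).2 hcom ⟨?_, ?_⟩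
  · exact Filter.mem_of_superset hXE hζsurj
  have hX' : ∀ j < lam.ord, ζ j ∈ X := fun j hj => (hζmem j hj).1
  have hpQ : ∀ j < lam.ord, p j ∈ Q.carrier := fun j hj => (hcom j hj).2.2.2.1
  have hple : ∀ i j, i ≤ j → j < lam.ord → Q.le (p i) (p j) := by
    intro i j hij hj
    rcases hij.eq_or_lt with rfl | hij
    · exact Q.le_refl _ (hpQ i hj)
    · have hi := hij.trans hj
      exact Q.le_trans _ (hpQ i hi) _ ((hinc i hi).1.1.1 0 h0) _ (hpQ j hj) (hinc i hi).2.1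
        ((hcom j hj).2.2.2.2.2 i hij 0 h0)
  have hlt : ∀ j < lam.ord, ht (p j) < A lam.ord := fun j hj => by
    rw [(key j hj).2.1]
    exact (hγA _ (hX' j hj)).trans (hA.lt _ _ (hsl _) le_rfl)
  have hlub : IsLUB (ht '' (p '' Iio lam.ord)) (A lam.ord) := by
    refine ⟨?_, fun b hb => ?_⟩
    · rintro _ ⟨_, ⟨j, hj, rfl⟩, rfl⟩
      exact (hlt j hj).le
    · by_contra! hbA
      obtain ⟨k, hk, hbk⟩ := hA.cont _ le_rfl (isSuccLimit_ord hlam) b hbA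
      obtain ⟨z, hz, hkz⟩ := hunb ⟨k, hk⟩
      obtain ⟨j, hj, rfl⟩ := hζsurj z hz
      have h1 : ht (p j) ≤ b := hb ⟨_, ⟨j, hj, rfl⟩, rfl⟩
      rw [(key j hj).2.1] at h1
      exact ((hbk.trans (hA.lt k _ hkz (ζ j).2.le)).trans ((hAγ _ (hX' j hj)).trans_le h1)).false
  obtain ⟨b, hb, hub, -⟩ := H.upper (p '' Iio lam.ord) ⟨p 0, 0, h0, rfl⟩ (by
      rintro _ ⟨j, hj, rfl⟩
      exact hpQ j hj) (increasing_chain ⟨hpQ, hple⟩) _ (hAκ _ le_rfl) hlub (by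
      intro hδ
      obtain ⟨rfl, rfl⟩ := hTδ hδ
      -- Here `T` is the ladder at the limit, and the invariant bounds the violations of all `p j`
      -- by one ordinal below it.
      refine Or.inr ⟨ht r, ?_, ?_⟩
      · exact ((hrγ _ (hX' 0 h0)).trans (hγA _ (hX' 0 h0))).trans (hA.lt _ _ (hsl _) le_rfl)
      · rintro _ ⟨j, hj, rfl⟩
        exact (key j hj).2.2)
  exact ⟨b, hb, fun i hi => hub _ ⟨i, hi, rfl⟩⟩

theorem isReallyComplete (H : IsLadderForcing lam κ S C h Q ht Bad)
    (hreg : lam.IsRegular) (hlam : Cardinal.aleph0 < lam) (hκ : κ = Order.succ lam)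
    (hS₀ : S₀ ⊆ cofSet κ lam) (hS : S ⊆ cofSet κ lam) (hdisj : ∀ δ ∈ S₀, δ ∉ S)
    (hC : IsLadderSystem lam S₀ S C) (hh : ∀ δ ∈ S, ∀ β ∈ C δ, h δ β < lam.ord)
    (D : OrdSetSeq lam → Filter (Iio lam.ord))
    (hD : ∀ a ∈ seqFamily lam κ S₀, D a = clubFilter lam ∨ IsNormalFilter lam (D a)) :
    IsReallyComplete lam κ κ (asFamily S₀) (seqFamily lam κ S₀) D Q := by
  refine ⟨H.isLTComplete hlam hκ hS, H.stronglyComplete hlam hκ hS₀ hdisj, ?_⟩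
  obtain ⟨F, hF⟩ := H.exists_move
  obtain ⟨χ₀, x, hx⟩ := exists_closure_witness (moveDomain lam κ Q) Q.carrier κ.ord.toZFSet F
    (fun p => (ht p).toZFSet) (aboveSet Q ht)
  refine ⟨χ₀, fun χ hχ _ W _ => ⟨x, (hx χ hχ).1, fun N hN hxN a X haX r hrN hr => ?_⟩⟩
  obtain ⟨haS, hXD, hbase⟩ := haX
  obtain ⟨A, hA, hAκ, hA₀, haA⟩ := exists_contSeq_of_mem_seqFamily haS
  have hcl := fun i (hi : i ≤ lam.ord) => (hx χ hχ).2 W (N i) (hN.elem i hi)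
    (hN.increasing 0 i zero_le hi hxN)
  refine H.not_incHasWinningStrategy hreg hlam hκ hS₀ hS hdisj hC hh (hD a haS) hF hA hAκ hA₀ hXD
    ⟨hN.increasing, hN.ords_mem, fun i hi => (hcl i hi).1, fun i hi => (hcl i hi).2.1,
      fun i hi => ⟨(hcl i hi).2.2.1, (hcl i hi).2.2.2⟩, fun z hz => (hbase z hz).1, fun z hz => ?_⟩
    hr hrN
  rw [(hbase z hz).2, haA]
  rfl

end IsLadderForcing

/-! ### The club-adding forcing -/

theorem mem_subsetCode {δ : Ordinal.{u}} {E : Set Ordinal.{u}} {y : ZFSet.{u}} :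
    y ∈ subsetCode δ E ↔ ∃ α ∈ E, α < δ ∧ y = α.toZFSet := by
  rw [subsetCode, ZFSet.mem_sep, Ordinal.mem_toZFSet_iff]
  constructor
  · rintro ⟨⟨β, hβ, rfl⟩, α, hα, h⟩
    obtain rfl := Ordinal.toZFSet_injective h
    exact ⟨β, hα, hβ, rfl⟩
  · rintro ⟨α, hα, hδ, rfl⟩
    exact ⟨⟨α, hδ, rfl⟩, α, hα, rfl⟩

theorem ordSet_subsetCode {δ : Ordinal.{u}} {E : Set Ordinal.{u}} (hE : E ⊆ Iio δ) :
    ordSet (subsetCode δ E) = E := by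
  ext α
  change α.toZFSet ∈ subsetCode δ E ↔ α ∈ E
  rw [mem_subsetCode]
  constructor
  · rintro ⟨β, hβ, -, h⟩
    rwa [Ordinal.toZFSet_injective h]
  · exact fun h => ⟨α, h, hE h, rfl⟩

section clubForcing

variable {lam κ : Cardinal.{u}} {S₀ S : Set Ordinal.{u}} {C : Ordinal.{u} → Set Ordinal.{u}}

theorem mem_clubForcing {p : ZFSet.{u}} : p ∈ (clubForcing κ S C).carrier ↔
    p ⊆ κ.ord.toZFSet ∧ IsClubCondition κ S C (ordSet p) := by
  rw [clubForcing, ZFSet.mem_sep, ZFSet.mem_powerset]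

theorem subsetCode_mem_clubForcing {E : Set Ordinal.{u}} (hE : IsClubCondition κ S C E) :
    subsetCode κ.ord E ∈ (clubForcing κ S C).carrier := by
  rw [mem_clubForcing, ordSet_subsetCode hE.1]
  exact ⟨ZFSet.sep_subset, hE⟩

theorem exists_of_mem_clubForcing {p y : ZFSet.{u}} (hp : p ∈ (clubForcing κ S C).carrier)
    (hy : y ∈ p) : ∃ α ∈ ordSet p, y = α.toZFSet := by
  obtain ⟨α, -, rfl⟩ := Ordinal.mem_toZFSet_iff.1 ((mem_clubForcing.1 hp).1 hy)
  exact ⟨α, hy, rfl⟩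

theorem clubForcing_le {p q : ZFSet.{u}} (hp : p ∈ (clubForcing κ S C).carrier)
    (hq : q ∈ (clubForcing κ S C).carrier) : (clubForcing κ S C).le p q ↔
      ordSet p ⊆ ordSet q ∧ ∀ y ∈ ordSet q, y ∉ ordSet p → ∀ x ∈ ordSet p, x < y := by
  constructor
  · rintro ⟨h1, h2⟩
    exact ⟨fun α (hα : α.toZFSet ∈ p) => show α.toZFSet ∈ q from h1 hα, fun y hy hyp x hx =>
      Ordinal.toZFSet_mem_toZFSet_iff.1 (h2 _ hy hyp _ hx)⟩
  · rintro ⟨h1, h2⟩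
    refine ⟨fun y hy => ?_, fun y hy hyp x hx => ?_⟩
    · obtain ⟨α, hα, rfl⟩ := exists_of_mem_clubForcing hp hy
      exact h1 hα
    · obtain ⟨α, hα, rfl⟩ := exists_of_mem_clubForcing hq hy
      obtain ⟨β, hβ, rfl⟩ := exists_of_mem_clubForcing hp hx
      exact Ordinal.toZFSet_mem_toZFSet_iff.2 (h2 α hα hyp β hβ)

/-- The height of a condition of the club-adding forcing. -/
def clubHt (p : ZFSet.{u}) : Ordinal.{u} := sSup (ordSet p)

theorem le_clubHt {p : ZFSet.{u}} (hp : p ∈ (clubForcing κ S C).carrier) {x : Ordinal.{u}}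
    (hx : x ∈ ordSet p) : x ≤ clubHt p :=
  le_csSup ⟨κ.ord, fun _ hy => le_of_lt ((mem_clubForcing.1 hp).2.1 hy)⟩ hx

/-- For `δ` between the old supremum and `γ`, the elements below `δ` are all old, hence bounded by
the old supremum. -/
theorem isClubCondition_insert {E : Set Ordinal.{u}} (hE : IsClubCondition κ S C E)
    {γ : Ordinal.{u}} (hγ : γ < κ.ord) (hEγ : sSup E < γ) :
    sSup (insert γ E) = γ ∧ IsClubCondition κ S C (insert γ E) := by
  have hle : ∀ x ∈ E, x ≤ sSup E := fun x hx => le_csSup ⟨κ.ord, fun _ hy => le_of_lt (hE.1 hy)⟩ hx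
  have hsup : sSup (insert γ E) = γ := by
    refine IsGreatest.csSup_eq ⟨mem_insert _ _, ?_⟩
    rintro x (rfl | hx)
    exacts [le_rfl, (hle x hx).trans hEγ.le]
  refine ⟨hsup, insert_subset hγ hE.1, ?_, hsup.trans_lt hγ, fun δ hδ hδγ => ?_⟩
  · rw [insert_eq]
    exact isClosed_singleton.union hE.2.1
  rw [hsup] at hδγ
  rcases le_or_gt δ (sSup E) with h | h
  · obtain ⟨β, hβ, hb⟩ := hE.2.2.2 δ hδ h
    refine ⟨β, hβ, ?_⟩
    rintro x ⟨rfl | hx, hxn⟩ hxδ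
    · exact absurd hxδ (h.trans hEγ.le).not_gt
    · exact hb x ⟨hx, hxn⟩ hxδ
  · refine ⟨sSup E, h, ?_⟩
    rintro x ⟨rfl | hx, hxn⟩ hxδ
    · exact absurd hxδ hδγ.not_gt
    · exact hle x hx

theorem exists_clubForcing_extension {p : ZFSet.{u}} (hp : p ∈ (clubForcing κ S C).carrier)
    {γ : Ordinal.{u}} (hγ : γ < κ.ord) (hpγ : clubHt p < γ) :
    ∃ q ∈ (clubForcing κ S C).carrier, (clubForcing κ S C).le p q ∧ clubHt q = γ ∧
      ordSet q = insert γ (ordSet p) := by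
  obtain ⟨hsup, hcond⟩ := isClubCondition_insert (mem_clubForcing.1 hp).2 hγ hpγ
  have hset := ordSet_subsetCode hcond.1
  have hq := subsetCode_mem_clubForcing hcond
  refine ⟨_, hq, ?_, ?_, hset⟩
  · rw [clubForcing_le hp hq, hset]
    refine ⟨subset_insert _ _, ?_⟩
    rintro y (rfl | hy) hyp x hx
    · exact (le_clubHt hp hx).trans_lt hpγ
    · exact absurd hy hyp
  · rw [clubHt, hset, hsup]

/-- The bound is the closure of the union. By end-extension it agrees with each `p ∈ A` below the
height of `p`, so the closure adds at most the point `α`. -/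
theorem clubForcing_upper (A : Set ZFSet.{u}) (hA : ∀ p ∈ A, p ∈ (clubForcing κ S C).carrier)
    (hchain : ∀ p ∈ A, ∀ q ∈ A, (clubForcing κ S C).le p q ∨ (clubForcing κ S C).le q p)
    (α : Ordinal.{u}) (hα : α < κ.ord) (hlub : IsLUB (clubHt '' A) α)
    (hS : α ∈ S → (∃ p ∈ A, clubHt p = α) ∨
      ∃ β < α, ∀ p ∈ A, ordSet p ∩ nacc (C α) ⊆ Iic β) :
    ∃ b ∈ (clubForcing κ S C).carrier, (∀ p ∈ A, (clubForcing κ S C).le p b) ∧ clubHt b = α ∧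
      ∀ β ∈ ordSet b, (∃ p ∈ A, β ∈ ordSet p) ∨ β = α := by
  set U : Set Ordinal.{u} := ⋃ p ∈ A, ordSet p with hU
  have hUα : closure U ⊆ Iic α := by
    refine closure_minimal (fun x hx => ?_) isClosed_Iic
    obtain ⟨p, hp, hx⟩ := mem_iUnion₂.1 hx
    exact (le_clubHt (hA p hp) hx).trans (hlub.1 ⟨p, hp, rfl⟩)
  have hUp : ∀ p ∈ A, ∀ x ∈ closure U, x < clubHt p → x ∈ ordSet p := by
    intro p hp x hx hxp
    have h1 : Iio (clubHt p) ∩ U ⊆ ordSet p := by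
      rintro y ⟨hyp, hy⟩
      obtain ⟨p', hp', hy⟩ := mem_iUnion₂.1 hy
      rcases hchain p hp p' hp' with hle | hle
      · by_contra hy'
        have h2 := ((clubForcing_le (hA p hp) (hA p' hp')).1 hle).2 y hy hy'
        exact (csSup_le' fun x hx => (h2 x hx).le).not_gt hyp
      · exact ((clubForcing_le (hA p' hp') (hA p hp)).1 hle).1 hy
    exact closure_minimal h1 (mem_clubForcing.1 (hA p hp)).2.2.1
      (isOpen_Iio.inter_closure ⟨hxp, hx⟩)
  have hbdd : BddAbove (closure U) := ⟨α, hUα⟩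
  have hsub : ∀ p ∈ A, ordSet p ⊆ closure U := fun p hp =>
    (subset_biUnion_of_mem (u := ordSet) hp).trans subset_closure
  have hsup : sSup (closure U) = α := by
    refine le_antisymm (csSup_le' hUα) (hlub.2 ?_)
    rintro _ ⟨p, hp, rfl⟩
    exact csSup_le_csSup' hbdd (hsub p hp)
  have hex : ∀ β ∈ closure U, (∃ p ∈ A, β ∈ ordSet p) ∨ β = α := by
    intro β hβ
    rcases (mem_Iic.1 (hUα hβ)).eq_or_lt with h | h
    · exact Or.inr h
    · obtain ⟨_, ⟨p, hp, rfl⟩, hβp⟩ := (lt_isLUB_iff hlub).1 h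
      exact Or.inl ⟨p, hp, hUp p hp β hβ hβp⟩
  have hcond : IsClubCondition κ S C (closure U) := by
    refine ⟨fun x hx => (hUα hx).trans_lt hα, isClosed_closure, hsup ▸ hα, fun δ hδ hδα => ?_⟩
    rw [hsup] at hδα
    -- The requirement at `δ` is inherited from a condition reaching `δ`, except when `δ = α` is not
    -- attained; that case is the hypothesis `hS`.
    have hcase : (∃ p ∈ A, δ ≤ clubHt p) ∨
        (δ = α ∧ ∃ β < α, ∀ p ∈ A, ordSet p ∩ nacc (C α) ⊆ Iic β) := by
      rcases hδα.eq_or_lt with rfl | h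
      · rcases hS hδ with ⟨p, hp, h⟩ | h
        exacts [Or.inl ⟨p, hp, h.ge⟩, Or.inr ⟨rfl, h⟩]
      · obtain ⟨_, ⟨p, hp, rfl⟩, hδp⟩ := (lt_isLUB_iff hlub).1 h
        exact Or.inl ⟨p, hp, hδp.le⟩
    rcases hcase with ⟨p, hp, hδp⟩ | ⟨rfl, β, hβ, hb⟩
    · obtain ⟨β, hβ, hb⟩ := (mem_clubForcing.1 (hA p hp)).2.2.2.2 δ hδ hδp
      exact ⟨β, hβ, fun x hx hxδ => hb x ⟨hUp p hp x hx.1 (hxδ.trans_le hδp), hx.2⟩ hxδ⟩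
    · refine ⟨β, hβ, fun x hx hxδ => ?_⟩
      rcases hex x hx.1 with ⟨p, hp, hxp⟩ | rfl
      exacts [hb p hp ⟨hxp, hx.2⟩, absurd hxδ (lt_irrefl _)]
  have hset := ordSet_subsetCode hcond.1
  have hb := subsetCode_mem_clubForcing hcond
  refine ⟨_, hb, fun p hp => ?_, by rw [clubHt, hset, hsup], by rwa [hset]⟩
  rw [clubForcing_le (hA p hp) hb, hset]
  refine ⟨hsub p hp, fun y hy hyp x hx => ?_⟩
  by_contra! hyx
  rcases hyx.eq_or_lt with rfl | hlt
  · exact hyp hx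
  · exact hyp (hUp p hp y hy (hlt.trans_le (le_clubHt (hA p hp) hx)))

theorem empty_mem_clubForcing (hκ : κ ≠ 0) (hS : ∀ δ ∈ S, δ ≠ 0) :
    subsetCode κ.ord ∅ ∈ (clubForcing κ S C).carrier := by
  have h0 : sSup (∅ : Set Ordinal.{u}) = 0 := csSup_empty
  refine subsetCode_mem_clubForcing ⟨empty_subset _, isClosed_empty, ?_, fun δ hδ hδ0 => ?_⟩
  · rw [h0, Cardinal.lt_ord, Ordinal.card_zero]
    exact pos_iff_ne_zero.2 hκ
  · rw [h0] at hδ0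
    exact absurd (le_antisymm hδ0 zero_le) (hS δ hδ)

/-- A violation is an element of the condition in `nacc T`. Extending to height `γ` adds only the
point `γ`, which is not in `T`. -/
theorem isLadderForcing_clubForcing (h : Ordinal.{u} → Ordinal.{u} → Ordinal.{u}) (hκ : κ ≠ 0)
    (hS : ∀ δ ∈ S, δ ≠ 0) : IsLadderForcing lam κ S C h (clubForcing κ S C) clubHt
      fun p T _ => ordSet p ∩ nacc T where
  nonempty := ⟨_, empty_mem_clubForcing hκ hS⟩
  ht_lt p hp := (mem_clubForcing.1 hp).2.2.2.1
  ht_mono p hp q hq hpq := csSup_le_csSup'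
    ⟨κ.ord, fun _ hy => le_of_lt ((mem_clubForcing.1 hq).2.1 hy)⟩ ((clubForcing_le hp hq).1 hpq).1
  bad_mem p hp T _ β hβ := ⟨hβ.2.1, le_clubHt hp hβ.1⟩
  bad_of_le p hp q hq hpq T _ β hβ := by
    by_cases hβp : β ∈ ordSet p
    · exact Or.inl ⟨hβp, hβ.2⟩
    · exact Or.inr (csSup_le' fun x hx =>
        (((clubForcing_le hp hq).1 hpq).2 β hβ.1 hβp x hx).le)
  bad_local p hp γ hγ T T' _ _ hγT hT _ β hβ := by
    refine ⟨hβ.1, mem_nacc_of_inter_eq hT (lt_of_le_of_ne ((le_clubHt hp hβ.1).trans hγ) ?_) hβ.2⟩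
    rintro rfl
    exact hγT hβ.2.1
  upper A _ hA hchain α hα hlub hαS := by
    obtain ⟨b, hb, hub, hht, hex⟩ := clubForcing_upper A hA hchain α hα hlub hαS
    refine ⟨b, hb, hub, hht, fun T _ β hβ => ?_⟩
    rcases hex β hβ.1 with ⟨p, hp, hβp⟩ | rfl
    exacts [Or.inl ⟨p, hp, hβp, hβ.2⟩, Or.inr ⟨rfl, hβ.2⟩]
  extend p hp γ hγ hpγ T _ hγT _ _ := by
    obtain ⟨q, hq, hpq, hht, hset⟩ := exists_clubForcing_extension hp hγ hpγ
    refine ⟨q, hq, hpq, hht, ?_⟩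
    rintro β ⟨hβ, hβT⟩
    rw [hset] at hβ
    rcases hβ with rfl | hβ
    exacts [absurd hβT.1 hγT, ⟨hβ, hβT⟩]

end clubForcing

/-! ### The uniformization forcing -/

section unifForcing

variable {lam κ : Cardinal.{u}} {S₀ S : Set Ordinal.{u}} {C : Ordinal.{u} → Set Ordinal.{u}}
  {h : Ordinal.{u} → Ordinal.{u} → Ordinal.{u}}

open Classical in
/-- The domain of a function from an ordinal to the ordinals. -/
def unifHt (p : ZFSet.{u}) : Ordinal.{u} :=
  if hp : ∃ (α : Ordinal.{u}) (g : Ordinal.{u} → Ordinal.{u}), p = seqCode α fun ξ => (g ξ).toZFSet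
  then hp.choose else 0

open Classical in
/-- The values of a function from an ordinal to the ordinals. -/
def unifVal (p : ZFSet.{u}) : Ordinal.{u} → Ordinal.{u} :=
  if hp : ∃ (α : Ordinal.{u}) (g : Ordinal.{u} → Ordinal.{u}), p = seqCode α fun ξ => (g ξ).toZFSet
  then hp.choose_spec.choose else id

theorem unifHt_unifVal_seqCode (α : Ordinal.{u}) (g : Ordinal.{u} → Ordinal.{u}) :
    unifHt (seqCode α fun ξ => (g ξ).toZFSet) = α ∧
      ∀ ξ < α, unifVal (seqCode α fun ξ => (g ξ).toZFSet) ξ = g ξ := by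
  have hp : ∃ (α' : Ordinal.{u}) (g' : Ordinal.{u} → Ordinal.{u}),
      (seqCode α fun ξ => (g ξ).toZFSet) = seqCode α' fun ξ => (g' ξ).toZFSet := ⟨α, g, rfl⟩
  obtain ⟨h1, h2⟩ := seqCode_inj hp.choose_spec.choose_spec
  rw [unifHt, unifVal, dif_pos hp, dif_pos hp]
  exact ⟨h1.symm, fun ξ hξ => (Ordinal.toZFSet_injective (h2 ξ hξ)).symm⟩

theorem unifForcing_spec {p : ZFSet.{u}} (hp : p ∈ (unifForcing lam κ S C h).carrier) :
    unifHt p < κ.ord ∧ (∀ ξ < unifHt p, unifVal p ξ < lam.ord) ∧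
      p = seqCode (unifHt p) (fun ξ => (unifVal p ξ).toZFSet) ∧
      ∀ δ ∈ S, δ ≤ unifHt p → BoundedIn {β | β ∈ C δ ∧ h δ β ≠ unifVal p β} δ := by
  rw [unifForcing, ZFSet.mem_sep] at hp
  obtain ⟨-, α, hα, g, hg, rfl, hδ⟩ := hp
  obtain ⟨h1, h2⟩ := unifHt_unifVal_seqCode α g
  rw [h1]
  refine ⟨hα, fun ξ hξ => h2 ξ hξ ▸ hg ξ hξ,
    seqCode_congr fun ξ hξ => by rw [h2 ξ hξ], fun δ hδS hδα => ?_⟩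
  obtain ⟨β, hβ, hb⟩ := hδ δ hδS hδα
  exact ⟨β, hβ, fun x hx hxδ => hb x ⟨hx.1, h2 x (hxδ.trans_le hδα) ▸ hx.2⟩ hxδ⟩

theorem exists_unifForcing {α : Ordinal.{u}} (hα : α < κ.ord) {g : Ordinal.{u} → Ordinal.{u}}
    (hg : ∀ ξ < α, g ξ < lam.ord)
    (hδ : ∀ δ ∈ S, δ ≤ α → BoundedIn {β | β ∈ C δ ∧ h δ β ≠ g β} δ) :
    ∃ p ∈ (unifForcing lam κ S C h).carrier, unifHt p = α ∧ ∀ ξ < α, unifVal p ξ = g ξ := by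
  refine ⟨seqCode α fun ξ => (g ξ).toZFSet, ?_, unifHt_unifVal_seqCode α g⟩
  rw [unifForcing, ZFSet.mem_sep]
  exact ⟨seqCode_mem_powerset hα.le fun ξ hξ => Ordinal.toZFSet_mem_toZFSet_iff.2 (hg ξ hξ),
    α, hα, g, hg, rfl, hδ⟩

theorem unifForcing_le {p q : ZFSet.{u}} (hp : p ∈ (unifForcing lam κ S C h).carrier)
    (hq : q ∈ (unifForcing lam κ S C h).carrier) : (unifForcing lam κ S C h).le p q ↔
      unifHt p ≤ unifHt q ∧ ∀ ξ < unifHt p, unifVal p ξ = unifVal q ξ := by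
  have hpe := (unifForcing_spec hp).2.2.1
  have hqe := (unifForcing_spec hq).2.2.1
  change p ⊆ q ↔ _
  constructor
  · intro hpq
    have key : ∀ ξ < unifHt p, ξ < unifHt q ∧ unifVal p ξ = unifVal q ξ := by
      intro ξ hξ
      have h1 : ZFSet.pair ξ.toZFSet (unifVal p ξ).toZFSet ∈ p := by
        rw [hpe]
        obtain ⟨h2, h3⟩ := unifHt_unifVal_seqCode (unifHt p) (unifVal p)
        rw [h3 ξ hξ]
        exact pair_mem_seqCode.2 ⟨hξ, rfl⟩
      have h2 := hpq h1
      rw [hqe, pair_mem_seqCode] at h2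
      exact ⟨h2.1, (Ordinal.toZFSet_injective h2.2).symm⟩
    exact ⟨le_of_forall_lt fun ξ hξ => (key ξ hξ).1, fun ξ hξ => (key ξ hξ).2⟩
  · rintro ⟨h1, h2⟩ y hy
    rw [hpe] at hy
    obtain ⟨ξ, hξ, rfl⟩ := mem_seqCode.1 hy
    rw [hqe, pair_mem_seqCode]
    exact ⟨hξ.trans_le h1, by rw [h2 ξ hξ]⟩

theorem unifForcing_upper (hlam : lam ≠ 0) (A : Set ZFSet.{u})
    (hA : ∀ p ∈ A, p ∈ (unifForcing lam κ S C h).carrier)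
    (hchain : ∀ p ∈ A, ∀ q ∈ A,
      (unifForcing lam κ S C h).le p q ∨ (unifForcing lam κ S C h).le q p)
    (α : Ordinal.{u}) (hα : α < κ.ord) (hlub : IsLUB (unifHt '' A) α)
    (hS : α ∈ S → (∃ p ∈ A, unifHt p = α) ∨
      ∃ β < α, ∀ p ∈ A, {β | β ∈ C α ∧ β < unifHt p ∧ h α β ≠ unifVal p β} ⊆ Iic β) :
    ∃ b ∈ (unifForcing lam κ S C h).carrier,
      (∀ p ∈ A, (unifForcing lam κ S C h).le p b) ∧ unifHt b = α := by
  -- Conditions in a chain agree on common arguments, so their union is a function.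
  have hval : ∀ ξ, ∃ v < lam.ord, ∀ p ∈ A, ξ < unifHt p → unifVal p ξ = v := by
    intro ξ
    by_cases hex : ∃ p ∈ A, ξ < unifHt p
    · obtain ⟨p, hp, hξ⟩ := hex
      refine ⟨unifVal p ξ, (unifForcing_spec (hA p hp)).2.1 ξ hξ, fun q hq hξq => ?_⟩
      rcases hchain p hp q hq with hle | hle
      · exact (((unifForcing_le (hA p hp) (hA q hq)).1 hle).2 ξ hξ).symm
      · exact ((unifForcing_le (hA q hq) (hA p hp)).1 hle).2 ξ hξq
    · refine ⟨0, ?_, fun p hp hξ => absurd ⟨p, hp, hξ⟩ hex⟩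
      rw [Cardinal.lt_ord, Ordinal.card_zero]
      exact pos_iff_ne_zero.2 hlam
  choose v hvl hv using hval
  have hlt : ∀ ξ < α, ∃ p ∈ A, ξ < unifHt p := fun ξ hξ => by
    obtain ⟨_, ⟨p, hp, rfl⟩, h1⟩ := (lt_isLUB_iff hlub).1 hξ
    exact ⟨p, hp, h1⟩
  obtain ⟨b, hb, hht, hbv⟩ := exists_unifForcing (lam := lam) (S := S) (C := C) (h := h) hα
    (fun ξ _ => hvl ξ) (fun δ hδ hδα => by
      have hcase : (∃ p ∈ A, δ ≤ unifHt p) ∨ (δ = α ∧ ∃ β < α, ∀ p ∈ A,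
          {β | β ∈ C α ∧ β < unifHt p ∧ h α β ≠ unifVal p β} ⊆ Iic β) := by
        rcases hδα.eq_or_lt with rfl | h
        · rcases hS hδ with ⟨p, hp, h⟩ | h
          exacts [Or.inl ⟨p, hp, h.ge⟩, Or.inr ⟨rfl, h⟩]
        · obtain ⟨p, hp, hδp⟩ := hlt δ h
          exact Or.inl ⟨p, hp, hδp.le⟩
      rcases hcase with ⟨p, hp, hδp⟩ | ⟨rfl, β, hβ, hb⟩
      · obtain ⟨β, hβ, hb⟩ := (unifForcing_spec (hA p hp)).2.2.2 δ hδ hδp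
        exact ⟨β, hβ, fun x hx hxδ =>
          hb x ⟨hx.1, (hv x p hp (hxδ.trans_le hδp)).symm ▸ hx.2⟩ hxδ⟩
      · refine ⟨β, hβ, fun x hx hxδ => ?_⟩
        obtain ⟨p, hp, hxp⟩ := hlt x hxδ
        exact hb p hp ⟨hx.1, hxp, (hv x p hp hxp).symm ▸ hx.2⟩)
  refine ⟨b, hb, fun p hp => ?_, hht⟩
  have hle : unifHt p ≤ α := hlub.1 ⟨p, hp, rfl⟩
  rw [unifForcing_le (hA p hp) hb, hht]
  exact ⟨hle, fun ξ hξ => (hv ξ p hp hξ).trans (hbv ξ (hξ.trans_le hle)).symm⟩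

/-- There are at most `λ` ordinals up to `γ < λ⁺`; indexing them by ordinals below `λ` leaves fewer
than `λ` predecessors of each. -/
theorem exists_index (hlam : Cardinal.aleph0 < lam) {γ : Ordinal.{u}}
    (hγ : γ < (Order.succ lam).ord) :
    ∃ idx inv : Ordinal.{u} → Ordinal.{u},
      ∀ δ ≤ γ, idx δ < lam.ord ∧ inv (idx δ) = δ := by
  classical
  have hinf : Cardinal.aleph0 ≤ Order.succ lam := hlam.le.trans (Order.le_succ lam)
  have h1 : Cardinal.mk (Iic γ) ≤ Cardinal.mk (Iio lam.ord) := by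
    rw [Cardinal.mk_Iio_ordinal, Cardinal.card_ord, ← Order.Iio_succ, Cardinal.mk_Iio_ordinal,
      Cardinal.lift_le]
    exact Order.lt_succ_iff.1 (Cardinal.lt_ord.1 ((Cardinal.isSuccLimit_ord hinf).succ_lt hγ))
  obtain ⟨f⟩ := (Cardinal.le_def _ _).1 h1
  set idx : Ordinal.{u} → Ordinal.{u} := fun δ => if hδ : δ ≤ γ then (f ⟨δ, hδ⟩).1 else 0 with hidx
  have hidx' : ∀ δ (hδ : δ ≤ γ), idx δ = (f ⟨δ, hδ⟩).1 := fun δ hδ => dif_pos hδ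
  have hinj : InjOn idx (Iic γ) := by
    intro x hx y hy hxy
    rw [hidx' x hx, hidx' y hy] at hxy
    exact congrArg Subtype.val (f.injective (Subtype.ext hxy))
  refine ⟨idx, Function.invFunOn idx (Iic γ), fun δ hδ => ⟨?_, hinj.leftInvOn_invFunOn hδ⟩⟩
  rw [hidx' δ hδ]
  exact (f ⟨δ, hδ⟩).2

/-- The ladders `C δ`, for at most `lam` many `δ`, can be made disjoint from each other and from a
small set by omitting a bounded part of each. -/
theorem exists_disjointification (hlam : Cardinal.aleph0 < lam) (hS : S ⊆ cofSet κ lam)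
    (hC : IsLadderSystem lam S₀ S C) {γ : Ordinal.{u}} (hγ : γ < (Order.succ lam).ord)
    {T : Set Ordinal.{u}} (hT : IsSmall lam T) :
    ∃ b : Ordinal.{u} → Ordinal.{u}, (∀ δ ∈ S, δ ≤ γ → b δ < δ) ∧
      (∀ δ ∈ S, δ ≤ γ → ∀ ξ ∈ T, ξ < δ → ξ ≤ b δ) ∧
      ∀ δ ∈ S, δ ≤ γ → ∀ δ' ∈ S, δ' ≤ γ → ∀ ξ ∈ C δ, ξ ∈ C δ' → b δ < ξ → b δ' < ξ → δ = δ' := by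
  classical
  have h0 : lam ≠ 0 := (zero_le.trans_lt hlam).ne'
  obtain ⟨idx, inv, hidx⟩ := exists_index hlam hγ
  -- Two distinct ladders meet boundedly below `δ`: a ladder at `δ' < δ` lies below `δ'`, and one at
  -- `δ' > δ` has fewer than `λ` points below `δ`.
  have hpair : ∀ δ ∈ S, ∀ δ' ∈ S, δ' ≠ δ → ∃ β < δ, ∀ ξ ∈ C δ', ξ < δ → ξ ≤ β := by
    intro δ hδ δ' hδ' hne
    rcases lt_or_gt_of_ne hne with hlt | hlt
    · exact ⟨δ', hlt, fun ξ hξ _ => le_of_lt ((hC δ' hδ').1 hξ)⟩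
    · obtain ⟨β, hβ, hb⟩ := (hC.isSmall hδ' (isSuccLimit_of_cof_eq hlam (hS hδ').2) hlt).boundedIn
        (hS hδ).2 h0
      exact ⟨β, hβ, fun ξ hξ hξδ => hb ξ ⟨hξ, hξδ⟩ hξδ⟩
  choose! B hB hBle using hpair
  have hbound : ∀ δ ∈ S, δ ≤ γ → ∃ b < δ, (∀ ξ ∈ T, ξ < δ → ξ ≤ b) ∧
      ∀ δ' ∈ S, δ' ≤ γ → idx δ' < idx δ → ∀ ξ ∈ C δ', ξ < δ → ξ ≤ b := by
    intro δ hδ hδγ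
    have hδ0 : 0 < δ := (isSuccLimit_of_cof_eq hlam (hS hδ).2).bot_lt
    obtain ⟨b₁, hb₁, h1⟩ := hT.boundedIn (hS hδ).2 h0
    -- Only ladders of smaller index are avoided at `δ`; they are fewer than `λ = cf δ`, so one
    -- bound works for all. Indices `ξ` with `inv ξ` outside `S` or equal to `δ` get the harmless
    -- value `0`.
    obtain ⟨b₂, hb₂, h2⟩ := exists_bound_of_lt_cof (hS hδ).2 h0 (hidx δ hδγ).1
      (fun ξ => if inv ξ ∈ S ∧ inv ξ ≠ δ then B δ (inv ξ) else 0) fun ξ _ => by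
        split_ifs with hc
        exacts [hB δ hδ _ hc.1 hc.2, hδ0]
    refine ⟨max b₁ b₂, max_lt hb₁ hb₂, fun ξ hξ hξδ => (h1 ξ hξ hξδ).trans (le_max_left _ _),
      fun δ' hδ' hδ'γ hlt ξ hξ hξδ => ?_⟩
    have hne : δ' ≠ δ := by
      rintro rfl
      exact hlt.false
    have h3 := h2 (idx δ') hlt
    rw [(hidx δ' hδ'γ).2, if_pos ⟨hδ', hne⟩] at h3
    exact ((hBle δ hδ δ' hδ' hne ξ hξ hξδ).trans h3).trans (le_max_right _ _)
  choose! b hb hbT hbC using hbound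
  refine ⟨b, hb, hbT, fun δ hδ hδγ δ' hδ' hδ'γ ξ hξ hξ' h1 h2 => ?_⟩
  rcases lt_trichotomy (idx δ) (idx δ') with hlt | heq | hlt
  · exact absurd (hbC δ' hδ' hδ'γ δ hδ hδγ hlt ξ hξ ((hC δ' hδ').1 hξ')) h2.not_ge
  · rw [← (hidx δ hδγ).2, heq, (hidx δ' hδ'γ).2]
  · exact absurd (hbC δ hδ hδγ δ' hδ' hδ'γ hlt ξ hξ' ((hC δ hδ).1 hξ)) h1.not_ge

/-- Above the domain of `p`, follow `g` on `T` and `h δ` on the tail of `C δ` beyond `b δ`.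
Disjointness of these tails, and of the tails from `T` below `γ`, makes the prescriptions
compatible. -/
theorem unifForcing_extend (hlam : Cardinal.aleph0 < lam) (hκ : κ = Order.succ lam)
    (hS : S ⊆ cofSet κ lam) (hC : IsLadderSystem lam S₀ S C)
    (hh : ∀ δ ∈ S, ∀ β ∈ C δ, h δ β < lam.ord) {p : ZFSet.{u}}
    (hp : p ∈ (unifForcing lam κ S C h).carrier) {γ : Ordinal.{u}} (hγ : γ < κ.ord)
    (hpγ : unifHt p < γ) {T : Set Ordinal.{u}} {g : Ordinal.{u} → Ordinal.{u}}
    (hT : IsSmall lam (T ∩ Iio γ)) (hg : ∀ β ∈ T, β < γ → g β < lam.ord) :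
    ∃ q ∈ (unifForcing lam κ S C h).carrier, (unifForcing lam κ S C h).le p q ∧ unifHt q = γ ∧
      ∀ β ∈ T, unifHt p ≤ β → β < γ → unifVal q β = g β := by
  classical
  obtain ⟨b, hb, hbT, hbC⟩ := exists_disjointification hlam hS hC (hκ ▸ hγ) hT
  obtain ⟨-, hpv, -, hpδ⟩ := unifForcing_spec hp
  have h0 : (0 : Ordinal.{u}) < lam.ord := (isSuccLimit_ord hlam).bot_lt
  let P : Ordinal.{u} → Ordinal.{u} → Prop := fun ξ δ => δ ∈ S ∧ δ ≤ γ ∧ ξ ∈ C δ ∧ b δ < ξ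
  let v : Ordinal.{u} → Ordinal.{u} := fun ξ =>
    if ξ < unifHt p then unifVal p ξ else if ξ ∈ T then g ξ else
      if hex : ∃ δ, P ξ δ then h hex.choose ξ else 0
  have hv1 : ∀ ξ < unifHt p, v ξ = unifVal p ξ := fun ξ hξ => if_pos hξ
  have hv2 : ∀ ξ, unifHt p ≤ ξ → ξ ∈ T → v ξ = g ξ := fun ξ hξ hξT =>
    (if_neg hξ.not_gt).trans (if_pos hξT)
  have hv3 : ∀ ξ δ, unifHt p ≤ ξ → ξ ∉ T → P ξ δ → v ξ = h δ ξ := by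
    intro ξ δ hξ hξT hP
    have hex : ∃ δ, P ξ δ := ⟨δ, hP⟩
    have h1 : v ξ = h hex.choose ξ := ((if_neg hξ.not_gt).trans (if_neg hξT)).trans (dif_pos hex)
    have h2 := hex.choose_spec
    rw [h1, hbC _ h2.1 h2.2.1 δ hP.1 hP.2.1 ξ h2.2.2.1 hP.2.2.1 h2.2.2.2 hP.2.2.2]
  have hvl : ∀ ξ < γ, v ξ < lam.ord := by
    intro ξ hξ
    by_cases h1 : ξ < unifHt p
    · rw [hv1 ξ h1]
      exact hpv ξ h1
    push Not at h1
    by_cases h2 : ξ ∈ T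
    · rw [hv2 ξ h1 h2]
      exact hg ξ h2 hξ
    by_cases h3 : ∃ δ, P ξ δ
    · obtain ⟨δ, hP⟩ := h3
      rw [hv3 ξ δ h1 h2 hP]
      exact hh δ hP.1 ξ hP.2.2.1
    · have h4 : v ξ = 0 := ((if_neg h1.not_gt).trans (if_neg h2)).trans (dif_neg h3)
      rwa [h4]
  obtain ⟨q, hq, hqh, hqv⟩ := exists_unifForcing (S := S) (C := C) (h := h) hγ hvl
    fun δ hδ hδγ => by
      rcases le_or_gt δ (unifHt p) with hle | hlt
      · obtain ⟨β, hβ, hbd⟩ := hpδ δ hδ hle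
        exact ⟨β, hβ, fun x hx hxδ => hbd x ⟨hx.1, hv1 x (hxδ.trans_le hle) ▸ hx.2⟩ hxδ⟩
      -- Beyond the old domain and the omitted part of `C δ`, the new function equals `h δ` on the
      -- ladder.
      · refine ⟨max (unifHt p) (b δ), max_lt hlt (hb δ hδ hδγ), fun x hx hxδ => ?_⟩
        by_contra! hmax
        obtain ⟨h1, h2⟩ := max_lt_iff.1 hmax
        refine hx.2 (hv3 x δ h1.le (fun hxT => ?_) ⟨hδ, hδγ, hx.1, h2⟩).symm
        exact (hbT δ hδ hδγ x ⟨hxT, hxδ.trans_le hδγ⟩ hxδ).not_gt h2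
  refine ⟨q, hq, ?_, hqh, fun β hβT hpβ hβγ => (hqv β hβγ).trans (hv2 β hpβ hβT)⟩
  rw [unifForcing_le hp hq, hqh]
  exact ⟨hpγ.le, fun ξ hξ => ((hqv ξ (hξ.trans hpγ)).trans (hv1 ξ hξ)).symm⟩

/-- A violation is a disagreement with `g` on `T` inside the domain. Unions create none, since each
argument already belongs to the domain of a member of the chain. -/
theorem isLadderForcing_unifForcing (hlam : Cardinal.aleph0 < lam) (hκ : κ = Order.succ lam)
    (hS : S ⊆ cofSet κ lam) (hC : IsLadderSystem lam S₀ S C)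
    (hh : ∀ δ ∈ S, ∀ β ∈ C δ, h δ β < lam.ord) :
    IsLadderForcing lam κ S C h (unifForcing lam κ S C h) unifHt
      fun p T g => {β | β ∈ T ∧ β < unifHt p ∧ g β ≠ unifVal p β} where
  nonempty := by
    have hκ0 : (0 : Ordinal.{u}) < κ.ord := by
      rw [Cardinal.lt_ord, Ordinal.card_zero, hκ]
      exact zero_le.trans_lt (Order.lt_succ lam)
    obtain ⟨p, hp, -⟩ := exists_unifForcing (lam := lam) (S := S) (C := C) (h := h) hκ0
      (g := id) (fun ξ hξ => absurd hξ not_lt_zero) fun δ hδ hδ0 =>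
        absurd (le_antisymm hδ0 zero_le) (isSuccLimit_of_cof_eq hlam (hS hδ).2).ne_bot
    exact ⟨p, hp⟩
  ht_lt p hp := (unifForcing_spec hp).1
  ht_mono p hp q hq hpq := ((unifForcing_le hp hq).1 hpq).1
  bad_mem p hp T g β hβ := ⟨hβ.1, hβ.2.1.le⟩
  bad_of_le p hp q hq hpq T g β hβ := by
    rcases lt_or_ge β (unifHt p) with h1 | h1
    · exact Or.inl ⟨hβ.1, h1, ((unifForcing_le hp hq).1 hpq).2 β h1 ▸ hβ.2.2⟩
    · exact Or.inr h1
  bad_local p hp γ hγ T T' g g' _ hT hg β hβ := by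
    have hβγ := hβ.2.1.trans_le hγ
    exact ⟨(hT.subset ⟨hβ.1, hβγ⟩).1, hβ.2.1, hg β hβ.1 hβγ ▸ hβ.2.2⟩
  upper A _ hA hchain α hα hlub hαS := by
    obtain ⟨b, hb, hub, hht⟩ := unifForcing_upper (zero_le.trans_lt hlam).ne' A hA hchain α hα
      hlub hαS
    refine ⟨b, hb, hub, hht, fun T g β hβ => Or.inl ?_⟩
    obtain ⟨_, ⟨p, hp, rfl⟩, hβp⟩ := (lt_isLUB_iff hlub).1 (hht ▸ hβ.2.1)
    exact ⟨p, hp, hβ.1, hβp, ((unifForcing_le (hA p hp) hb).1 (hub p hp)).2 β hβp ▸ hβ.2.2⟩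
  extend p hp γ hγ hpγ T g _ hT hg := by
    obtain ⟨q, hq, hpq, hht, hqv⟩ := unifForcing_extend hlam hκ hS hC hh hp hγ hpγ hT hg
    refine ⟨q, hq, hpq, hht, fun β hβ => ?_⟩
    rcases lt_or_ge β (unifHt p) with h1 | h1
    · exact ⟨hβ.1, h1, ((unifForcing_le hp hq).1 hpq).2 β h1 ▸ hβ.2.2⟩
    · exact absurd (hqv β hβ.1 h1 (hht ▸ hβ.2.1)).symm hβ.2.2

end unifForcing

/-! ### The forcing relation -/

section forcing

variable {Q : ForcingNotion.{u}}

theorem ForcingNotion.le_trans' {p q r : Q.Cond} (h : Q.le p.1 q.1) (h' : Q.le q.1 r.1) :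
    Q.le p.1 r.1 := Q.le_trans _ p.2 _ q.2 _ r.2 h h'

theorem ForcingNotion.le_refl' (p : Q.Cond) : Q.le p.1 p.1 := Q.le_refl _ p.2

theorem Below.mono {c : Set Q.Cond} {p q : Q.Cond} (hpq : Q.le p.1 q.1) (h : Below c p) :
    Below c q := by
  obtain ⟨s, hs, h⟩ := h
  exact ⟨s, hs, Q.le_trans' h hpq⟩

theorem below_univ (p : Q.Cond) : Below univ p := ⟨p, mem_univ _, Q.le_refl' p⟩

theorem fEq_mono {x y : FName Q} {p q : Q.Cond} (hpq : Q.le p.1 q.1) (h : fEq x y p) :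
    fEq x y q := by
  cases x
  cases y
  rw [fEq] at h ⊢
  exact ⟨fun i r hr => h.1 i r (Q.le_trans' hpq hr), fun j r hr => h.2 j r (Q.le_trans' hpq hr)⟩

theorem fMem_mono {x y : FName Q} {p q : Q.Cond} (hpq : Q.le p.1 q.1) (h : fMem x y p) :
    fMem x y q := by
  cases y
  rw [fMem] at h ⊢
  exact fun r hr => h r (Q.le_trans' hpq hr)

theorem fEq_refl (x : FName Q) (p : Q.Cond) : fEq x x p := by
  induction x generalizing p with
  | mk ι A c ih =>
    rw [fEq]
    exact ⟨fun i q _ hq => ⟨q, Q.le_refl' q, i, hq, ih i q⟩,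
      fun i q _ hq => ⟨q, Q.le_refl' q, i, hq, ih i q⟩⟩

theorem fEq_symm {x y : FName Q} {p : Q.Cond} (h : fEq x y p) : fEq y x p := by
  induction x generalizing y p with
  | mk ι A c ih =>
    cases y
    rw [fEq] at h ⊢
    refine ⟨fun j q hq hj => ?_, fun i q hq hi => ?_⟩
    · obtain ⟨r, hr, i, hi, h1⟩ := h.2 j q hq hj
      exact ⟨r, hr, i, hi, ih i h1⟩
    · obtain ⟨r, hr, j, hj, h1⟩ := h.1 i q hq hi
      exact ⟨r, hr, j, hj, ih i h1⟩

theorem fEq_trans {x y z : FName Q} {p : Q.Cond} (h : fEq x y p) (h' : fEq y z p) :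
    fEq x z p := by
  induction x generalizing y z p with
  | mk ι A c ih =>
    cases y
    cases z
    rw [fEq] at h h' ⊢
    refine ⟨fun i q hq hi => ?_, fun k q hq hk => ?_⟩
    · obtain ⟨r, hr, j, hj, h1⟩ := h.1 i q hq hi
      obtain ⟨r', hr', k, hk, h2⟩ := h'.1 j r (Q.le_trans' hq hr) hj
      exact ⟨r', Q.le_trans' hr hr', k, hk, ih i (fEq_mono hr' h1) h2⟩
    · obtain ⟨r, hr, j, hj, h1⟩ := h'.2 k q hq hk
      obtain ⟨r', hr', i, hi, h2⟩ := h.2 j r (Q.le_trans' hq hr) hj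
      exact ⟨r', Q.le_trans' hr hr', i, hi, ih i h2 (fEq_mono hr' h1)⟩

theorem fMem_congr_left {x x' y : FName Q} {p : Q.Cond} (h : fMem x y p) (hx : fEq x x' p) :
    fMem x' y p := by
  cases y
  rw [fMem] at h ⊢
  intro q hq
  obtain ⟨r, hr, j, hj, h1⟩ := h q hq
  exact ⟨r, hr, j, hj, fEq_trans (fEq_symm (fEq_mono (Q.le_trans' hq hr) hx)) h1⟩

theorem fMem_congr_right {x y y' : FName Q} {p : Q.Cond} (h : fMem x y p) (hy : fEq y y' p) :
    fMem x y' p := by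
  cases y
  cases y'
  rw [fMem] at h ⊢
  rw [fEq] at hy
  intro q hq
  obtain ⟨r, hr, j, hj, h1⟩ := h q hq
  obtain ⟨r', hr', k, hk, h2⟩ := hy.1 j r (Q.le_trans' hq hr) hj
  exact ⟨r', Q.le_trans' hr hr', k, hk, fEq_trans (fEq_mono hr' h1) h2⟩

theorem fMem_check {x : FName Q} {a : ZFSet.{u}} {p : Q.Cond} (h : fMem x (check Q a) p) :
    ∃ r : Q.Cond, Q.le p.1 r.1 ∧ ∃ b ∈ a, fEq x (check Q b) r := by
  rw [check, fMem] at h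
  obtain ⟨r, hr, j, -, h1⟩ := h p (Q.le_refl' p)
  exact ⟨r, hr, _, ((equivShrink a).symm j).2, h1⟩

theorem fMem_check_of_fEq {x : FName Q} {a b : ZFSet.{u}} {p : Q.Cond} (hb : b ∈ a)
    (h : fEq x (check Q b) p) : fMem x (check Q a) p := by
  rw [check, fMem]
  intro q hq
  refine ⟨q, Q.le_refl' q, equivShrink a ⟨b, hb⟩, below_univ q, ?_⟩
  rw [Equiv.symm_apply_apply]
  exact fEq_mono hq h

theorem fMem_check_check_of_mem {a b : ZFSet.{u}} (hb : b ∈ a) (p : Q.Cond) :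
    fMem (check Q b) (check Q a) p := fMem_check_of_fEq hb (fEq_refl _ _)

/-- By `∈`-induction: equality of standard names cannot be forced by any condition unless it is
true. -/
theorem eq_of_fEq_check {a b : ZFSet.{u}} {p : Q.Cond} (h : fEq (check Q a) (check Q b) p) :
    a = b := by
  induction a using ZFSet.inductionOn generalizing b p with
  | _ a ih =>
    ext y
    constructor
    · intro hy
      obtain ⟨r, -, z, hz, h1⟩ := fMem_check (fMem_congr_right (fMem_check_check_of_mem hy p) h)
      exact ih y hy h1 ▸ hz
    · intro hy
      obtain ⟨r, -, z, hz, h1⟩ :=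
        fMem_check (fMem_congr_right (fMem_check_check_of_mem hy p) (fEq_symm h))
      exact ih z hz (fEq_symm h1) ▸ hz

theorem mem_of_fMem_check {a b : ZFSet.{u}} {p : Q.Cond} (h : fMem (check Q b) (check Q a) p) :
    b ∈ a := by
  obtain ⟨r, -, z, hz, h1⟩ := fMem_check h
  exact eq_of_fEq_check h1 ▸ hz

theorem fMem_genericUnion {x : FName Q} {k : ZFSet.{u}} {p : Q.Cond}
    (h : fMem x (genericUnion Q k) p) :
    ∃ r : Q.Cond, Q.le p.1 r.1 ∧ ∃ b ∈ k, (∃ s : Q.Cond, Q.le s.1 r.1 ∧ b ∈ s.1) ∧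
      fEq x (check Q b) r := by
  rw [genericUnion, fMem] at h
  obtain ⟨r, hr, j, ⟨s, hs, hsr⟩, h1⟩ := h p (Q.le_refl' p)
  exact ⟨r, hr, _, ((equivShrink k).symm j).2, ⟨s, hsr, hs⟩, h1⟩

theorem fMem_genericUnion_of_fEq {x : FName Q} {k b : ZFSet.{u}} {p : Q.Cond} (hbk : b ∈ k)
    (hb : b ∈ p.1) (h : fEq x (check Q b) p) : fMem x (genericUnion Q k) p := by
  rw [genericUnion, fMem]
  intro q hq
  refine ⟨q, Q.le_refl' q, equivShrink k ⟨b, hbk⟩, ⟨p, ?_, hq⟩, ?_⟩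
  · rw [mem_ofPred_eq, Equiv.symm_apply_apply]
    exact hb
  · rw [Equiv.symm_apply_apply]
    exact fEq_mono hq h

/-- Implication and existence are defined through negation, so their conclusions have to be reached
only densely, by a further extension. -/
theorem fImp_intro {A B : Stmt Q} {p : Q.Cond}
    (h : ∀ q : Q.Cond, Q.le p.1 q.1 → A q → ∃ r : Q.Cond, Q.le q.1 r.1 ∧ B r) : fImp A B p := by
  rintro q hq ⟨hA, hB⟩
  obtain ⟨r, hr, h1⟩ := h q hq hA
  exact hB r hr h1

theorem fImp_elim {A B : Stmt Q} {p q : Q.Cond} (h : fImp A B p) (hq : Q.le p.1 q.1) (hA : A q) :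
    ∃ r : Q.Cond, Q.le q.1 r.1 ∧ B r := by
  have h1 := h q hq
  simp only [fAnd, fNot, not_and, not_forall, not_not] at h1
  obtain ⟨r, hr, h2⟩ := h1 hA
  exact ⟨r, hr, h2⟩

theorem fEx_intro {A : FName Q → Stmt Q} {p : Q.Cond}
    (h : ∀ q : Q.Cond, Q.le p.1 q.1 → ∃ r : Q.Cond, Q.le q.1 r.1 ∧ ∃ x, A x r) : fEx A p := by
  intro q hq hA
  obtain ⟨r, hr, x, h1⟩ := h q hq
  exact hA x r hr h1

theorem fEx_elim {A : FName Q → Stmt Q} {p : Q.Cond} (h : fEx A p) :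
    ∃ r : Q.Cond, Q.le p.1 r.1 ∧ ∃ x, A x r := by
  have h1 := h p (Q.le_refl' p)
  simp only [fAll, fNot, not_forall, not_not] at h1
  obtain ⟨x, r, hr, h1⟩ := h1
  exact ⟨r, hr, x, h1⟩

end forcing

/-! ### The club added by the club-adding forcing -/

section addsClub

variable {lam κ : Cardinal.{u}} {S₀ S : Set Ordinal.{u}} {C : Ordinal.{u} → Set Ordinal.{u}}

theorem exists_cond_above (hκ : Cardinal.aleph0 ≤ κ) (p : (clubForcing κ S C).Cond)
    {α : Ordinal.{u}} (hα : α < κ.ord) : ∃ q : (clubForcing κ S C).Cond,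
      (clubForcing κ S C).le p.1 q.1 ∧ ∃ γ, α < γ ∧ γ < κ.ord ∧ γ ∈ ordSet q.1 := by
  have hγ : Order.succ (max α (clubHt p.1)) < κ.ord :=
    (Cardinal.isSuccLimit_ord hκ).succ_lt (max_lt hα (mem_clubForcing.1 p.2).2.2.2.1)
  obtain ⟨q, hq, hpq, -, hset⟩ := exists_clubForcing_extension p.2 hγ
    ((le_max_right _ _).trans_lt (Order.lt_succ _))
  exact ⟨⟨q, hq⟩, hpq, _, (le_max_left _ _).trans_lt (Order.lt_succ _), hγ, hset ▸ mem_insert _ _⟩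

/-- A condition containing `γ` has decided the generic set below `γ`, since stronger conditions are
end-extensions. -/
theorem mem_of_le_of_lt {p q : (clubForcing κ S C).Cond} (hpq : (clubForcing κ S C).le p.1 q.1)
    {x γ : Ordinal.{u}} (hγ : γ ∈ ordSet p.1) (hx : x ∈ ordSet q.1) (hxγ : x < γ) :
    x ∈ ordSet p.1 := by
  by_contra hxp
  exact (((clubForcing_le p.2 q.2).1 hpq).2 x hx hxp γ hγ).not_gt hxγ

theorem fMem_genericUnion_clubForcing {x : FName (clubForcing κ S C)}
    {p : (clubForcing κ S C).Cond}
    (h : fMem x (genericUnion (clubForcing κ S C) κ.ord.toZFSet) p) :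
    ∃ r : (clubForcing κ S C).Cond, (clubForcing κ S C).le p.1 r.1 ∧
      ∃ α < κ.ord, α ∈ ordSet r.1 ∧ fEq x (check _ α.toZFSet) r := by
  obtain ⟨r, hr, b, hb, ⟨s, hsr, hbs⟩, h1⟩ := fMem_genericUnion h
  obtain ⟨α, hα, rfl⟩ := Ordinal.mem_toZFSet_iff.1 hb
  exact ⟨r, hr, α, hα, hsr.1 hbs, h1⟩

theorem forced_isClub (hκ : Cardinal.aleph0 ≤ κ) :
    Forced (fIsClubIn (genericUnion (clubForcing κ S C) κ.ord.toZFSet)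
      (check (clubForcing κ S C) κ.ord.toZFSet)) := by
  set Q := clubForcing κ S C with hQ
  intro p
  refine ⟨fun x => fImp_intro fun q _ hxq => ?_, fun x => fImp_intro fun q _ hxq => ?_,
    fun x => fImp_intro fun q _ hxq => ?_⟩
  · obtain ⟨r, hr, α, hα, -, h1⟩ := fMem_genericUnion_clubForcing hxq
    exact ⟨r, hr, fMem_check_of_fEq (Ordinal.toZFSet_mem_toZFSet_iff.2 hα) h1⟩
  · obtain ⟨r, hr, b, hb, h1⟩ := fMem_check hxq
    obtain ⟨α, hα, rfl⟩ := Ordinal.mem_toZFSet_iff.1 hb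
    obtain ⟨r', hr', γ, hαγ, hγ, hγr⟩ := exists_cond_above hκ r hα
    refine ⟨r', Q.le_trans' hr hr', fEx_intro fun s hs => ⟨s, Q.le_refl' s, check Q γ.toZFSet,
      fMem_mono hs (fMem_genericUnion_of_fEq (Ordinal.toZFSet_mem_toZFSet_iff.2 hγ) hγr
        (fEq_refl _ _)), fMem_check_of_fEq (Ordinal.toZFSet_mem_toZFSet_iff.2 hαγ)
          (fEq_mono (Q.le_trans' hr' hs) h1)⟩⟩
  · obtain ⟨hxk, hne, hlim⟩ := hxq
    obtain ⟨r₀, hr₀, b, hb, h1⟩ := fMem_check hxk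
    obtain ⟨α, hα, rfl⟩ := Ordinal.mem_toZFSet_iff.1 hb
    -- With a point `γ > α` in `r`, everything forced into the generic set below `α` is already in
    -- `r`; closedness of `r` as a set of ordinals then gives `α ∈ r`.
    obtain ⟨r, hr, γ, hαγ, hγ, hγr⟩ := exists_cond_above hκ r₀ hα
    have hqr := Q.le_trans' hr₀ hr
    have hxr : fEq x (check Q α.toZFSet) r := fEq_mono hr h1
    have hlim' : ∀ β < α, ∃ ζ ∈ ordSet r.1, β < ζ ∧ ζ < α := by
      intro β hβ
      have hβx : fMem (check Q β.toZFSet) x r :=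
        fMem_congr_right (fMem_check_check_of_mem (Ordinal.toZFSet_mem_toZFSet_iff.2 hβ) r)
          (fEq_symm hxr)
      obtain ⟨s, hs, h2⟩ := fImp_elim (hlim (check Q β.toZFSet)) hqr hβx
      obtain ⟨s₁, hs₁, z, hzE, hβz, hzx⟩ := fEx_elim h2
      obtain ⟨s₂, hs₂, ζ, hζ, hζs, hz⟩ := fMem_genericUnion_clubForcing hzE
      have h3 := mem_of_fMem_check (fMem_congr_right (fMem_mono hs₂ hβz) hz)
      have hrs := Q.le_trans' (Q.le_trans' hs hs₁) hs₂
      have h4 := mem_of_fMem_check (fMem_congr_left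
        (fMem_congr_right (fMem_mono hs₂ hzx) (fEq_mono hrs hxr)) hz)
      rw [Ordinal.toZFSet_mem_toZFSet_iff] at h3 h4
      exact ⟨ζ, mem_of_le_of_lt hrs hγr hζs (h4.trans hαγ), h3, h4⟩
    have hα0 : α ≠ 0 := by
      rintro rfl
      obtain ⟨s, hs, y, hy⟩ := fEx_elim (p := r) (fun s hs => hne s (Q.le_trans' hqr hs))
      obtain ⟨s', -, c, hc, -⟩ := fMem_check (fMem_congr_right hy (fEq_mono hs hxr))
      obtain ⟨ζ, hζ, -⟩ := Ordinal.mem_toZFSet_iff.1 hc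
      exact not_lt_zero hζ
    have hαr : α ∈ ordSet r.1 := by
      have hcl : IsClosed (ordSet r.1) := (mem_clubForcing.1 r.2).2.2.1
      have hlub : IsLUB (ordSet r.1 ∩ Iio α) α := by
        refine ⟨fun y hy => le_of_lt hy.2, fun b hb => ?_⟩
        by_contra! hbα
        obtain ⟨ζ, hζ, h2, h3⟩ := hlim' b hbα
        exact (hb ⟨hζ, h3⟩).not_gt h2
      obtain ⟨ζ, hζ, -, h3⟩ := hlim' 0 (pos_iff_ne_zero.2 hα0)
      exact hcl.closure_subset_iff.2 inter_subset_left (hlub.mem_closure ⟨ζ, hζ, h3⟩)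
    exact ⟨r, hqr, fMem_genericUnion_of_fEq (Ordinal.toZFSet_mem_toZFSet_iff.2 hα) hαr hxr⟩

theorem forced_interBounded (hκ : Cardinal.aleph0 ≤ κ) {δ : Ordinal.{u}} (hδ : δ ∈ S)
    (hδκ : δ < κ.ord) (hlim : Order.IsSuccLimit δ) :
    Forced (fInterBounded (genericUnion (clubForcing κ S C) κ.ord.toZFSet)
      (check (clubForcing κ S C) (subsetCode δ (nacc (C δ))))
      (check (clubForcing κ S C) δ.toZFSet)) := by
  set Q := clubForcing κ S C with hQ
  intro p
  refine fEx_intro fun q _ => ?_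
  -- A point above `δ` makes `r` subject to the requirement at `δ` and decides the generic set below
  -- `δ`.
  obtain ⟨r, hr, γ, hδγ, hγ, hγr⟩ := exists_cond_above hκ q hδκ
  obtain ⟨β, hβ, hb⟩ := (mem_clubForcing.1 r.2).2.2.2.2 δ hδ (hδγ.le.trans (le_clubHt r.2 hγr))
  -- The bound is used as a set whose elements are smaller ordinals, so `β` is replaced by its
  -- successor, still below the limit `δ`.
  refine ⟨r, hr, check Q (Order.succ β).toZFSet,
    fMem_check_check_of_mem (Ordinal.toZFSet_mem_toZFSet_iff.2 (hlim.succ_lt hβ)) r,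
    fun x => fImp_intro fun s hs hx => ?_⟩
  obtain ⟨s₁, hs₁, ζ, hζ, hζs, h1⟩ := fMem_genericUnion_clubForcing hx.1
  obtain ⟨s₂, hs₂, c, hc, h2⟩ := fMem_check (fMem_mono hs₁ hx.2)
  obtain ⟨η, hη, hηδ, rfl⟩ := mem_subsetCode.1 hc
  obtain rfl := Ordinal.toZFSet_injective
    (eq_of_fEq_check (fEq_trans (fEq_symm (fEq_mono hs₂ h1)) h2))
  have hζr := mem_of_le_of_lt (Q.le_trans' hs hs₁) hγr hζs (hηδ.trans hδγ)
  exact ⟨s₂, Q.le_trans' hs₁ hs₂, fMem_check_of_fEq (Ordinal.toZFSet_mem_toZFSet_iff.2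
    (Order.lt_succ_of_le (hb ζ ⟨hζr, hη⟩ hηδ))) h2⟩

end addsClub

end ReallyComplete
end

/-! ### The main theorem -/

theorem mainTheorem12
    (lam κ : Cardinal.{u}) (hlam : Cardinal.aleph0 < lam) (hpow : Cardinal.powerlt lam lam = lam)
    (hκ : κ = Order.succ lam)
    (S₀ S : Set Ordinal.{u})
    (hS₀ : S₀ ⊆ ReallyComplete.cofSet κ lam)
    (hS₀stat : IsStationary {x : Set.Iio κ.ord | x.1 ∈ S₀})
    (hS : S = ReallyComplete.cofSet κ lam \ S₀)
    (C : Ordinal.{u} → Set Ordinal.{u})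
    (hC : ReallyComplete.IsLadderSystem lam S₀ S C)
    (h : Ordinal.{u} → Ordinal.{u} → Ordinal.{u})
    (hh : ∀ δ ∈ S, ∀ β ∈ C δ, h δ β < lam.ord)
    (D : ReallyComplete.OrdSetSeq lam → Filter (Set.Iio lam.ord))
    (hD : ∀ a ∈ ReallyComplete.seqFamily lam κ S₀,
      D a = ReallyComplete.clubFilter lam ∨ ReallyComplete.IsNormalFilter lam (D a)) :
    ReallyComplete.IsReallyComplete lam κ κ (ReallyComplete.asFamily S₀)
      (ReallyComplete.seqFamily lam κ S₀) D (ReallyComplete.clubForcing κ S C) ∧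
    ReallyComplete.IsReallyComplete lam κ κ (ReallyComplete.asFamily S₀)
      (ReallyComplete.seqFamily lam κ S₀) D (ReallyComplete.unifForcing lam κ S C h) ∧
    ReallyComplete.AddsClubAvoiding κ S C (ReallyComplete.clubForcing κ S C) := by
  have hreg := ReallyComplete.isRegular_of_powerlt_eq hlam hpow
  have hSc : S ⊆ ReallyComplete.cofSet κ lam := hS ▸ Set.sdiff_subset
  have hdisj : ∀ δ ∈ S₀, δ ∉ S := fun δ hδ hδS => (hS ▸ hδS).2 hδ
  have hlim : ∀ δ ∈ S, Order.IsSuccLimit δ := fun δ hδ =>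
    ReallyComplete.isSuccLimit_of_cof_eq hlam (hSc hδ).2
  have hκ0 : Cardinal.aleph0 ≤ κ := hκ ▸ hlam.le.trans (Order.le_succ lam)
  refine ⟨?_, ?_, ReallyComplete.forced_isClub hκ0, fun δ hδ =>
    ReallyComplete.forced_interBounded hκ0 hδ (hSc hδ).1 (hlim δ hδ)⟩
  · exact (ReallyComplete.isLadderForcing_clubForcing h (Cardinal.aleph0_pos.trans_le hκ0).ne'
      fun δ hδ => (hlim δ hδ).ne_bot).isReallyComplete hreg hlam hκ hS₀ hSc hdisj hC hh D hD
  · exact (ReallyComplete.isLadderForcing_unifForcing hlam hκ hSc hC hh).isReallyComplete hreg hlam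
      hκ hS₀ hSc hdisj hC hh D hD
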